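/- Let $b_1,b_2>0$ and let $a(x)=b_1^{-2}$ for $x<0$, $a(x)=b_2^{-2}$ for $x>0$. For $u:\mathbb{Z}\to\mathbb{C}$ put $$\partial(a\partial u)(j)=a(j+\tfrac12)u(j+1)-\big(a(j+\tfrac12)+a(j-\tfrac12)\big)u(j)+a(j-\tfrac12)u(j-1),\qquad j\in\mathbb{Z},$$ that is, $b_1^{-2}(u(j+1)-2u(j)+u(j-1))$ for $j\le -1$, $\;b_2^{-2}(u(j+1)-2u(j)+u(j-1))$ for $j\ge 1$, and $b_1^{-2}u(-1)-(b_1^{-2}+b_2^{-2})u(0)+b_2^{-2}u(1)$ for $j=0$. Consider the system $$i\,u_t(t,j)+\partial(a\partial u(t,\cdot))(j)=0\quad (j\in\mathbb{Z},\ t\neq 0),\qquad u(0,j)=\varphi(j)\quad (j\in\mathbb{Z}).\tag{1}$$ For every $\varphi\in l^2(\mathbb{Z})$ there exists a unique solution $u\in C(\mathbb{R},l^2(\mathbb{Z}))$ of (1). Moreover, there exists a positive constant $C(b_1,b_2)$, depending only on $b_1$ and $b_2$, such that for every $\varphi\in l^1(\mathbb{Z})$ the solution $u$ of (1) satisfies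 $$\|u(t)\|_{l^\infty(\mathbb{Z})}\le C(b_1,b_2)\,(|t|+1)^{-1/3}\,\|\varphi\|_{l^1(\mathbb{Z})}\qquad\text{for all } t\in\mathbb{R}.$$ -/

import Mathlib

open scoped ENNReal

/-- The step coefficient `a(x) = b₁⁻²` for `x < 0` and `a(x) = b₂⁻²` for `x > 0`. The value at
`x = 0` is irrelevant: below, `a` is only evaluated at half-integers. -/
noncomputable def stepCoeff (b₁ b₂ : ℝ) (x : ℝ) : ℝ :=
  if x < 0 then (b₁ ^ 2)⁻¹ else (b₂ ^ 2)⁻¹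

/-- The second order difference operator
`∂(a∂u)(j) = a(j+1/2) u(j+1) - (a(j+1/2) + a(j-1/2)) u(j) + a(j-1/2) u(j-1)` on `ℤ`,
with the step coefficient `a`. -/
noncomputable def jumpLaplacian (b₁ b₂ : ℝ) (u : ℤ → ℂ) (j : ℤ) : ℂ :=
  (stepCoeff b₁ b₂ ((j : ℝ) + 1 / 2) : ℂ) * u (j + 1)
    - ((stepCoeff b₁ b₂ ((j : ℝ) + 1 / 2) : ℂ) + (stepCoeff b₁ b₂ ((j : ℝ) - 1 / 2) : ℂ)) * u j
    + (stepCoeff b₁ b₂ ((j : ℝ) - 1 / 2) : ℂ) * u (j - 1)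

/-- On the negative integers the operator is `b₁⁻²` times the discrete Laplacian. -/
theorem jumpLaplacian_of_neg (b₁ b₂ : ℝ) (u : ℤ → ℂ) {j : ℤ} (hj : j ≤ -1) :
    jumpLaplacian b₁ b₂ u j = ((b₁ : ℂ) ^ 2)⁻¹ * (u (j + 1) - 2 * u j + u (j - 1)) := by
  have h : (j : ℝ) ≤ -1 := by exact_mod_cast hj
  have h1 : (j : ℝ) + 1 / 2 < 0 := by linarith
  have h2 : (j : ℝ) - 1 / 2 < 0 := by linarith
  simp only [jumpLaplacian, stepCoeff, if_pos h1, if_pos h2]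
  push_cast
  ring

/-- On the positive integers the operator is `b₂⁻²` times the discrete Laplacian. -/
theorem jumpLaplacian_of_pos (b₁ b₂ : ℝ) (u : ℤ → ℂ) {j : ℤ} (hj : 1 ≤ j) :
    jumpLaplacian b₁ b₂ u j = ((b₂ : ℂ) ^ 2)⁻¹ * (u (j + 1) - 2 * u j + u (j - 1)) := by
  have h : (1 : ℝ) ≤ j := by exact_mod_cast hj
  have h1 : ¬ (j : ℝ) + 1 / 2 < 0 := by linarith
  have h2 : ¬ (j : ℝ) - 1 / 2 < 0 := by linarith
  simp only [jumpLaplacian, stepCoeff, if_neg h1, if_neg h2]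
  push_cast
  ring

/-- The value of the operator at the origin, where the coefficient jumps. -/
theorem jumpLaplacian_zero (b₁ b₂ : ℝ) (u : ℤ → ℂ) :
    jumpLaplacian b₁ b₂ u 0 =
      ((b₁ : ℂ) ^ 2)⁻¹ * u (-1) - (((b₁ : ℂ) ^ 2)⁻¹ + ((b₂ : ℂ) ^ 2)⁻¹) * u 0
        + ((b₂ : ℂ) ^ 2)⁻¹ * u 1 := by
  have h1 : ¬ ((0 : ℤ) : ℝ) + 1 / 2 < 0 := by norm_num
  have h2 : ((0 : ℤ) : ℝ) - 1 / 2 < 0 := by norm_num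
  simp only [jumpLaplacian, stepCoeff, if_neg h1, if_pos h2, zero_add, zero_sub]
  push_cast
  ring

/-- `u ∈ C(ℝ, ℓ²(ℤ))` solves the initial value problem
`i u_t(t, j) + ∂(a∂u)(t, j) = 0` for all `j ∈ ℤ` and `t ≠ 0`, with `u(0, j) = φ(j)`. -/
structure IsJumpSolution (b₁ b₂ : ℝ) (φ : ℤ → ℂ) (u : ℝ → lp (fun _ : ℤ => ℂ) 2) : Prop where
  continuous : Continuous u
  differentiableAt : ∀ t : ℝ, t ≠ 0 → ∀ j : ℤ, DifferentiableAt ℝ (fun s : ℝ => u s j) t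
  equation : ∀ t : ℝ, t ≠ 0 → ∀ j : ℤ,
    Complex.I * deriv (fun s : ℝ => u s j) t + jumpLaplacian b₁ b₂ (u t) j = 0
  initial : ∀ j : ℤ, u 0 j = φ j

/-! The operator `∂(a∂)` is bounded on `ℓ²`, so its exponential solves the system. Uniqueness is
proved in the larger class of coordinatewise solutions that are bounded on the lattice locally in
time: the operator is bounded in the sup norm, so a difference of two solutions is at most `B (A t)
^ k / k!` for every `k`. This uniqueness is also what identifies the kernel: any bounded expression
that satisfies the equation and the initial condition must be `jumpKernel`. The dispersive bound
then amounts to a bound on `jumpKernel` uniform in both indices, and reflecting the lattice allows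
`b₁ ≤ b₂`.

Let `z` be a point of the unit circle with energy `λ = b₁⁻² (z - 2 + z⁻¹)`. The corresponding wave
is `z ^ |n|` on the left and `r(z) ^ n` on the right, where `b₂⁻² (r - 2 + r⁻¹) = λ`. The kernel is
a Dirichlet kernel on the half line of the source (method of images) plus the circle average of
`exp(itλ) 2 T w_n w_m`, with `w_n` the wave and `2 T` the transmission coefficient
(`IsScatteringData.jumpKernel_eq`). No spectral theory enters. Since `r` and `T` are holomorphic in
the disc and `r(0) = 0`, the mean value property gives the initial data; the junction condition
gives the equation at the origin for a source at the origin; symmetry of the kernel supplies the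
value at the origin for every other source.

For decay put `κ = b₂ / b₁ > 1` and `s = sin(θ/2)`. In the common band `s ≤ 1/κ` the phase is
`-4cts² + 2j arcsin s + 2k arcsin(κs)` with `j, k ≥ 0`. If `j + k` is at least a small multiple of
`|t|`, the third derivative is at least of size `|t|`: the quadratic term drops out and the two
arcsines cannot cancel. If `j + k` is smaller, the quadratic term dominates the second derivative
away from the edge; near it the variable `v = 2 arcsin(κs)` makes the `k` term linear and the `j`
term smooth (`exists_subintervalBound_jumpPhase`). Outside the common band `r` is real and negative,
so its powers are monotone amplitudes up to a sign and only the free phase oscillates. Amplitudes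
are sums of products of monotone functions and cost only constants. When `b₁ = b₂` everything
reduces to the free kernel. -/

/-! ### Monotone amplitudes and van der Corput estimates -/

open MeasureTheory Set in
/-- A bounded order-connected set of reals is almost everywhere equal to an interval. -/
theorem Set.OrdConnected.exists_ae_eq_Ioc {s : Set ℝ} (hs : s.OrdConnected) {a b : ℝ} (hab : a ≤ b)
    (hsub : s ⊆ Icc a b) :
    ∃ c d, a ≤ c ∧ c ≤ d ∧ d ≤ b ∧ s =ᵐ[volume] Ioc c d := by
  rcases s.eq_empty_or_nonempty with rfl | hne
  · exact ⟨a, a, le_rfl, le_rfl, hab, by simp⟩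
  have hb : BddBelow s := ⟨a, fun x hx => (hsub hx).1⟩
  have hB : BddAbove s := ⟨b, fun x hx => (hsub hx).2⟩
  refine ⟨sInf s, sSup s, le_csInf hne fun x hx => (hsub hx).1, Real.sInf_le_sSup s hb hB,
    csSup_le hne fun x hx => (hsub hx).2, ?_⟩
  have h1 : Ioo (sInf s) (sSup s) ⊆ s := by
    rintro x ⟨hx1, hx2⟩
    obtain ⟨y, hy, hyx⟩ := exists_lt_of_csInf_lt hne hx1
    obtain ⟨z, hz, hxz⟩ := exists_lt_of_lt_csSup hne hx2
    exact hs.out hy hz ⟨hyx.le, hxz.le⟩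
  have h2 : s ⊆ Icc (sInf s) (sSup s) := fun x hx => ⟨csInf_le hb hx, le_csSup hB hx⟩
  refine Filter.EventuallyLE.antisymm ?_ ?_
  · exact (LE.le.eventuallyLE h2).trans Ioc_ae_eq_Icc.symm.le
  · exact Ioo_ae_eq_Ioc.symm.le.trans (LE.le.eventuallyLE h1)

open MeasureTheory Set in
/-- A unimodal amplitude with values in `[0, 1]` does not increase the bound for integrals over
subintervals. -/
theorem norm_integral_mul_le_of_ordConnected {f : ℝ → ℂ} {g : ℝ → ℝ} {a b M : ℝ} (hab : a ≤ b)
    (hf : IntervalIntegrable f volume a b) (hg : Measurable g)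
    (hgI : ∀ x, g x ∈ Icc (0 : ℝ) 1)
    (hoc : ∀ y, OrdConnected {x | y < g x})
    (hM : ∀ c d, a ≤ c → c ≤ d → d ≤ b → ‖∫ x in c..d, f x‖ ≤ M) :
    ‖∫ x in a..b, f x * g x‖ ≤ M := by
  have hfI : Integrable f (volume.restrict (Ioc a b)) := hf.1
  -- Layer cake: `g x` is the integral over `y` in `(0, 1]` of the indicator of `y < g x`. After
  -- Fubini each level `y` leaves the integral of `f` over an interval.
  set G : ℝ → ℝ → ℂ := fun x y => (Set.indicator {p : ℝ × ℝ | p.2 < g p.1} (fun p => f p.1)) (x, y)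
    with hG
  have hmeas : MeasurableSet {p : ℝ × ℝ | p.2 < g p.1} :=
    measurableSet_lt measurable_snd (hg.comp measurable_fst)
  have hint : Integrable (Function.uncurry G)
      ((volume.restrict (Ioc a b)).prod (volume.restrict (Ioc (0 : ℝ) 1))) := by
    have : Integrable (fun p : ℝ × ℝ => f p.1)
        ((volume.restrict (Ioc a b)).prod (volume.restrict (Ioc (0 : ℝ) 1))) :=
      hfI.comp_fst _
    exact this.indicator hmeas
  have h1 : ∀ x, ∫ y in Ioc (0 : ℝ) 1, G x y = f x * g x := by
    intro x
    have : ∀ y, G x y = Set.indicator (Iio (g x)) (fun _ => f x) y := by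
      intro y
      simp only [hG, Set.indicator_apply, mem_ofPred_eq, mem_Iio]
    simp_rw [this]
    rw [integral_indicator measurableSet_Iio, Measure.restrict_restrict measurableSet_Iio]
    have hset : (Iio (g x) ∩ Ioc (0 : ℝ) 1 : Set ℝ) =ᵐ[volume] (Ioc 0 (g x) : Set ℝ) := by
      have : Ioo 0 (g x) =ᵐ[volume] Ioc 0 (g x) := Ioo_ae_eq_Ioc
      have heq : Iio (g x) ∩ Ioc (0 : ℝ) 1 = Ioo 0 (g x) := ?_
      · rwa [heq]
      ext y
      simp only [mem_inter_iff, mem_Iio, mem_Ioc, mem_Ioo]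
      have := (hgI x).2
      constructor
      · rintro ⟨h, h', _⟩; exact ⟨h', h⟩
      · rintro ⟨h, h'⟩; exact ⟨h', h, by linarith⟩
    rw [setIntegral_congr_set hset, setIntegral_const]
    simp [Measure.real, (hgI x).1, mul_comm]
  have h2 : ∫ x in a..b, f x * g x = ∫ y in Ioc (0 : ℝ) 1, ∫ x in Ioc a b, G x y := by
    rw [intervalIntegral.integral_of_le hab]
    simp_rw [← h1]
    exact integral_integral_swap hint
  rw [h2]
  have h3 : ∀ y, ‖∫ x in Ioc a b, G x y‖ ≤ M := by
    intro y
    have hGy : ∀ x, G x y = Set.indicator {x | y < g x} f x := by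
      intro x
      simp only [hG, Set.indicator_apply, mem_ofPred_eq]
    have hms : MeasurableSet {x | y < g x} := measurableSet_lt measurable_const hg
    simp_rw [hGy]
    rw [integral_indicator hms, Measure.restrict_restrict hms]
    obtain ⟨c, d, hac, hcd, hdb, hae⟩ :=
      ((hoc y).inter (show OrdConnected (Ioc a b) from ordConnected_Ioc)).exists_ae_eq_Ioc hab
        (fun x hx => ⟨hx.2.1.le, hx.2.2⟩)
    rw [setIntegral_congr_set hae, ← intervalIntegral.integral_of_le hcd]
    exact hM c d hac hcd hdb
  calc _ ≤ M * (volume.restrict (Ioc (0 : ℝ) 1)).real univ :=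
        norm_integral_le_of_norm_le_const (Filter.Eventually.of_forall h3)
    _ = M := by simp [Measure.real]

open MeasureTheory Set in
/-- A monotone or antitone amplitude with values in `[0, 1]` does not increase the bound for
integrals over subintervals. -/
theorem norm_integral_mul_le_of_monotoneOn {f : ℝ → ℂ} {g : ℝ → ℝ} {a b M : ℝ} (hab : a ≤ b)
    (hf : IntervalIntegrable f volume a b)
    (hgI : ∀ x ∈ Icc a b, g x ∈ Icc (0 : ℝ) 1)
    (hg : MonotoneOn g (Icc a b) ∨ AntitoneOn g (Icc a b))
    (hM : ∀ c d, a ≤ c → c ≤ d → d ≤ b → ‖∫ x in c..d, f x‖ ≤ M) :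
    ‖∫ x in a..b, f x * g x‖ ≤ M := by
  -- Extending `g` by constants beyond the endpoints makes it monotone, hence measurable, on the
  -- whole line.
  set g' : ℝ → ℝ := fun x => g (projIcc a b hab x) with hg'
  have hcongr : ∫ x in a..b, f x * g x = ∫ x in a..b, f x * g' x := by
    refine intervalIntegral.integral_congr fun x hx => ?_
    rw [uIcc_of_le hab] at hx
    simp [hg', projIcc_of_mem hab hx]
  rw [hcongr]
  have hmono : Monotone g' ∨ Antitone g' := by
    rcases hg with hg | hg
    · exact Or.inl fun x y hxy => hg (projIcc a b hab x).2 (projIcc a b hab y).2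
        (monotone_projIcc hab hxy)
    · exact Or.inr fun x y hxy => hg (projIcc a b hab x).2 (projIcc a b hab y).2
        (monotone_projIcc hab hxy)
  refine norm_integral_mul_le_of_ordConnected hab hf ?_ (fun x => hgI _ (projIcc a b hab x).2) ?_ hM
  · exact hmono.elim Monotone.measurable Antitone.measurable
  · intro y
    rcases hmono with h | h
    · exact ⟨fun u hu v _ w hw => lt_of_lt_of_le hu (h hw.1)⟩
    · exact ⟨fun u _ v hv w hw => lt_of_lt_of_le hv (h hw.2)⟩

open MeasureTheory Set in
/-- First order van der Corput estimate for an increasing derivative. -/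
theorem vanDerCorput_one {φ ψ : ℝ → ℝ} {a b μ : ℝ} (hab : a ≤ b) (hμ : 0 < μ)
    (hφ : ∀ x ∈ Icc a b, HasDerivAt φ (ψ x) x) (hψ : ContinuousOn ψ (Icc a b))
    (hmono : MonotoneOn ψ (Icc a b)) (hlow : μ ≤ ψ a) :
    ‖∫ x in a..b, Complex.exp (φ x * Complex.I)‖ ≤ 2 / μ := by
  have hge : ∀ x ∈ Icc a b, μ ≤ ψ x := fun x hx => hlow.trans (hmono ⟨le_rfl, hab⟩ hx hx.1)
  have hφc : ContinuousOn φ (Icc a b) := fun x hx => (hφ x hx).continuousAt.continuousWithinAt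
  -- This replaces integration by parts: `f` has an explicit primitive, and the remaining factor `μ
  -- / ψ` is antitone with values in `[0, 1]`.
  set f : ℝ → ℂ := fun x => (ψ x : ℂ) / μ * Complex.exp (φ x * Complex.I) with hf
  have hfc : ContinuousOn f (Icc a b) := by
    have h1 : ContinuousOn (fun x => (φ x : ℂ)) (Icc a b) := Complex.continuous_ofReal.comp_continuousOn hφc
    have h2 : ContinuousOn (fun x => (ψ x : ℂ)) (Icc a b) := Complex.continuous_ofReal.comp_continuousOn hψ
    exact (h2.div_const _).mul ((h1.mul continuousOn_const).cexp)
  have hcong : ∫ x in a..b, Complex.exp (φ x * Complex.I) =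
      ∫ x in a..b, f x * ((μ / ψ x : ℝ) : ℂ) := by
    refine intervalIntegral.integral_congr fun x hx => ?_
    rw [uIcc_of_le hab] at hx
    have h1 : (ψ x : ℂ) ≠ 0 := by exact_mod_cast (hμ.trans_le (hge x hx)).ne'
    have h2 : (μ : ℂ) ≠ 0 := by exact_mod_cast hμ.ne'
    simp only [hf]
    push_cast
    field_simp
  rw [hcong]
  refine norm_integral_mul_le_of_monotoneOn hab (hfc.intervalIntegrable_of_Icc hab) ?_ (Or.inr ?_) ?_
  · intro x hx
    have := hge x hx
    exact ⟨by have : 0 < ψ x := by linarith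
              positivity, (div_le_one (by linarith)).2 this⟩
  · intro x hx y hy hxy
    have := hge x hx
    exact div_le_div_of_nonneg_left hμ.le (by linarith) (hmono hx hy hxy)
  · intro c d hac hcd hdb
    have hI : ∫ x in c..d, f x =
        Complex.exp (φ d * Complex.I) / (μ * Complex.I) - Complex.exp (φ c * Complex.I) / (μ * Complex.I) := by
      refine intervalIntegral.integral_eq_sub_of_hasDerivAt
        (f := fun x => Complex.exp (φ x * Complex.I) / (μ * Complex.I)) ?_ ?_
      · intro x hx
        rw [uIcc_of_le hcd] at hx
        have h := hφ x ⟨hac.trans hx.1, hx.2.trans hdb⟩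
        have h2 : (μ : ℂ) ≠ 0 := by exact_mod_cast hμ.ne'
        refine ((h.ofReal_comp.mul_const Complex.I).cexp.div_const (μ * Complex.I)).congr_deriv ?_
        simp only [hf]
        field_simp
      · exact (hfc.mono (Icc_subset_Icc hac hdb)).intervalIntegrable_of_Icc hcd
    rw [hI]
    refine (norm_sub_le _ _).trans ?_
    simp only [norm_div, Complex.norm_exp_ofReal_mul_I, norm_mul, Complex.norm_I, mul_one,
      Complex.norm_real, Real.norm_eq_abs, abs_of_pos hμ]
    apply le_of_eq; ring

open MeasureTheory Set in
theorem norm_integral_cexp_mul_I_le {φ : ℝ → ℝ} {a b : ℝ} (hab : a ≤ b) :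
    ‖∫ x in a..b, Complex.exp (φ x * Complex.I)‖ ≤ b - a := by
  have := intervalIntegral.norm_integral_le_of_norm_le_const (a := a) (b := b) (C := 1)
    (f := fun x => Complex.exp (φ x * Complex.I)) (fun x _ => by simp [Complex.norm_exp_ofReal_mul_I])
  rwa [one_mul, abs_of_nonneg (by linarith)] at this

theorem norm_integral_cexp_neg {φ : ℝ → ℝ} {a b : ℝ} :
    ‖∫ x in a..b, Complex.exp (((-φ x : ℝ) : ℂ) * Complex.I)‖ =
      ‖∫ x in a..b, Complex.exp (φ x * Complex.I)‖ := by
  have : ∀ x, Complex.exp (((-φ x : ℝ) : ℂ) * Complex.I) =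
      (starRingEnd ℂ) (Complex.exp (φ x * Complex.I)) := by
    intro x
    rw [← Complex.exp_conj]
    simp
  rw [intervalIntegral.integral_congr (g := fun x => (starRingEnd ℂ)
    (Complex.exp (φ x * Complex.I))) (fun x _ => this x),
    intervalIntegral.intervalIntegral_conj, RCLike.norm_conj]

-- Cut at distance `1 / √ρ` from `a`. The first piece is bounded by its length; beyond it `ψ ≥ √ρ`,
-- and the first order estimate gives `2 / √ρ`.
open MeasureTheory Set in
theorem vanDerCorput_two_of_nonneg {φ ψ : ℝ → ℝ} {a b ρ : ℝ} (hab : a ≤ b) (hρ : 0 < ρ)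
    (hφ : ∀ x ∈ Icc a b, HasDerivAt φ (ψ x) x) (hψ : ContinuousOn ψ (Icc a b))
    (hmono : ∀ x ∈ Icc a b, ∀ y ∈ Icc a b, x ≤ y → ρ * (y - x) ≤ ψ y - ψ x) (hlow : 0 ≤ ψ a) :
    ‖∫ x in a..b, Complex.exp (φ x * Complex.I)‖ ≤ 3 / √ρ := by
  have hs : 0 < √ρ := Real.sqrt_pos.2 hρ
  have hss : √ρ * √ρ = ρ := Real.mul_self_sqrt hρ.le
  rcases le_total b (a + 1 / √ρ) with hb | hb
  · refine (norm_integral_cexp_mul_I_le hab).trans ?_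
    have : (1 : ℝ) / √ρ ≤ 3 / √ρ := by gcongr; norm_num
    linarith
  have hδ : 0 < 1 / √ρ := by positivity
  have hφc : ContinuousOn (fun x => Complex.exp (φ x * Complex.I)) (Icc a b) := by
    have h1 : ContinuousOn (fun x => (φ x : ℂ)) (Icc a b) :=
      Complex.continuous_ofReal.comp_continuousOn
        fun x hx => (hφ x hx).continuousAt.continuousWithinAt
    exact (h1.mul continuousOn_const).cexp
  have hsub : Icc (a + 1 / √ρ) b ⊆ Icc a b := Icc_subset_Icc (by linarith) le_rfl
  rw [← intervalIntegral.integral_add_adjacent_intervals (b := a + 1 / √ρ)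
    ((hφc.mono (Icc_subset_Icc le_rfl hb)).intervalIntegrable_of_Icc (by linarith))
    ((hφc.mono hsub).intervalIntegrable_of_Icc hb)]
  refine (norm_add_le _ _).trans ?_
  have e1 := norm_integral_cexp_mul_I_le (φ := φ) (a := a) (b := a + 1 / √ρ) (by linarith)
  have e2 : ‖∫ x in (a + 1 / √ρ)..b, Complex.exp (φ x * Complex.I)‖ ≤ 2 / √ρ := by
    refine vanDerCorput_one hb hs (fun x hx => hφ x (hsub hx)) (hψ.mono hsub) ?_ ?_
    · intro x hx y hy hxy
      have := hmono x (hsub hx) y (hsub hy) hxy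
      have : 0 ≤ ρ * (y - x) := mul_nonneg hρ.le (by linarith)
      linarith
    · have := hmono a ⟨le_rfl, hab⟩ (a + 1 / √ρ) ⟨by linarith, hb⟩ (by linarith)
      have h3 : ρ * (a + 1 / √ρ - a) = √ρ := by
        rw [add_sub_cancel_left]
        field_simp
        linarith [Real.sq_sqrt hρ.le]
      linarith
  have : 3 / √ρ = 1 / √ρ + 2 / √ρ := by ring
  linarith

open MeasureTheory Set in
/-- Second order van der Corput estimate. -/
theorem vanDerCorput_two {φ ψ : ℝ → ℝ} {a b ρ : ℝ} (hab : a ≤ b) (hρ : 0 < ρ)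
    (hφ : ∀ x ∈ Icc a b, HasDerivAt φ (ψ x) x) (hψ : ContinuousOn ψ (Icc a b))
    (hmono : ∀ x ∈ Icc a b, ∀ y ∈ Icc a b, x ≤ y → ρ * (y - x) ≤ ψ y - ψ x) :
    ‖∫ x in a..b, Complex.exp (φ x * Complex.I)‖ ≤ 6 / √ρ := by
  have hs : 0 < √ρ := Real.sqrt_pos.2 hρ
  have h36 : 3 / √ρ ≤ 6 / √ρ := by gcongr; norm_num
  have hneg : ∀ c, a ≤ c → c ≤ b → ψ c ≤ 0 →
      ‖∫ x in a..c, Complex.exp (φ x * Complex.I)‖ ≤ 3 / √ρ := by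
    intro c hac hcb hc
    -- The reflection `x ↦ -x` changes the sign of the first derivative and keeps that of the
    -- second.
    have key := vanDerCorput_two_of_nonneg (φ := fun x => φ (-x)) (ψ := fun x => -ψ (-x))
      (a := -c) (b := -a) (neg_le_neg hac) hρ ?_ ?_ ?_ (by simpa using hc)
    · have h := intervalIntegral.integral_comp_neg (a := -c) (b := -a)
        (fun x => Complex.exp (φ x * Complex.I))
      rw [neg_neg, neg_neg] at h
      rwa [h] at key
    · intro x hx
      have h := hφ (-x) ⟨by linarith [hx.2], by linarith [hx.1]⟩
      simpa [Function.comp_def] using h.comp x (hasDerivAt_neg x)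
    · refine (hψ.comp continuousOn_neg ?_).neg
      intro x hx
      exact ⟨by linarith [hx.2], by linarith [hx.1]⟩
    · intro x hx y hy hxy
      have := hmono (-y) ⟨by linarith [hy.2], by linarith [hy.1]⟩ (-x)
        ⟨by linarith [hx.2], by linarith [hx.1]⟩ (by linarith)
      have e : -x - -y = y - x := by ring
      rw [e] at this
      linarith
  have hpos : ∀ c, a ≤ c → c ≤ b → 0 ≤ ψ c →
      ‖∫ x in c..b, Complex.exp (φ x * Complex.I)‖ ≤ 3 / √ρ := by
    intro c hac hcb hc
    have hsub : Icc c b ⊆ Icc a b := Icc_subset_Icc hac le_rfl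
    exact vanDerCorput_two_of_nonneg hcb hρ (fun x hx => hφ x (hsub hx)) (hψ.mono hsub)
      (fun x hx y hy => hmono x (hsub hx) y (hsub hy)) hc
  rcases le_total 0 (ψ a) with h0 | h0
  · exact (hpos a le_rfl hab h0).trans h36
  rcases le_total (ψ b) 0 with h1 | h1
  · exact (hneg b hab le_rfl h1).trans h36
  obtain ⟨c, hc, hc0⟩ := intermediate_value_Icc hab hψ ⟨h0, h1⟩
  have hφc : ContinuousOn (fun x => Complex.exp (φ x * Complex.I)) (Icc a b) := by
    have h1 : ContinuousOn (fun x => (φ x : ℂ)) (Icc a b) :=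
      Complex.continuous_ofReal.comp_continuousOn
        fun x hx => (hφ x hx).continuousAt.continuousWithinAt
    exact (h1.mul continuousOn_const).cexp
  rw [← intervalIntegral.integral_add_adjacent_intervals (b := c)
    ((hφc.mono (Icc_subset_Icc le_rfl hc.2)).intervalIntegrable_of_Icc hc.1)
    ((hφc.mono (Icc_subset_Icc hc.1 le_rfl)).intervalIntegrable_of_Icc hc.2)]
  refine (norm_add_le _ _).trans ?_
  have e1 := hneg c hc.1 hc.2 hc0.le
  have e2 := hpos c hc.1 hc.2 hc0.ge
  have : 6 / √ρ = 3 / √ρ + 3 / √ρ := by ring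
  linarith

-- Cut at distance `δ = ρ ^ (-1/3)` from `a`. The first piece has length `δ`; beyond it the second
-- derivative is at least `ρδ = δ⁻²`, so the second order estimate gives `6δ`.
open MeasureTheory Set in
theorem vanDerCorput_three_of_nonneg {φ ψ χ : ℝ → ℝ} {a b ρ : ℝ} (hab : a ≤ b) (hρ : 0 < ρ)
    (hφ : ∀ x ∈ Icc a b, HasDerivAt φ (ψ x) x) (hψ : ∀ x ∈ Icc a b, HasDerivAt ψ (χ x) x)
    (hmono : ∀ x ∈ Icc a b, ∀ y ∈ Icc a b, x ≤ y → ρ * (y - x) ≤ χ y - χ x) (hlow : 0 ≤ χ a) :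
    ‖∫ x in a..b, Complex.exp (φ x * Complex.I)‖ ≤ 7 * ρ ^ (-(1 / 3 : ℝ)) := by
  set δ : ℝ := ρ ^ (-(1 / 3 : ℝ)) with hδdef
  have hδ : 0 < δ := Real.rpow_pos_of_pos hρ _
  rcases le_total b (a + δ) with hb | hb
  · refine (norm_integral_cexp_mul_I_le hab).trans ?_
    linarith
  have hφc : ContinuousOn (fun x => Complex.exp (φ x * Complex.I)) (Icc a b) := by
    have h1 : ContinuousOn (fun x => (φ x : ℂ)) (Icc a b) :=
      Complex.continuous_ofReal.comp_continuousOn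
        fun x hx => (hφ x hx).continuousAt.continuousWithinAt
    exact (h1.mul continuousOn_const).cexp
  have hsub : Icc (a + δ) b ⊆ Icc a b := Icc_subset_Icc (by linarith) le_rfl
  have hρδ : ρ * δ = (δ⁻¹) ^ 2 := by
    have h1 : δ⁻¹ = ρ ^ (1 / 3 : ℝ) := by rw [hδdef, Real.rpow_neg hρ.le, inv_inv]
    rw [h1, ← Real.rpow_natCast, ← Real.rpow_mul hρ.le, hδdef]
    nth_rewrite 1 [← Real.rpow_one ρ]
    rw [← Real.rpow_add hρ]
    norm_num
  rw [← intervalIntegral.integral_add_adjacent_intervals (b := a + δ)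
    ((hφc.mono (Icc_subset_Icc le_rfl hb)).intervalIntegrable_of_Icc (by linarith))
    ((hφc.mono hsub).intervalIntegrable_of_Icc hb)]
  refine (norm_add_le _ _).trans ?_
  have e1 := norm_integral_cexp_mul_I_le (φ := φ) (a := a) (b := a + δ) (by linarith)
  have e2 : ‖∫ x in (a + δ)..b, Complex.exp (φ x * Complex.I)‖ ≤ 6 / √(ρ * δ) := by
    refine vanDerCorput_two hb (by positivity) (fun x hx => hφ x (hsub hx))
      (fun x hx => (hψ x (hsub hx)).continuousAt.continuousWithinAt) ?_
    intro x hx y hy hxy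
    refine (convex_Icc (a + δ) b).mul_sub_le_image_sub_of_le_deriv
      (f := ψ) (fun x hx => (hψ x (hsub hx)).continuousAt.continuousWithinAt) ?_ ?_ x hx y hy hxy
    · intro z hz
      exact (hψ z (hsub (interior_subset hz))).differentiableAt.differentiableWithinAt
    · intro z hz
      have hz' := interior_subset hz
      rw [(hψ z (hsub hz')).deriv]
      have h1 := hmono a ⟨le_rfl, hab⟩ z (hsub hz') (hsub hz').1
      have h2 : ρ * δ ≤ ρ * (z - a) := by
        have := hz'.1
        gcongr
        linarith
      linarith
  rw [hρδ, Real.sqrt_sq (by positivity)] at e2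
  have : 6 / δ⁻¹ = 6 * δ := by rw [div_inv_eq_mul]
  linarith

open MeasureTheory Set in
/-- Third order van der Corput estimate. -/
theorem vanDerCorput_three {φ ψ χ : ℝ → ℝ} {a b ρ : ℝ} (hab : a ≤ b) (hρ : 0 < ρ)
    (hφ : ∀ x ∈ Icc a b, HasDerivAt φ (ψ x) x) (hψ : ∀ x ∈ Icc a b, HasDerivAt ψ (χ x) x)
    (hχ : ContinuousOn χ (Icc a b))
    (hmono : ∀ x ∈ Icc a b, ∀ y ∈ Icc a b, x ≤ y → ρ * (y - x) ≤ χ y - χ x) :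
    ‖∫ x in a..b, Complex.exp (φ x * Complex.I)‖ ≤ 14 * ρ ^ (-(1 / 3 : ℝ)) := by
  have hs : 0 < ρ ^ (-(1 / 3 : ℝ)) := Real.rpow_pos_of_pos hρ _
  have hneg : ∀ c, a ≤ c → c ≤ b → χ c ≤ 0 →
      ‖∫ x in a..c, Complex.exp (φ x * Complex.I)‖ ≤ 7 * ρ ^ (-(1 / 3 : ℝ)) := by
    intro c hac hcb hc
    -- Reflection alone would reverse the sign of the third derivative, so the phase is negated as
    -- well; this only conjugates the integral.
    have key := vanDerCorput_three_of_nonneg (φ := fun x => -φ (-x)) (ψ := fun x => ψ (-x))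
      (χ := fun x => -χ (-x))
      (a := -c) (b := -a) (neg_le_neg hac) hρ ?_ ?_ ?_ (by simpa using hc)
    · have h := intervalIntegral.integral_comp_neg (a := -c) (b := -a)
        (fun x => Complex.exp (φ x * Complex.I))
      rw [neg_neg, neg_neg] at h
      rw [norm_integral_cexp_neg (φ := fun x => φ (-x))] at key
      rwa [h] at key
    · intro x hx
      have h := hφ (-x) ⟨by linarith [hx.2], by linarith [hx.1]⟩
      simpa [Function.comp_def, Pi.neg_def] using (h.comp x (hasDerivAt_neg x)).neg
    · intro x hx
      have h := hψ (-x) ⟨by linarith [hx.2], by linarith [hx.1]⟩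
      simpa [Function.comp_def] using h.comp x (hasDerivAt_neg x)
    · intro x hx y hy hxy
      have := hmono (-y) ⟨by linarith [hy.2], by linarith [hy.1]⟩ (-x)
        ⟨by linarith [hx.2], by linarith [hx.1]⟩ (by linarith)
      have e : -x - -y = y - x := by ring
      rw [e] at this
      linarith
  have hpos : ∀ c, a ≤ c → c ≤ b → 0 ≤ χ c →
      ‖∫ x in c..b, Complex.exp (φ x * Complex.I)‖ ≤ 7 * ρ ^ (-(1 / 3 : ℝ)) := by
    intro c hac hcb hc
    have hsub : Icc c b ⊆ Icc a b := Icc_subset_Icc hac le_rfl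
    exact vanDerCorput_three_of_nonneg hcb hρ (fun x hx => hφ x (hsub hx))
      (fun x hx => hψ x (hsub hx)) (fun x hx y hy => hmono x (hsub hx) y (hsub hy)) hc
  rcases le_total 0 (χ a) with h0 | h0
  · have := hpos a le_rfl hab h0; linarith
  rcases le_total (χ b) 0 with h1 | h1
  · have := hneg b hab le_rfl h1; linarith
  obtain ⟨c, hc, hc0⟩ := intermediate_value_Icc hab hχ ⟨h0, h1⟩
  have hφc : ContinuousOn (fun x => Complex.exp (φ x * Complex.I)) (Icc a b) := by
    have h1 : ContinuousOn (fun x => (φ x : ℂ)) (Icc a b) :=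
      Complex.continuous_ofReal.comp_continuousOn
        fun x hx => (hφ x hx).continuousAt.continuousWithinAt
    exact (h1.mul continuousOn_const).cexp
  rw [← intervalIntegral.integral_add_adjacent_intervals (b := c)
    ((hφc.mono (Icc_subset_Icc le_rfl hc.2)).intervalIntegrable_of_Icc hc.1)
    ((hφc.mono (Icc_subset_Icc hc.1 le_rfl)).intervalIntegrable_of_Icc hc.2)]
  refine (norm_add_le _ _).trans ?_
  have e1 := hneg c hc.1 hc.2 hc0.le
  have e2 := hpos c hc.1 hc.2 hc0.ge
  linarith

/-! ### Bounds uniform over subintervals -/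

/-- The integrals of `f` over all subintervals of `[a, b]` are bounded by `M`. -/
def SubintervalBound (f : ℝ → ℂ) (a b M : ℝ) : Prop :=
  ∀ x y, a ≤ x → x ≤ y → y ≤ b → ‖∫ s in x..y, f s‖ ≤ M

namespace SubintervalBound

theorem mono {f : ℝ → ℂ} {a b M M' : ℝ} (h : SubintervalBound f a b M) (hM : M ≤ M') :
    SubintervalBound f a b M' := fun x y hx hxy hy => (h x y hx hxy hy).trans hM

theorem congr {f g : ℝ → ℂ} {a b M : ℝ} (h : SubintervalBound f a b M)
    (hfg : ∀ s ∈ Set.Icc a b, f s = g s) : SubintervalBound g a b M := by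
  intro x y hx hxy hy
  rw [← intervalIntegral.integral_congr (f := f)]
  · exact h x y hx hxy hy
  · intro s hs
    rw [Set.uIcc_of_le hxy] at hs
    exact hfg s ⟨hx.trans hs.1, hs.2.trans hy⟩

theorem const_mul {f : ℝ → ℂ} {a b M : ℝ} (h : SubintervalBound f a b M) (z : ℂ) :
    SubintervalBound (fun s => z * f s) a b (‖z‖ * M) := by
  intro x y hx hxy hy
  rw [intervalIntegral.integral_const_mul, norm_mul]
  exact mul_le_mul_of_nonneg_left (h x y hx hxy hy) (norm_nonneg _)

theorem add {f g : ℝ → ℂ} {a b M N : ℝ} (h : SubintervalBound f a b M)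
    (h' : SubintervalBound g a b N) (hf : ContinuousOn f (Set.Icc a b))
    (hg : ContinuousOn g (Set.Icc a b)) :
    SubintervalBound (fun s => f s + g s) a b (M + N) := by
  intro x y hx hxy hy
  have hs : Set.Icc x y ⊆ Set.Icc a b := Set.Icc_subset_Icc hx hy
  rw [intervalIntegral.integral_add ((hf.mono hs).intervalIntegrable_of_Icc hxy)
    ((hg.mono hs).intervalIntegrable_of_Icc hxy)]
  exact (norm_add_le _ _).trans (add_le_add (h x y hx hxy hy) (h' x y hx hxy hy))

/-- Controlling all subintervals, and not only `[a, b]`, makes the bound stable under monotone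
amplitudes. The lemma can thus be iterated, and amplitudes need not be differentiable. -/
theorem mul_monotoneOn {f : ℝ → ℂ} {g : ℝ → ℝ} {a b M B : ℝ} (h : SubintervalBound f a b M)
    (hf : ContinuousOn f (Set.Icc a b)) (hB : 0 < B)
    (hgI : ∀ x ∈ Set.Icc a b, g x ∈ Set.Icc 0 B)
    (hg : MonotoneOn g (Set.Icc a b) ∨ AntitoneOn g (Set.Icc a b)) :
    SubintervalBound (fun s => f s * g s) a b (B * M) := by
  intro x y hx hxy hy
  have hs : Set.Icc x y ⊆ Set.Icc a b := Set.Icc_subset_Icc hx hy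
  have key := norm_integral_mul_le_of_monotoneOn (g := fun s => g s / B) hxy
    ((hf.mono hs).intervalIntegrable_of_Icc hxy)
    (fun s hs' => ⟨div_nonneg (hgI s (hs hs')).1 hB.le, (div_le_one hB).2 (hgI s (hs hs')).2⟩)
    (hg.imp (fun hg u hu v hv huv => div_le_div_of_nonneg_right (hg (hs hu) (hs hv) huv) hB.le)
      (fun hg u hu v hv huv => div_le_div_of_nonneg_right (hg (hs hu) (hs hv) huv) hB.le))
    (fun c d hc hcd hd => h c d (hx.trans hc) hcd (hd.trans hy))
  have e : ∀ s, f s * g s = B * (f s * ((g s / B : ℝ) : ℂ)) := by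
    intro s
    have : (B : ℂ) ≠ 0 := by exact_mod_cast hB.ne'
    push_cast
    field_simp
  simp_rw [e]
  rw [intervalIntegral.integral_const_mul, norm_mul, Complex.norm_real, Real.norm_eq_abs,
    abs_of_pos hB]
  exact mul_le_mul_of_nonneg_left key hB.le

theorem split {f : ℝ → ℂ} {a b c M N : ℝ} (h : SubintervalBound f a b M)
    (h' : SubintervalBound f b c N) (hab : a ≤ b) (hbc : b ≤ c)
    (hf : ContinuousOn f (Set.Icc a c)) :
    SubintervalBound f a c (M + N) := by
  have hM : 0 ≤ M := (norm_nonneg _).trans (h a a le_rfl le_rfl hab)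
  have hN : 0 ≤ N := (norm_nonneg _).trans (h' b b le_rfl le_rfl hbc)
  intro x y hx hxy hy
  rcases le_total y b with hyb | hyb
  · have := h x y hx hxy hyb; linarith
  rcases le_total b x with hbx | hbx
  · have := h' x y hbx hxy hy; linarith
  rw [← intervalIntegral.integral_add_adjacent_intervals (b := b)
    ((hf.mono (Set.Icc_subset_Icc hx hbc)).intervalIntegrable_of_Icc hbx)
    ((hf.mono (Set.Icc_subset_Icc hab hy)).intervalIntegrable_of_Icc hyb)]
  exact (norm_add_le _ _).trans (add_le_add (h x b hx hbx le_rfl) (h' b y le_rfl hyb hy))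

/-- The primitive is continuous up to `b`. This is needed at the band edge `s = 1/κ`, where the
derivatives of `arcsin (κ s)` blow up. -/
theorem of_lt {f : ℝ → ℂ} {a b M : ℝ} (hf : ContinuousOn f (Set.Icc a b)) (hM : 0 ≤ M)
    (h : ∀ b', a < b' → b' < b → SubintervalBound f a b' M) : SubintervalBound f a b M := by
  intro x y hx hxy hy
  rcases hxy.eq_or_lt with rfl | hlt
  · simpa using hM
  have hc : ContinuousOn (fun z => ∫ s in x..z, f s) (Set.Icc x y) := by
    have := intervalIntegral.continuousOn_primitive_interval (f := f) (a := x) (b := y)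
      (μ := MeasureTheory.volume) ?_
    · rwa [Set.uIcc_of_le hxy] at this
    · rw [Set.uIcc_of_le hxy]
      exact (hf.mono (Set.Icc_subset_Icc hx hy)).integrableOn_Icc
  have ht : Filter.Tendsto (fun z => ∫ s in x..z, f s) (nhdsWithin y (Set.Ioo x y))
      (nhds (∫ s in x..y, f s)) :=
    (hc y ⟨hxy, le_rfl⟩).mono_left (nhdsWithin_mono _ Set.Ioo_subset_Icc_self)
  have : (nhdsWithin y (Set.Ioo x y)).NeBot := by
    rw [← mem_closure_iff_nhdsWithin_neBot, closure_Ioo hlt.ne]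
    exact ⟨hxy, le_rfl⟩
  refine le_of_tendsto ht.norm ?_
  filter_upwards [self_mem_nhdsWithin] with z hz
  exact h z (hx.trans_lt hz.1) (hz.2.trans_le hy) x z hx hz.1.le le_rfl

end SubintervalBound

theorem continuousOn_cexp_mul_I {φ : ℝ → ℝ} {s : Set ℝ} (h : ContinuousOn φ s) :
    ContinuousOn (fun x => Complex.exp (φ x * Complex.I)) s :=
  ((Complex.continuous_ofReal.comp_continuousOn h).mul continuousOn_const).cexp

/-- The constant in the decay estimates of order two and three. -/
noncomputable def vdcConst (c : ℝ) : ℝ := 6 / √c + 14 * c ^ (-(1 / 3 : ℝ))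

theorem vdcConst_pos {c : ℝ} (hc : 0 < c) : 0 < vdcConst c := by
  have := Real.rpow_pos_of_pos hc (-(1 / 3 : ℝ))
  unfold vdcConst
  positivity

theorem six_div_sqrt_le {c τ : ℝ} (hc : 0 < c) (hτ : 1 ≤ τ) :
    6 / √(c * τ) ≤ vdcConst c * τ ^ (-(1 / 3 : ℝ)) := by
  have h1 : 1 / √τ ≤ τ ^ (-(1 / 3 : ℝ)) := by
    rw [Real.sqrt_eq_rpow, one_div, ← Real.rpow_neg (by linarith)]
    exact Real.rpow_le_rpow_of_exponent_le hτ (by norm_num)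
  have h2 : 0 < c ^ (-(1 / 3 : ℝ)) := Real.rpow_pos_of_pos hc _
  have h3 : 0 < τ ^ (-(1 / 3 : ℝ)) := Real.rpow_pos_of_pos (by linarith) _
  have hsc : 0 < √c := Real.sqrt_pos.2 hc
  calc 6 / √(c * τ) = 6 / √c * (1 / √τ) := by
        rw [Real.sqrt_mul hc.le]; field_simp
    _ ≤ 6 / √c * τ ^ (-(1 / 3 : ℝ)) := by gcongr
    _ ≤ _ := by unfold vdcConst; gcongr; linarith

theorem fourteen_mul_rpow_le {c τ : ℝ} (hc : 0 < c) (hτ : 1 ≤ τ) :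
    14 * (c * τ) ^ (-(1 / 3 : ℝ)) ≤ vdcConst c * τ ^ (-(1 / 3 : ℝ)) := by
  have h3 : 0 < τ ^ (-(1 / 3 : ℝ)) := Real.rpow_pos_of_pos (by linarith) _
  have hsc : 0 < √c := Real.sqrt_pos.2 hc
  rw [Real.mul_rpow hc.le (by linarith), ← mul_assoc]
  unfold vdcConst
  gcongr
  have : 0 < 6 / √c := by positivity
  linarith

open Set in
/-- Decay of an oscillatory integral whose phase has a second derivative of size at least
`c * τ`. -/
theorem subintervalBound_of_second_deriv {φ ψ χ : ℝ → ℝ} {a b c τ : ℝ} (hc : 0 < c) (hτ : 1 ≤ τ)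
    (hφ : ∀ x ∈ Icc a b, HasDerivAt φ (ψ x) x) (hψ : ∀ x ∈ Icc a b, HasDerivAt ψ (χ x) x)
    (hχ : (∀ x ∈ Icc a b, c * τ ≤ χ x) ∨ (∀ x ∈ Icc a b, χ x ≤ -(c * τ))) :
    SubintervalBound (fun x => Complex.exp (φ x * Complex.I)) a b
      (vdcConst c * τ ^ (-(1 / 3 : ℝ))) := by
  have hρ : 0 < c * τ := by positivity
  have main : ∀ {φ ψ χ : ℝ → ℝ}, (∀ x ∈ Icc a b, HasDerivAt φ (ψ x) x) →
      (∀ x ∈ Icc a b, HasDerivAt ψ (χ x) x) → (∀ x ∈ Icc a b, c * τ ≤ χ x) →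
      SubintervalBound (fun x => Complex.exp (φ x * Complex.I)) a b (6 / √(c * τ)) := by
    intro φ ψ χ hφ hψ hχ x y hx hxy hy
    have hs : Icc x y ⊆ Icc a b := Icc_subset_Icc hx hy
    have hψc : ContinuousOn ψ (Icc x y) :=
      fun z hz => (hψ z (hs hz)).continuousAt.continuousWithinAt
    refine vanDerCorput_two hxy hρ (fun z hz => hφ z (hs hz)) hψc ?_
    refine (convex_Icc x y).mul_sub_le_image_sub_of_le_deriv hψc ?_ ?_
    · exact fun z hz =>
        (hψ z (hs (interior_subset hz))).differentiableAt.differentiableWithinAt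
    · intro z hz
      rw [(hψ z (hs (interior_subset hz))).deriv]
      exact hχ z (hs (interior_subset hz))
  rcases hχ with hχ | hχ
  · exact (main hφ hψ hχ).mono (six_div_sqrt_le hc hτ)
  · intro x y hx hxy hy
    rw [← norm_integral_cexp_neg]
    exact ((main (φ := fun x => -φ x) (fun x hx => (hφ x hx).fun_neg)
      (fun x hx => (hψ x hx).fun_neg) (fun x hx => by linarith [hχ x hx])).mono
        (six_div_sqrt_le hc hτ)) x y hx hxy hy

open Set in
/-- Decay of an oscillatory integral whose phase has a third derivative of size at least
`c * τ`. -/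
theorem subintervalBound_of_third_deriv {φ ψ χ : ℝ → ℝ} {a b c τ : ℝ} (hc : 0 < c) (hτ : 1 ≤ τ)
    (hφ : ∀ x ∈ Icc a b, HasDerivAt φ (ψ x) x) (hψ : ∀ x ∈ Icc a b, HasDerivAt ψ (χ x) x)
    (hχ : ContinuousOn χ (Icc a b))
    (hmono : ∀ x ∈ Icc a b, ∀ y ∈ Icc a b, x ≤ y → c * τ * (y - x) ≤ χ y - χ x) :
    SubintervalBound (fun x => Complex.exp (φ x * Complex.I)) a b
      (vdcConst c * τ ^ (-(1 / 3 : ℝ))) := by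
  intro x y hx hxy hy
  have hs : Icc x y ⊆ Icc a b := Icc_subset_Icc hx hy
  exact (vanDerCorput_three hxy (by positivity) (fun z hz => hφ z (hs hz))
    (fun z hz => hψ z (hs hz)) (hχ.mono hs)
    (fun u hu v hv => hmono u (hs hu) v (hs hv))).trans (fourteen_mul_rpow_le hc hτ)

open Set Real in
/-- Oscillatory integrals with the phase of the discrete Schrödinger equation. -/
theorem exists_subintervalBound_cos {c : ℝ} (hc : 0 < c) :
    ∃ C : ℝ, 0 < C ∧ ∀ t k d : ℝ, 1 ≤ |t| →
      SubintervalBound (fun x => Complex.exp ((c * t * cos x + k * x + d : ℝ) * Complex.I)) 0 π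
        (C * |t| ^ (-(1 / 3 : ℝ))) := by
  have hc2 : 0 < c / 2 := by positivity
  refine ⟨vdcConst (c / 2) + vdcConst (c / 2) + vdcConst (c / 2), by
    have := vdcConst_pos hc2; positivity, ?_⟩
  have main : ∀ t k d : ℝ, 1 ≤ t →
      SubintervalBound (fun x => Complex.exp ((c * t * cos x + k * x + d : ℝ) * Complex.I)) 0 π
        ((vdcConst (c / 2) + vdcConst (c / 2) + vdcConst (c / 2)) * t ^ (-(1 / 3 : ℝ))) := by
    intro t k d ht
    have hpi := pi_pos
    have hφ : ∀ x, HasDerivAt (fun x => c * t * cos x + k * x + d) (-(c * t) * sin x + k) x := by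
      intro x
      refine ((((hasDerivAt_cos x).const_mul (c * t)).add
        ((hasDerivAt_id x).const_mul k)).add_const d).congr_deriv ?_
      ring
    have hψ : ∀ x, HasDerivAt (fun x => -(c * t) * sin x + k) (-(c * t) * cos x) x := by
      intro x
      exact ((hasDerivAt_sin x).const_mul (-(c * t))).add_const k
    have hcont : Continuous (fun x => Complex.exp ((c * t * cos x + k * x + d : ℝ) * Complex.I)) := by
      fun_prop
    have h4 : (1 : ℝ) / 2 ≤ √2 / 2 := by
      have : (1 : ℝ) ≤ √2 := by rw [Real.one_le_sqrt]; norm_num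
      linarith
    have hct : 0 < c * t := by positivity
    rw [add_mul, add_mul]
    -- On the two outer quarters `|cos| ≥ 1/2` bounds the second derivative below; on the middle
    -- half `sin ≥ 1/2` bounds the third.
    refine SubintervalBound.split (b := 3 * π / 4) (SubintervalBound.split (b := π / 4) ?_ ?_
      (by positivity) (by linarith) hcont.continuousOn) ?_ (by positivity) (by linarith)
      hcont.continuousOn
    · refine subintervalBound_of_second_deriv hc2 ht (fun x _ => hφ x) (fun x _ => hψ x)
        (Or.inr fun x hx => ?_)
      have : √2 / 2 ≤ cos x := by
        rw [← cos_pi_div_four]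
        exact cos_le_cos_of_nonneg_of_le_pi hx.1 (by linarith) hx.2
      have : c * t * (1 / 2) ≤ c * t * cos x := by gcongr; linarith
      linarith
    · refine subintervalBound_of_third_deriv hc2 ht (fun x _ => hφ x) (fun x _ => hψ x)
        (by fun_prop) ?_
      have hd : ∀ x, HasDerivAt (fun x => -(c * t) * cos x) (c * t * sin x) x := by
        intro x
        refine ((hasDerivAt_cos x).const_mul (-(c * t))).congr_deriv ?_
        ring
      refine (convex_Icc _ _).mul_sub_le_image_sub_of_le_deriv (by fun_prop)
        (fun x _ => (hd x).differentiableAt.differentiableWithinAt) ?_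
      intro x hx
      have hx := interior_subset hx
      rw [(hd x).deriv]
      have : 1 / 2 ≤ sin x := by
        rw [← cos_pi_div_two_sub]
        refine h4.trans ?_
        rw [← cos_pi_div_four, ← cos_abs (π / 2 - x)]
        refine cos_le_cos_of_nonneg_of_le_pi (abs_nonneg _) (by linarith) ?_
        rw [abs_le]
        constructor <;> linarith [hx.1, hx.2]
      have : c * t * (1 / 2) ≤ c * t * sin x := by gcongr
      linarith
    · refine subintervalBound_of_second_deriv hc2 ht (fun x _ => hφ x) (fun x _ => hψ x)
        (Or.inl fun x hx => ?_)
      have : √2 / 2 ≤ -cos x := by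
        rw [← cos_pi_div_four, ← cos_pi_sub]
        exact cos_le_cos_of_nonneg_of_le_pi (by linarith [hx.2]) (by linarith) (by linarith [hx.1])
      have : c * t * (1 / 2) ≤ c * t * -cos x := by gcongr; linarith
      linarith
  intro t k d ht
  rcases le_total 0 t with h | h
  · rw [abs_of_nonneg h] at ht ⊢
    exact main t k d ht
  · rw [abs_of_nonpos h] at ht ⊢
    intro x y hx hxy hy
    rw [← norm_integral_cexp_neg]
    have := main (-t) (-k) (-d) ht x y hx hxy hy
    convert this using 5
    ring_nf

/-! ### Two competing phases on the common band -/

/-- The phase of the transmitted waves in the variable `s = sin (θ / 2)`. -/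
noncomputable def jumpPhase (c κ t j k s : ℝ) : ℝ :=
  -(4 * c * t * s ^ 2) + 2 * j * Real.arcsin s + 2 * k * Real.arcsin (κ * s)

theorem continuous_jumpPhase (c κ t j k : ℝ) : Continuous (jumpPhase c κ t j k) := by
  unfold jumpPhase
  have h1 : Continuous fun s : ℝ => Real.arcsin s := Real.continuous_arcsin
  have h2 : Continuous fun s : ℝ => Real.arcsin (κ * s) :=
    Real.continuous_arcsin.comp (continuous_const.mul continuous_id)
  fun_prop

theorem hasDerivAt_inv_sqrt_one_sub_sq {x : ℝ} (h : x ^ 2 < 1) :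
    HasDerivAt (fun x : ℝ => (√(1 - x ^ 2))⁻¹) (x / √(1 - x ^ 2) ^ 3) x := by
  have h0 : 0 < 1 - x ^ 2 := by linarith
  have h1 : 0 < √(1 - x ^ 2) := Real.sqrt_pos.2 h0
  have hd : HasDerivAt (fun x : ℝ => 1 - x ^ 2) (-(2 * x)) x := by
    simpa using (hasDerivAt_pow 2 x).const_sub 1
  refine ((hd.sqrt h0.ne').fun_inv h1.ne').congr_deriv ?_
  field_simp

theorem hasDerivAt_arcsin_of_sq_lt_one {x : ℝ} (h : x ^ 2 < 1) :
    HasDerivAt Real.arcsin (√(1 - x ^ 2))⁻¹ x := by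
  have := Real.hasDerivAt_arcsin (x := x) (by rintro rfl; norm_num at h)
    (by rintro rfl; norm_num at h)
  rwa [one_div] at this

/-- The function is the second derivative of `arcsin`: the identity times an increasing factor that
is at least `1`. So the third derivative of `arcsin` is at least `1` on `[0, 1)`, in integrated
form. -/
theorem sub_le_div_sqrt_pow_sub {x y : ℝ} (hx : 0 ≤ x) (hxy : x ≤ y) (hy : y < 1) :
    y - x ≤ y / √(1 - y ^ 2) ^ 3 - x / √(1 - x ^ 2) ^ 3 := by
  have hy2 : 0 < √(1 - y ^ 2) := Real.sqrt_pos.2 (by nlinarith)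
  have h1 : √(1 - y ^ 2) ≤ √(1 - x ^ 2) := Real.sqrt_le_sqrt (by nlinarith)
  have h2 : √(1 - y ^ 2) ≤ 1 := Real.sqrt_le_iff.2 ⟨zero_le_one, by nlinarith⟩
  have h3 : (1 : ℝ) ≤ (√(1 - y ^ 2) ^ 3)⁻¹ := (one_le_inv₀ (by positivity)).2 (pow_le_one₀ hy2.le h2)
  have h4 : (√(1 - x ^ 2) ^ 3)⁻¹ ≤ (√(1 - y ^ 2) ^ 3)⁻¹ := by gcongr
  rw [div_eq_mul_inv, div_eq_mul_inv]
  nlinarith [mul_le_mul_of_nonneg_left h4 hx, mul_le_mul_of_nonneg_left h3 (sub_nonneg.2 hxy)]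

/-- First derivative of `jumpPhase`. -/
noncomputable def jumpPhaseD1 (c κ t j k s : ℝ) : ℝ :=
  -(8 * c * t * s) + 2 * j * (√(1 - s ^ 2))⁻¹ + 2 * k * κ * (√(1 - (κ * s) ^ 2))⁻¹

/-- Second derivative of `jumpPhase`. -/
noncomputable def jumpPhaseD2 (c κ t j k s : ℝ) : ℝ :=
  -(8 * c * t) + 2 * j * (s / √(1 - s ^ 2) ^ 3) +
    2 * k * κ ^ 2 * ((κ * s) / √(1 - (κ * s) ^ 2) ^ 3)

theorem hasDerivAt_jumpPhase (c κ t j k : ℝ) {s : ℝ} (h1 : s ^ 2 < 1) (h2 : (κ * s) ^ 2 < 1) :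
    HasDerivAt (jumpPhase c κ t j k) (jumpPhaseD1 c κ t j k s) s := by
  have e1 := ((hasDerivAt_pow 2 s).const_mul (4 * c * t)).fun_neg
  have e2 := (hasDerivAt_arcsin_of_sq_lt_one h1).const_mul (2 * j)
  have e3 := ((hasDerivAt_arcsin_of_sq_lt_one h2).comp s
    ((hasDerivAt_id s).const_mul κ)).const_mul (2 * k)
  refine ((e1.add e2).add e3).congr_deriv ?_
  simp only [jumpPhaseD1]
  push_cast
  ring

theorem hasDerivAt_jumpPhaseD1 (c κ t j k : ℝ) {s : ℝ} (h1 : s ^ 2 < 1) (h2 : (κ * s) ^ 2 < 1) :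
    HasDerivAt (jumpPhaseD1 c κ t j k) (jumpPhaseD2 c κ t j k s) s := by
  have e1 := ((hasDerivAt_id s).const_mul (8 * c * t)).fun_neg
  have e2 := (hasDerivAt_inv_sqrt_one_sub_sq h1).const_mul (2 * j)
  have e3 := ((hasDerivAt_inv_sqrt_one_sub_sq h2).comp s
    ((hasDerivAt_id s).const_mul κ)).const_mul (2 * k * κ)
  refine ((e1.add e2).add e3).congr_deriv ?_
  simp only [jumpPhaseD2]
  ring

theorem continuousAt_jumpPhaseD2 (c κ t j k : ℝ) {s : ℝ} (h1 : s ^ 2 < 1)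
    (h2 : (κ * s) ^ 2 < 1) : ContinuousAt (jumpPhaseD2 c κ t j k) s := by
  have e1 : √(1 - s ^ 2) ^ 3 ≠ 0 := (pow_pos (Real.sqrt_pos.2 (by linarith)) 3).ne'
  have e2 : √(1 - (κ * s) ^ 2) ^ 3 ≠ 0 := (pow_pos (Real.sqrt_pos.2 (by linarith)) 3).ne'
  unfold jumpPhaseD2
  fun_prop (disch := assumption)

/-- Lower order derivatives may cancel, the third cannot: the quadratic term is gone and, as `j, k ≥
0`, both arcsines contribute with the same sign, in total at least `j + k`. -/
theorem subintervalBound_jumpPhase_of_large {c κ ε t j k b : ℝ} (hκ : 1 < κ) (hε : 0 < ε)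
    (ht : 1 ≤ |t|) (hj : 0 ≤ j) (hk : 0 ≤ k) (hlarge : ε * |t| ≤ j + k) (hb : κ * b < 1) :
    SubintervalBound (fun s => Complex.exp (jumpPhase c κ t j k s * Complex.I)) 0 b
      (vdcConst ε * |t| ^ (-(1 / 3 : ℝ))) := by
  have hκs : ∀ s ∈ Set.Icc 0 b, 0 ≤ κ * s ∧ κ * s < 1 := by
    intro s hs
    exact ⟨mul_nonneg (by linarith) hs.1, lt_of_le_of_lt (by gcongr; exact hs.2) hb⟩
  have hs1 : ∀ s ∈ Set.Icc 0 b, s < 1 := by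
    intro s hs
    have := hκs s hs
    nlinarith [hs.1]
  have h1 : ∀ s ∈ Set.Icc 0 b, s ^ 2 < 1 := by
    intro s hs
    have := hs1 s hs
    nlinarith [hs.1]
  have h2 : ∀ s ∈ Set.Icc 0 b, (κ * s) ^ 2 < 1 := by
    intro s hs
    have := hκs s hs
    nlinarith
  refine subintervalBound_of_third_deriv hε ht (fun s hs => hasDerivAt_jumpPhase c κ t j k
    (h1 s hs) (h2 s hs)) (fun s hs => hasDerivAt_jumpPhaseD1 c κ t j k (h1 s hs) (h2 s hs))
    (fun s hs => (continuousAt_jumpPhaseD2 c κ t j k (h1 s hs) (h2 s hs)).continuousWithinAt) ?_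
  intro x hx y hy hxy
  have e1 := sub_le_div_sqrt_pow_sub hx.1 hxy (hs1 y hy)
  have e2 := sub_le_div_sqrt_pow_sub (hκs x hx).1 (by gcongr) (hκs y hy).2
  set A := y / √(1 - y ^ 2) ^ 3 - x / √(1 - x ^ 2) ^ 3 with hA
  set B := κ * y / √(1 - (κ * y) ^ 2) ^ 3 - κ * x / √(1 - (κ * x) ^ 2) ^ 3 with hB
  have e3 : jumpPhaseD2 c κ t j k y - jumpPhaseD2 c κ t j k x = 2 * j * A + 2 * k * (κ ^ 2 * B) := by
    simp only [jumpPhaseD2, hA, hB]; ring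
  rw [e3]
  have hd : 0 ≤ y - x := by linarith
  have e4 : y - x ≤ κ ^ 2 * B := by
    have : y - x ≤ κ * y - κ * x := by nlinarith
    have hB0 : y - x ≤ B := by linarith
    have : 1 ≤ κ ^ 2 := by nlinarith
    nlinarith
  have e5 := mul_le_mul_of_nonneg_left e1 hj
  have e6 := mul_le_mul_of_nonneg_left e4 hk
  have e7 := mul_le_mul_of_nonneg_right hlarge hd
  nlinarith [mul_nonneg hj hd, mul_nonneg hk hd]

theorem div_sqrt_pow_le {x : ℝ} (hx : 0 ≤ x) (h : x ^ 2 ≤ 3 / 4) :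
    0 ≤ x / √(1 - x ^ 2) ^ 3 ∧ x / √(1 - x ^ 2) ^ 3 ≤ 8 := by
  have h1 : (1 / 2 : ℝ) ≤ √(1 - x ^ 2) := Real.le_sqrt_of_sq_le (by linarith)
  refine ⟨by positivity, ?_⟩
  have h2 : (1 / 2 : ℝ) ^ 3 ≤ √(1 - x ^ 2) ^ 3 := by gcongr
  rw [div_le_iff₀ (by positivity)]
  nlinarith

theorem abs_le_of_add_le_mul {c κ ε t j k : ℝ} (hε : ε * (4 * κ ^ 2) ≤ c)
    (hsmall : j + k ≤ ε * |t|) : 16 * κ ^ 2 * (j + k) ≤ 4 * c * |t| := by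
  have h1 : 16 * κ ^ 2 * (j + k) ≤ 16 * κ ^ 2 * (ε * |t|) := by gcongr
  have h2 := mul_le_mul_of_nonneg_right hε (abs_nonneg t)
  nlinarith

/-- Away from the edge the second derivatives of the arcsines are bounded, so for small `j + k` they
add at most `4c|t|` to `-8ct`; at least half of the latter survives. -/
theorem subintervalBound_jumpPhase_interior {c κ ε t j k b : ℝ} (hc : 0 < c) (hκ : 1 < κ)
    (ht : 1 ≤ |t|) (hj : 0 ≤ j) (hk : 0 ≤ k) (hε : ε * (4 * κ ^ 2) ≤ c)
    (hsmall : j + k ≤ ε * |t|) (hb : (κ * b) ^ 2 ≤ 3 / 4) :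
    SubintervalBound (fun s => Complex.exp (jumpPhase c κ t j k s * Complex.I)) 0 b
      (vdcConst (4 * c) * |t| ^ (-(1 / 3 : ℝ))) := by
  have h2 : ∀ s ∈ Set.Icc 0 b, (κ * s) ^ 2 ≤ 3 / 4 := by
    intro s hs
    refine le_trans ?_ hb
    have := hs.1
    have := hs.2
    gcongr
  have h1 : ∀ s ∈ Set.Icc 0 b, s ^ 2 ≤ 3 / 4 := by
    intro s hs
    refine le_trans ?_ (h2 s hs)
    have := hs.1
    have : s ≤ κ * s := by nlinarith
    gcongr
  have hlt : ∀ {u : ℝ}, u ≤ 3 / 4 → u < 1 := fun h => by linarith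
  have hD : ∀ s ∈ Set.Icc 0 b, jumpPhaseD2 c κ t j k s + 8 * c * t ∈ Set.Icc 0 (4 * c * |t|) := by
    intro s hs
    have e1 := div_sqrt_pow_le hs.1 (h1 s hs)
    have e2 := div_sqrt_pow_le (mul_nonneg (by linarith) hs.1) (h2 s hs)
    have e3 : jumpPhaseD2 c κ t j k s + 8 * c * t = 2 * j * (s / √(1 - s ^ 2) ^ 3) +
        2 * k * κ ^ 2 * ((κ * s) / √(1 - (κ * s) ^ 2) ^ 3) := by
      simp only [jumpPhaseD2]; ring
    rw [e3]
    set A := s / √(1 - s ^ 2) ^ 3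
    set B := κ * s / √(1 - (κ * s) ^ 2) ^ 3
    have hκ2 : 1 ≤ κ ^ 2 := by nlinarith
    refine ⟨add_nonneg (mul_nonneg (by linarith) e1.1) (mul_nonneg (by positivity) e2.1),
      le_trans ?_ (abs_le_of_add_le_mul hε hsmall)⟩
    have f1 : 2 * j * A ≤ 2 * j * 8 := by have := e1.2; gcongr
    have f2 : 2 * k * κ ^ 2 * B ≤ 2 * k * κ ^ 2 * 8 := by have := e2.2; gcongr
    nlinarith [mul_le_mul_of_nonneg_left hκ2 hj]
  refine subintervalBound_of_second_deriv (by positivity) ht (fun s hs => hasDerivAt_jumpPhase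
    c κ t j k (hlt (h1 s hs)) (hlt (h2 s hs))) (fun s hs => hasDerivAt_jumpPhaseD1 c κ t j k
    (hlt (h1 s hs)) (hlt (h2 s hs))) ?_
  rcases le_total 0 t with h | h
  · rw [abs_of_nonneg h] at hD ⊢
    refine Or.inr fun s hs => ?_
    linarith [(hD s hs).2]
  · rw [abs_of_nonpos h] at hD ⊢
    refine Or.inl fun s hs => ?_
    have := mul_nonneg hc.le (neg_nonneg.2 h)
    linarith [(hD s hs).1]

/-- The phase of the transmitted waves near the band edge, in the angle of the smaller band. -/
noncomputable def edgePhase (c κ t j k v : ℝ) : ℝ :=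
  2 * c * t / κ ^ 2 * (Real.cos v - 1) + 2 * j * Real.arcsin (Real.sin (v / 2) / κ) + k * v

/-- The substitution `s = sin (v/2) / κ` turns the singular `arcsin (κ s)` into `v/2`. The `k` term
becomes linear, so no smallness of `k` is needed near the edge. -/
theorem jumpPhase_sin_div {κ : ℝ} (hκ : 0 < κ) (c t j k : ℝ) {v : ℝ}
    (hv : v ∈ Set.Icc 0 Real.pi) :
    jumpPhase c κ t j k (Real.sin (v / 2) / κ) = edgePhase c κ t j k v := by
  have h1 : κ * (Real.sin (v / 2) / κ) = Real.sin (v / 2) := by field_simp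
  have h2 : Real.arcsin (Real.sin (v / 2)) = v / 2 :=
    Real.arcsin_sin (by linarith [hv.1, Real.pi_pos]) (by linarith [hv.2])
  have h3 : Real.cos v = 1 - 2 * Real.sin (v / 2) ^ 2 := by
    have := Real.cos_two_mul (v / 2)
    rw [mul_div_cancel₀ v two_ne_zero] at this
    rw [this, Real.cos_sq']
    ring
  simp only [jumpPhase, edgePhase, h1, h2, h3]
  field_simp
  ring

theorem hasDerivAt_sin_half (v : ℝ) :
    HasDerivAt (fun v => Real.sin (v / 2)) (Real.cos (v / 2) / 2) v := by
  refine ((Real.hasDerivAt_sin (v / 2)).comp v ((hasDerivAt_id v).div_const 2)).congr_deriv ?_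
  ring

theorem hasDerivAt_cos_half (v : ℝ) :
    HasDerivAt (fun v => Real.cos (v / 2)) (-(Real.sin (v / 2) / 2)) v := by
  refine ((Real.hasDerivAt_cos (v / 2)).comp v ((hasDerivAt_id v).div_const 2)).congr_deriv ?_
  ring

theorem sin_half_div_sq_lt_one {κ : ℝ} (hκ : 1 < κ) (v : ℝ) : (Real.sin (v / 2) / κ) ^ 2 < 1 := by
  rw [div_pow, div_lt_one (by positivity)]
  nlinarith [Real.sin_sq_le_one (v / 2)]

/-- First derivative of `edgePhase`. -/
noncomputable def edgePhaseD1 (c κ t j k v : ℝ) : ℝ :=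
  -(2 * c * t / κ ^ 2 * Real.sin v) +
    j / κ * (Real.cos (v / 2) * (√(1 - (Real.sin (v / 2) / κ) ^ 2))⁻¹) + k

/-- Second derivative of the angle of the larger band with respect to that of the smaller one. -/
noncomputable def edgeCurvature (κ v : ℝ) : ℝ :=
  (-(Real.sin (v / 2) / 2) * (√(1 - (Real.sin (v / 2) / κ) ^ 2))⁻¹ +
    Real.cos (v / 2) * (Real.sin (v / 2) / κ / √(1 - (Real.sin (v / 2) / κ) ^ 2) ^ 3 *
      (Real.cos (v / 2) / 2 / κ))) / κ

theorem hasDerivAt_edgePhase (c : ℝ) {κ : ℝ} (hκ : 1 < κ) (t j k v : ℝ) :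
    HasDerivAt (edgePhase c κ t j k) (edgePhaseD1 c κ t j k v) v := by
  have e1 := ((Real.hasDerivAt_cos v).sub_const 1).const_mul (2 * c * t / κ ^ 2)
  have e2 := ((hasDerivAt_arcsin_of_sq_lt_one (sin_half_div_sq_lt_one hκ v)).comp v
    ((hasDerivAt_sin_half v).div_const κ)).const_mul (2 * j)
  have e3 := (hasDerivAt_id v).const_mul k
  refine ((e1.add e2).add e3).congr_deriv ?_
  simp only [edgePhaseD1]
  ring

theorem hasDerivAt_edgePhaseD1 (c : ℝ) {κ : ℝ} (hκ : 1 < κ) (t j k v : ℝ) :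
    HasDerivAt (edgePhaseD1 c κ t j k)
      (-(2 * c * t / κ ^ 2 * Real.cos v) + j * edgeCurvature κ v) v := by
  have e1 := ((Real.hasDerivAt_sin v).const_mul (2 * c * t / κ ^ 2)).fun_neg
  have e2 := (((hasDerivAt_cos_half v).mul ((hasDerivAt_inv_sqrt_one_sub_sq
    (sin_half_div_sq_lt_one hκ v)).comp v ((hasDerivAt_sin_half v).div_const κ)))).const_mul (j / κ)
  refine ((e1.add e2).add_const k).congr_deriv ?_
  simp only [edgeCurvature, Function.comp]
  ring

/-- Since `κ > 1`, the edge of the smaller band lies strictly inside the larger one: the square root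
stays above `√(1 - κ⁻²)`. -/
theorem exists_abs_edgeCurvature_le {κ : ℝ} (hκ : 1 < κ) : ∃ E, 0 < E ∧ ∀ v, |edgeCurvature κ v| ≤ E := by
  set σ : ℝ := √(1 - (1 / κ) ^ 2) with hσ
  have hσ0 : 0 < σ := by
    refine Real.sqrt_pos.2 ?_
    rw [div_pow, one_pow, sub_pos, div_lt_one (by positivity)]
    nlinarith
  refine ⟨1 * σ⁻¹ + 1 * (1 / σ ^ 3 * 1), by positivity, fun v => ?_⟩
  have hκ0 : 0 < κ := by linarith
  have h1 : σ ≤ √(1 - (Real.sin (v / 2) / κ) ^ 2) := by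
    refine Real.sqrt_le_sqrt (sub_le_sub_left ?_ 1)
    rw [div_pow, div_pow, one_pow]
    gcongr
    exact Real.sin_sq_le_one _
  set R := √(1 - (Real.sin (v / 2) / κ) ^ 2)
  have hR : 0 < R := hσ0.trans_le h1
  have hs := Real.abs_sin_le_one (v / 2)
  have hc := Real.abs_cos_le_one (v / 2)
  have hdiv : ∀ {x : ℝ}, |x| ≤ 1 → |x / κ| ≤ 1 := by
    intro x hx
    rw [abs_div, abs_of_pos hκ0]
    exact (div_le_one hκ0).2 (by linarith)
  unfold edgeCurvature
  rw [abs_div, abs_of_pos hκ0]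
  refine (div_le_self (abs_nonneg _) hκ.le).trans ((abs_add_le _ _).trans (add_le_add ?_ ?_))
  · rw [abs_mul, abs_inv, abs_of_pos hR]
    have : |-(Real.sin (v / 2) / 2)| ≤ 1 := by
      rw [abs_neg, abs_div, abs_two]; linarith
    gcongr
  · rw [abs_mul, abs_mul, abs_div (Real.sin (v / 2) / κ), abs_of_pos (pow_pos hR 3)]
    have h3 : |Real.cos (v / 2) / 2| ≤ 1 := by rw [abs_div, abs_two]; linarith
    have := hdiv h3
    have := hdiv hs
    gcongr

-- Here `-cos v ≥ 1/2`, so the free term has second derivative at least `c|t|/κ²` in size. The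
-- choice of `ε` lets the `j` term use up at most half of it.
open Real in
theorem subintervalBound_edgePhase {c κ ε E t j k : ℝ} (hc : 0 < c) (hκ : 1 < κ)
    (ht : 1 ≤ |t|) (hj : 0 ≤ j) (hE : ∀ v, |edgeCurvature κ v| ≤ E)
    (hε : ε * E ≤ c / (2 * κ ^ 2)) (hsmall : j ≤ ε * |t|) :
    SubintervalBound (fun v => Complex.exp (edgePhase c κ t j k v * Complex.I)) (2 * π / 3) π
      (vdcConst (c / (2 * κ ^ 2)) * |t| ^ (-(1 / 3 : ℝ))) := by
  have hκ0 : 0 < κ := by linarith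
  have hE0 : 0 ≤ E := (abs_nonneg _).trans (hE 0)
  refine subintervalBound_of_second_deriv (by positivity) ht
    (fun v _ => hasDerivAt_edgePhase c hκ t j k v)
    (fun v _ => hasDerivAt_edgePhaseD1 c hκ t j k v) ?_
  have hcos : ∀ v ∈ Set.Icc (2 * π / 3) π, 1 / 2 ≤ -cos v := by
    intro v hv
    rw [← cos_pi_div_three, ← cos_pi_sub]
    exact cos_le_cos_of_nonneg_of_le_pi (by linarith [hv.2]) (by linarith [pi_pos])
      (by linarith [hv.1])
  have hjE : ∀ v, |j * edgeCurvature κ v| ≤ c / (2 * κ ^ 2) * |t| := by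
    intro v
    rw [abs_mul, abs_of_nonneg hj]
    calc j * |edgeCurvature κ v| ≤ ε * |t| * E := by
          have := hj.trans hsmall
          have := hE v
          gcongr
      _ = ε * E * |t| := by ring
      _ ≤ _ := by gcongr
  have hmain : ∀ v ∈ Set.Icc (2 * π / 3) π,
      2 * (c / (2 * κ ^ 2) * |t|) ≤ 2 * c * |t| / κ ^ 2 * -cos v := by
    intro v hv
    calc 2 * (c / (2 * κ ^ 2) * |t|) = 2 * c * |t| / κ ^ 2 * (1 / 2) := by field_simp
      _ ≤ _ := by gcongr; exact hcos v hv
  rcases le_total 0 t with h | h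
  · rw [abs_of_nonneg h] at hjE hmain ⊢
    refine Or.inl fun v hv => ?_
    have := (abs_le.1 (hjE v)).1
    linarith [hmain v hv]
  · rw [abs_of_nonpos h] at hjE hmain ⊢
    refine Or.inr fun v hv => ?_
    have h1 := (abs_le.1 (hjE v)).2
    have h2 := hmain v hv
    have h3 : 2 * c * -t / κ ^ 2 * -cos v = 2 * c * t / κ ^ 2 * cos v := by ring
    rw [h3] at h2
    linarith

-- The edge estimate is transported back to the variable `s`. The endpoint `√3/2/κ` corresponds to
-- `v = 2π/3`, and the Jacobian `cos (v/2) / (2κ)` is an antitone amplitude in `[0, 1]`.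
open Real in
theorem subintervalBound_jumpPhase_edge {c κ ε E t j k : ℝ} (hc : 0 < c) (hκ : 1 < κ)
    (ht : 1 ≤ |t|) (hj : 0 ≤ j) (hE : ∀ v, |edgeCurvature κ v| ≤ E)
    (hε : ε * E ≤ c / (2 * κ ^ 2)) (hsmall : j ≤ ε * |t|) :
    SubintervalBound (fun s => Complex.exp (jumpPhase c κ t j k s * Complex.I))
      (√3 / 2 / κ) (1 / κ)
      (vdcConst (c / (2 * κ ^ 2)) * |t| ^ (-(1 / 3 : ℝ))) := by
  have hκ0 : 0 < κ := by linarith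
  have hpi := pi_pos
  have key := (subintervalBound_edgePhase (k := k) hc hκ ht hj hE hε hsmall).mul_monotoneOn
    (g := fun v => cos (v / 2) / 2 / κ) (B := 1) ?_ one_pos ?_ ?_
  · rw [one_mul] at key
    intro x y hx hxy hy
    have hmem : ∀ z, √3 / 2 / κ ≤ z → z ≤ 1 / κ → 2 * π / 3 ≤ 2 * arcsin (κ * z) ∧
        2 * arcsin (κ * z) ≤ π ∧ sin (2 * arcsin (κ * z) / 2) / κ = z := by
      intro z hz1 hz2
      have h1 : √3 / 2 ≤ κ * z := by rw [div_le_iff₀ hκ0] at hz1; linarith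
      have h2 : κ * z ≤ 1 := by rw [le_div_iff₀ hκ0] at hz2; linarith
      refine ⟨?_, by linarith [arcsin_le_pi_div_two (κ * z)], ?_⟩
      · have : arcsin (√3 / 2) = π / 3 := by
          rw [← sin_pi_div_three, arcsin_sin (by linarith) (by linarith)]
        have := monotone_arcsin h1
        linarith
      · rw [mul_div_cancel_left₀ _ two_ne_zero, sin_arcsin ?_ h2]
        · field_simp
        · have : (0 : ℝ) ≤ √3 := sqrt_nonneg 3
          linarith
    obtain ⟨hx1, hx2, hx3⟩ := hmem x hx (hxy.trans hy)
    obtain ⟨hy1, hy2, hy3⟩ := hmem y (hx.trans hxy) hy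
    have hle : 2 * arcsin (κ * x) ≤ 2 * arcsin (κ * y) := by
      have := monotone_arcsin (mul_le_mul_of_nonneg_left hxy hκ0.le)
      linarith
    have hsub := intervalIntegral.integral_deriv_smul_comp
      (a := 2 * arcsin (κ * x)) (b := 2 * arcsin (κ * y)) (f := fun v => sin (v / 2) / κ)
      (f' := fun v => cos (v / 2) / 2 / κ)
      (g := fun s => Complex.exp (jumpPhase c κ t j k s * Complex.I))
      (fun v _ => (hasDerivAt_sin_half v).div_const κ) (by fun_prop)
      (by
        have := continuous_jumpPhase c κ t j k
        fun_prop)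
    simp only [hx3, hy3] at hsub
    rw [← hsub]
    refine le_of_eq_of_le (congrArg _ ?_) (key _ _ hx1 hle hy2)
    refine intervalIntegral.integral_congr fun v hv => ?_
    rw [Set.uIcc_of_le hle] at hv
    simp only [Function.comp, Complex.real_smul]
    rw [jumpPhase_sin_div hκ0 c t j k ⟨by linarith [hv.1], by linarith [hv.2]⟩, mul_comm]
  · exact continuousOn_cexp_mul_I fun v _ =>
      (hasDerivAt_edgePhase c hκ t j k v).continuousAt.continuousWithinAt
  · intro v hv
    have h0 : 0 ≤ cos (v / 2) := cos_nonneg_of_mem_Icc ⟨by linarith [hv.1], by linarith [hv.2]⟩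
    refine ⟨by positivity, ?_⟩
    rw [div_div, div_le_one (by positivity)]
    linarith [cos_le_one (v / 2)]
  · refine Or.inr fun u hu v hv huv => ?_
    have : cos (v / 2) ≤ cos (u / 2) :=
      cos_le_cos_of_nonneg_of_le_pi (by linarith [hu.1]) (by linarith [hv.2]) (by linarith)
    dsimp only
    gcongr

/-- Uniform decay of the oscillatory integrals with two competing phases, over the common band. -/
theorem exists_subintervalBound_jumpPhase {c κ : ℝ} (hc : 0 < c) (hκ : 1 < κ) :
    ∃ C : ℝ, 0 < C ∧ ∀ t j k : ℝ, 1 ≤ |t| → 0 ≤ j → 0 ≤ k →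
      SubintervalBound (fun s => Complex.exp (jumpPhase c κ t j k s * Complex.I)) 0 (1 / κ)
        (C * |t| ^ (-(1 / 3 : ℝ))) := by
  have hκ0 : 0 < κ := by linarith
  obtain ⟨E, hE0, hE⟩ := exists_abs_edgeCurvature_le hκ
  -- The first entry serves the interior estimate, the second absorbs the curvature bound `E` near
  -- the edge.
  set ε : ℝ := min (c / (4 * κ ^ 2)) (c / (2 * κ ^ 2) / E) with hε
  have hε0 : 0 < ε := by positivity
  have hε1 : ε * (4 * κ ^ 2) ≤ c := by
    rw [← le_div_iff₀ (by positivity)]; exact min_le_left _ _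
  have hε2 : ε * E ≤ c / (2 * κ ^ 2) := by
    rw [← le_div_iff₀ hE0]; exact min_le_right _ _
  have hc4 : 0 < 4 * c := by positivity
  have hcκ : 0 < c / (2 * κ ^ 2) := by positivity
  refine ⟨vdcConst ε + (vdcConst (4 * c) + vdcConst (c / (2 * κ ^ 2))), by
    have := vdcConst_pos hε0; have := vdcConst_pos hc4; have := vdcConst_pos hcκ
    positivity, ?_⟩
  intro t j k ht hj hk
  have hcont : Continuous (fun s => Complex.exp (jumpPhase c κ t j k s * Complex.I)) := by
    have := continuous_jumpPhase c κ t j k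
    fun_prop
  have ht3 : 0 < |t| ^ (-(1 / 3 : ℝ)) := Real.rpow_pos_of_pos (by linarith) _
  have p1 := mul_pos (vdcConst_pos hε0) ht3
  have p2 := mul_pos (vdcConst_pos hc4) ht3
  have p3 := mul_pos (vdcConst_pos hcκ) ht3
  rw [add_mul, add_mul]
  rcases le_total (ε * |t|) (j + k) with h | h
  -- The third derivative estimate requires `κ b < 1`, so the edge itself is reached as a limit.
  · refine SubintervalBound.mono (SubintervalBound.of_lt hcont.continuousOn p1.le ?_)
      (le_add_of_nonneg_right (by positivity))
    intro b' _ hb'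
    refine subintervalBound_jumpPhase_of_large hκ hε0 ht hj hk h ?_
    rw [lt_div_iff₀ hκ0] at hb'
    linarith
  · refine SubintervalBound.mono (SubintervalBound.split (b := √3 / 2 / κ)
      (subintervalBound_jumpPhase_interior hc hκ ht hj hk hε1 h ?_)
      (subintervalBound_jumpPhase_edge hc hκ ht hj hE hε2 (by linarith)) (by positivity) ?_
      hcont.continuousOn) (le_add_of_nonneg_left p1.le)
    · have : κ * (√3 / 2 / κ) = √3 / 2 := by field_simp
      rw [this, div_pow, Real.sq_sqrt (by norm_num)]
      norm_num
    · gcongr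
      have : √3 ≤ 2 := by rw [Real.sqrt_le_left (by norm_num)]; norm_num
      linarith

/-! ### Integrals over the upper half circle -/

/-- Boundary value on the upper half circle of the square root `√(1 - (κ sin (θ / 2)) ^ 2)`. Outside
the common band it is purely imaginary. -/
noncomputable def bandRoot (κ θ : ℝ) : ℂ :=
  (√(1 - (κ * Real.sin (θ / 2)) ^ 2) : ℂ) - (√((κ * Real.sin (θ / 2)) ^ 2 - 1) : ℂ) * Complex.I

/-- The transmitted wave integrand on the upper half circle. -/
noncomputable def bandIntegrand (c κ t : ℝ) (j k : ℕ) (θ : ℝ) : ℂ :=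
  Complex.exp ((2 * c * t * Real.cos θ + j * θ + -(2 * c * t) : ℝ) * Complex.I) *
    (κ * Real.cos (θ / 2) * (κ * Real.cos (θ / 2) - bandRoot κ θ)) *
    (bandRoot κ θ + κ * Real.sin (θ / 2) * Complex.I) ^ (2 * k)

theorem continuous_bandRoot (κ : ℝ) : Continuous (bandRoot κ) := by
  unfold bandRoot
  fun_prop

theorem continuous_bandIntegrand (c κ t : ℝ) (j k : ℕ) : Continuous (bandIntegrand c κ t j k) := by
  have := continuous_bandRoot κ
  unfold bandIntegrand
  fun_prop

theorem sqrt_add_mul_I_eq_cexp_arcsin {x : ℝ} (h0 : -1 ≤ x) (h1 : x ≤ 1) :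
    (√(1 - x ^ 2) : ℂ) + x * Complex.I = Complex.exp (Real.arcsin x * Complex.I) := by
  rw [Complex.exp_mul_I, ← Complex.ofReal_cos, ← Complex.ofReal_sin, Real.sin_arcsin h0 h1,
    Real.cos_arcsin]

/-- In this reciprocal form the antitonicity and the range `[0, 1]` are evident. Beyond the band
edge, with `x = κ sin (θ/2)`, the square of this number is the modulus of the right root. -/
theorem sub_sqrt_sq_sub_one {x : ℝ} (hx : 1 ≤ x) :
    x - √(x ^ 2 - 1) = (x + √(x ^ 2 - 1))⁻¹ := by
  have h := Real.sq_sqrt (show 0 ≤ x ^ 2 - 1 by nlinarith)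
  have := Real.sqrt_nonneg (x ^ 2 - 1)
  refine eq_inv_of_mul_eq_one_left ?_
  nlinarith

theorem antitoneOn_sub_sqrt_sq_sub_one : AntitoneOn (fun x : ℝ => x - √(x ^ 2 - 1)) (Set.Ici 1) := by
  intro x hx y hy hxy
  have hx : 1 ≤ x := hx
  have hy : 1 ≤ y := hy
  simp only [sub_sqrt_sq_sub_one hx, sub_sqrt_sq_sub_one hy]
  gcongr

theorem sub_sqrt_sq_sub_one_mem {x : ℝ} (hx : 1 ≤ x) : x - √(x ^ 2 - 1) ∈ Set.Icc (0 : ℝ) 1 := by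
  rw [sub_sqrt_sq_sub_one hx]
  have := Real.sqrt_nonneg (x ^ 2 - 1)
  exact ⟨by positivity, inv_le_one_of_one_le₀ (by linarith)⟩

open Real in
theorem sin_half_mono {u v : ℝ} (hu : 0 ≤ u) (huv : u ≤ v) (hv : v ≤ π) :
    sin (u / 2) ≤ sin (v / 2) :=
  sin_le_sin_of_le_of_le_pi_div_two (by linarith [pi_pos]) (by linarith) (by linarith)

open Real in
theorem cos_half_anti {u v : ℝ} (hu : 0 ≤ u) (huv : u ≤ v) (hv : v ≤ π) :
    cos (v / 2) ≤ cos (u / 2) :=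
  cos_le_cos_of_nonneg_of_le_pi (by linarith) (by linarith [pi_pos]) (by linarith)

/-- The endpoint of the common band. -/
noncomputable def bandEdge (κ : ℝ) : ℝ := 2 * Real.arcsin (1 / κ)

open Real in
theorem bandEdge_mem {κ : ℝ} (hκ : 1 < κ) : bandEdge κ ∈ Set.Icc 0 π := by
  unfold bandEdge
  have : 0 ≤ arcsin (1 / κ) := arcsin_nonneg.2 (by positivity)
  exact ⟨by linarith, by linarith [arcsin_le_pi_div_two (1 / κ)]⟩

theorem sin_bandEdge_half {κ : ℝ} (hκ : 1 < κ) : Real.sin (bandEdge κ / 2) = 1 / κ := by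
  have h0 : 0 < 1 / κ := by positivity
  unfold bandEdge
  rw [mul_div_cancel_left₀ _ two_ne_zero, Real.sin_arcsin (by linarith)]
  exact (div_le_one (by linarith)).2 hκ.le

open Real in
theorem mul_sin_half_le_one {κ θ : ℝ} (hκ : 1 < κ) (h0 : 0 ≤ θ) (h1 : θ ≤ bandEdge κ) :
    0 ≤ κ * sin (θ / 2) ∧ κ * sin (θ / 2) ≤ 1 := by
  have hm := bandEdge_mem hκ
  have := sin_half_mono h0 h1 hm.2
  rw [sin_bandEdge_half hκ, le_div_iff₀ (by linarith)] at this
  refine ⟨mul_nonneg (by linarith) (sin_nonneg_of_nonneg_of_le_pi ?_ ?_), by linarith⟩ <;>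
    linarith [hm.2]

open Real in
theorem one_le_mul_sin_half {κ θ : ℝ} (hκ : 1 < κ) (h0 : bandEdge κ ≤ θ) (h1 : θ ≤ π) :
    1 ≤ κ * sin (θ / 2) := by
  have hm := bandEdge_mem hκ
  have := sin_half_mono hm.1 h0 h1
  rw [sin_bandEdge_half hκ, div_le_iff₀ (by linarith)] at this
  linarith

-- The factor `cos (θ/2) / 2` is the Jacobian of `s = sin (θ/2)`. What remains is one oscillating
-- exponential in `s` times a difference of two antitone amplitudes.
open Real in
theorem bandIntegrand_eq_of_le {c κ t θ : ℝ} (hκ : 1 < κ) (j k : ℕ) (h0 : 0 ≤ θ)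
    (h1 : θ ≤ bandEdge κ) :
    bandIntegrand c κ t j k θ = (cos (θ / 2) / 2) •
      ((Complex.exp (jumpPhase c κ t j k (sin (θ / 2)) * Complex.I) *
          ((2 * κ ^ 2 * √(1 - sin (θ / 2) ^ 2) : ℝ) : ℂ)) +
        -1 * (Complex.exp (jumpPhase c κ t j k (sin (θ / 2)) * Complex.I) *
          ((2 * κ * √(1 - (κ * sin (θ / 2)) ^ 2) : ℝ) : ℂ))) := by
  obtain ⟨hx0, hx1⟩ := mul_sin_half_le_one hκ h0 h1
  have hm := bandEdge_mem hκ
  have hq : √((κ * sin (θ / 2)) ^ 2 - 1) = 0 := sqrt_eq_zero_of_nonpos (by nlinarith)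
  have hc : √(1 - sin (θ / 2) ^ 2) = cos (θ / 2) := by
    rw [← cos_sq', sqrt_sq]
    exact cos_nonneg_of_mem_Icc ⟨by linarith [pi_pos], by linarith [hm.2]⟩
  have hQ : bandRoot κ θ + κ * sin (θ / 2) * Complex.I =
      Complex.exp (arcsin (κ * sin (θ / 2)) * Complex.I) := by
    rw [← sqrt_add_mul_I_eq_cexp_arcsin (by linarith) hx1, bandRoot, hq]
    push_cast
    ring
  have hcos : cos θ = 1 - 2 * sin (θ / 2) ^ 2 := by
    have := cos_two_mul (θ / 2)
    rw [mul_div_cancel₀ θ two_ne_zero] at this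
    rw [this, cos_sq']
    ring
  have hexp : Complex.exp (jumpPhase c κ t j k (sin (θ / 2)) * Complex.I) =
      Complex.exp ((2 * c * t * cos θ + j * θ + -(2 * c * t) : ℝ) * Complex.I) *
      Complex.exp (arcsin (κ * sin (θ / 2)) * Complex.I) ^ (2 * k) := by
    rw [← Complex.exp_nat_mul, ← Complex.exp_add]
    congr 1
    have : arcsin (sin (θ / 2)) = θ / 2 :=
      arcsin_sin (by linarith [pi_pos]) (by linarith [hm.2])
    simp only [jumpPhase, this, hcos]
    push_cast
    ring
  rw [hc, hexp, bandIntegrand, hQ, bandRoot, hq, Complex.real_smul]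
  push_cast
  ring

-- Beyond the edge the right root is `-(x - √(x² - 1))²` with `x = κ sin (θ/2)`. Its powers give a
-- sign and an evanescent monotone factor, so the phase no longer depends on `k`.
open Real in
theorem bandIntegrand_eq_of_ge {c κ t θ : ℝ} (hκ : 1 < κ) (j k : ℕ) (h0 : bandEdge κ ≤ θ)
    (h1 : θ ≤ π) :
    bandIntegrand c κ t j k θ =
      (-1) ^ k * (Complex.exp ((2 * c * t * cos θ + j * θ + -(2 * c * t) : ℝ) * Complex.I) *
        (((κ * sin (θ / 2) - √((κ * sin (θ / 2)) ^ 2 - 1)) ^ (2 * k) : ℝ) : ℂ) *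
          ((κ * cos (θ / 2) : ℝ) : ℂ) * ((κ * cos (θ / 2) : ℝ) : ℂ)) +
      ((-1) ^ k * Complex.I) *
      (Complex.exp ((2 * c * t * cos θ + j * θ + -(2 * c * t) : ℝ) * Complex.I) *
        (((κ * sin (θ / 2) - √((κ * sin (θ / 2)) ^ 2 - 1)) ^ (2 * k) : ℝ) : ℂ) *
          ((κ * cos (θ / 2) : ℝ) : ℂ) * ((√((κ * sin (θ / 2)) ^ 2 - 1) : ℝ) : ℂ)) := by
  have hx1 := one_le_mul_sin_half hκ h0 h1
  have hq : √(1 - (κ * sin (θ / 2)) ^ 2) = 0 := sqrt_eq_zero_of_nonpos (by nlinarith)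
  have hQ : (bandRoot κ θ + κ * sin (θ / 2) * Complex.I) ^ (2 * k) =
      (-1) ^ k * (((κ * sin (θ / 2) - √((κ * sin (θ / 2)) ^ 2 - 1)) ^ (2 * k) : ℝ) : ℂ) := by
    have : bandRoot κ θ + κ * sin (θ / 2) * Complex.I =
      Complex.I * ((κ * sin (θ / 2) - √((κ * sin (θ / 2)) ^ 2 - 1) : ℝ) : ℂ) := by
      rw [bandRoot, hq]
      push_cast
      ring
    rw [this, mul_pow, pow_mul Complex.I, Complex.I_sq]
    push_cast
    rfl
  rw [bandIntegrand, hQ, bandRoot, hq]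
  push_cast
  ring

open Real in
theorem exists_norm_integral_bandIntegrand_inner_le {c κ : ℝ} (hc : 0 < c) (hκ : 1 < κ) :
    ∃ C : ℝ, 0 < C ∧ ∀ (t : ℝ) (j k : ℕ), 1 ≤ |t| →
      ‖∫ θ in 0..(bandEdge κ), bandIntegrand c κ t j k θ‖ ≤ C * |t| ^ (-(1 / 3 : ℝ)) := by
  obtain ⟨C, hC, hb⟩ := exists_subintervalBound_jumpPhase hc hκ
  refine ⟨2 * κ ^ 2 * C + 2 * κ * C, by positivity, fun t j k ht => ?_⟩
  have hm := bandEdge_mem hκ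
  have hκ0 : 0 < κ := by linarith
  have hΦ := continuous_jumpPhase c κ t j k
  have hcont : Continuous fun s => Complex.exp (jumpPhase c κ t j k s * Complex.I) := by fun_prop
  have h := hb t j k ht (Nat.cast_nonneg j) (Nat.cast_nonneg k)
  have b1 := h.mul_monotoneOn (g := fun s => 2 * κ ^ 2 * √(1 - s ^ 2)) (B := 2 * κ ^ 2)
    hcont.continuousOn (by positivity) ?_ (Or.inr ?_)
  · have b2 := h.mul_monotoneOn (g := fun s => 2 * κ * √(1 - (κ * s) ^ 2)) (B := 2 * κ)
      hcont.continuousOn (by positivity) ?_ (Or.inr ?_)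
    · have b3 := b1.add (b2.const_mul (-1)) (by fun_prop) (by fun_prop)
      have hsub := intervalIntegral.integral_deriv_smul_comp
        (a := 0) (b := bandEdge κ) (f := fun θ => sin (θ / 2))
        (f' := fun θ => cos (θ / 2) / 2)
        (g := fun s => Complex.exp (jumpPhase c κ t j k s * Complex.I) *
            ((2 * κ ^ 2 * √(1 - s ^ 2) : ℝ) : ℂ) +
          -1 * (Complex.exp (jumpPhase c κ t j k s * Complex.I) *
            ((2 * κ * √(1 - (κ * s) ^ 2) : ℝ) : ℂ)))
        (fun v _ => hasDerivAt_sin_half v) (by fun_prop) (by fun_prop)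
      simp only [zero_div, sin_zero, sin_bandEdge_half hκ] at hsub
      rw [intervalIntegral.integral_congr (fun θ hθ => bandIntegrand_eq_of_le hκ j k
        (Set.uIcc_of_le hm.1 ▸ hθ).1 (Set.uIcc_of_le hm.1 ▸ hθ).2)]
      refine le_of_eq_of_le (congrArg _ hsub) ?_
      refine (b3 0 (1 / κ) le_rfl (by positivity) le_rfl).trans (le_of_eq ?_)
      rw [norm_neg, norm_one]
      ring
    · intro s hs
      have : √(1 - (κ * s) ^ 2) ≤ 1 := sqrt_le_iff.2 ⟨zero_le_one, by nlinarith [sq_nonneg (κ * s)]⟩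
      exact ⟨by positivity, by nlinarith⟩
    · intro u hu v hv huv
      dsimp only
      have := hu.1
      gcongr
  · intro s hs
    have : √(1 - s ^ 2) ≤ 1 := sqrt_le_iff.2 ⟨zero_le_one, by nlinarith [sq_nonneg s]⟩
    exact ⟨by positivity, by nlinarith [sq_nonneg κ]⟩
  · intro u hu v hv huv
    dsimp only
    have := hu.1
    gcongr

-- Only the free phase oscillates, and every other factor is monotone with a bound independent of
-- `j` and `k`; in particular the `2k`-th power stays antitone in `[0, 1]`.
open Real in
theorem exists_norm_integral_bandIntegrand_outer_le {c κ : ℝ} (hc : 0 < c) (hκ : 1 < κ) :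
    ∃ C : ℝ, 0 < C ∧ ∀ (t : ℝ) (j k : ℕ), 1 ≤ |t| →
      ‖∫ θ in (bandEdge κ)..π, bandIntegrand c κ t j k θ‖ ≤ C * |t| ^ (-(1 / 3 : ℝ)) := by
  have hc2 : 0 < 2 * c := by linarith
  obtain ⟨C, hC, hb⟩ := exists_subintervalBound_cos hc2
  refine ⟨κ * (κ * C) + κ * (κ * C), by positivity, fun t j k ht => ?_⟩
  have hm := bandEdge_mem hκ
  have hκ0 : 0 < κ := by linarith
  have hpi := pi_pos
  have h : SubintervalBound (fun θ => Complex.exp ((2 * c * t * cos θ + j * θ + -(2 * c * t) : ℝ) *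
      Complex.I)) (bandEdge κ) π (C * |t| ^ (-(1 / 3 : ℝ))) :=
    fun x y hx => hb t j (-(2 * c * t)) ht x y (hm.1.trans hx)
  have hx1 : ∀ θ ∈ Set.Icc (bandEdge κ) π, 1 ≤ κ * sin (θ / 2) :=
    fun θ hθ => one_le_mul_sin_half hκ hθ.1 hθ.2
  have hcosmem : ∀ θ ∈ Set.Icc (bandEdge κ) π, κ * cos (θ / 2) ∈ Set.Icc 0 κ := by
    intro θ hθ
    have := hm.1.trans hθ.1
    have : 0 ≤ cos (θ / 2) := cos_nonneg_of_mem_Icc ⟨by linarith, by linarith [hθ.2]⟩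
    exact ⟨by positivity, mul_le_of_le_one_right hκ0.le (cos_le_one _)⟩
  have hcosanti : AntitoneOn (fun θ => κ * cos (θ / 2)) (Set.Icc (bandEdge κ) π) := by
    intro u hu v hv huv
    exact mul_le_mul_of_nonneg_left (cos_half_anti (hm.1.trans hu.1) huv hv.2) hκ0.le
  have b1 := h.mul_monotoneOn
    (g := fun θ => (κ * sin (θ / 2) - √((κ * sin (θ / 2)) ^ 2 - 1)) ^ (2 * k)) (B := 1)
    (by fun_prop) one_pos ?_ (Or.inr ?_)
  · have b2 := b1.mul_monotoneOn (g := fun θ => κ * cos (θ / 2)) (B := κ)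
      (by fun_prop) hκ0 hcosmem (Or.inr hcosanti)
    have b3 := (b2.mul_monotoneOn (g := fun θ => κ * cos (θ / 2)) (B := κ)
      (by fun_prop) hκ0 hcosmem (Or.inr hcosanti)).const_mul ((-1) ^ k)
    have b4 := (b2.mul_monotoneOn (g := fun θ => √((κ * sin (θ / 2)) ^ 2 - 1)) (B := κ)
      (by fun_prop) hκ0 ?_ (Or.inl ?_)).const_mul ((-1) ^ k * Complex.I)
    · have b5 := (b3.add b4 (by fun_prop) (by fun_prop)).congr
        (g := bandIntegrand c κ t j k)
        (fun θ hθ => (bandIntegrand_eq_of_ge hκ j k hθ.1 hθ.2).symm)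
      refine (b5 _ _ le_rfl hm.2 le_rfl).trans (le_of_eq ?_)
      simp only [norm_pow, norm_neg, norm_one, norm_mul, Complex.norm_I, one_pow]
      ring
    · intro θ hθ
      refine ⟨sqrt_nonneg _, sqrt_le_iff.2 ⟨hκ0.le, ?_⟩⟩
      rw [mul_pow]
      nlinarith [sin_sq_le_one (θ / 2), mul_le_mul_of_nonneg_left (sin_sq_le_one (θ / 2))
        (sq_nonneg κ)]
    · intro u hu v hv huv
      have h1 := hx1 u hu
      have h2 := sin_half_mono (hm.1.trans hu.1) huv hv.2
      dsimp only
      have : κ * sin (u / 2) ≤ κ * sin (v / 2) := by gcongr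
      gcongr
  · intro θ hθ
    have := sub_sqrt_sq_sub_one_mem (hx1 θ hθ)
    exact ⟨pow_nonneg this.1 _, pow_le_one₀ this.1 this.2⟩
  · intro u hu v hv huv
    refine pow_le_pow_left₀ (sub_sqrt_sq_sub_one_mem (hx1 v hv)).1 ?_ _
    refine antitoneOn_sub_sqrt_sq_sub_one (hx1 u hu) (hx1 v hv) ?_
    have h2 := sin_half_mono (hm.1.trans hu.1) huv hv.2
    gcongr

open Real in
/-- Uniform decay of the transmitted wave integrals over the upper half circle. -/
theorem exists_norm_integral_bandIntegrand_le {c κ : ℝ} (hc : 0 < c) (hκ : 1 < κ) :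
    ∃ C : ℝ, 0 < C ∧ ∀ (t : ℝ) (j k : ℕ), 1 ≤ |t| →
      ‖∫ θ in 0..π, bandIntegrand c κ t j k θ‖ ≤ C * |t| ^ (-(1 / 3 : ℝ)) := by
  obtain ⟨C₁, h₁, b₁⟩ := exists_norm_integral_bandIntegrand_inner_le hc hκ
  obtain ⟨C₂, h₂, b₂⟩ := exists_norm_integral_bandIntegrand_outer_le hc hκ
  refine ⟨C₁ + C₂, by positivity, fun t j k ht => ?_⟩
  have hcont := continuous_bandIntegrand c κ t j k
  rw [← intervalIntegral.integral_add_adjacent_intervals (b := bandEdge κ)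
    (hcont.intervalIntegrable _ _) (hcont.intervalIntegrable _ _), add_mul]
  exact (norm_add_le _ _).trans (add_le_add (b₁ t j k ht) (b₂ t j k ht))

/-! ### The difference operator and uniqueness of bounded solutions -/

theorem stepCoeff_nonneg (b₁ b₂ x : ℝ) : 0 ≤ stepCoeff b₁ b₂ x := by
  unfold stepCoeff; split_ifs <;> positivity

theorem norm_stepCoeff_le (b₁ b₂ x : ℝ) :
    ‖(stepCoeff b₁ b₂ x : ℂ)‖ ≤ (b₁ ^ 2)⁻¹ + (b₂ ^ 2)⁻¹ := by
  rw [Complex.norm_real, Real.norm_eq_abs, abs_of_nonneg (stepCoeff_nonneg b₁ b₂ x)]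
  have h1 : 0 ≤ (b₁ ^ 2)⁻¹ := by positivity
  have h2 : 0 ≤ (b₂ ^ 2)⁻¹ := by positivity
  unfold stepCoeff; split_ifs <;> linarith

theorem norm_jumpLaplacian_le {b₁ b₂ : ℝ} {u : ℤ → ℂ} {B : ℝ} (h : ∀ j, ‖u j‖ ≤ B) (j : ℤ) :
    ‖jumpLaplacian b₁ b₂ u j‖ ≤ 4 * ((b₁ ^ 2)⁻¹ + (b₂ ^ 2)⁻¹) * B := by
  set M := (b₁ ^ 2)⁻¹ + (b₂ ^ 2)⁻¹ with hM
  have hM0 : 0 ≤ M := by positivity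
  have h1 := norm_stepCoeff_le b₁ b₂ ((j : ℝ) + 1 / 2)
  have h2 := norm_stepCoeff_le b₁ b₂ ((j : ℝ) - 1 / 2)
  unfold jumpLaplacian
  refine (norm_add_le _ _).trans ((add_le_add_left (norm_sub_le _ _) _).trans ?_)
  rw [norm_mul, norm_mul, norm_mul]
  have e1 := mul_le_mul h1 (h (j + 1)) (norm_nonneg _) hM0
  have e2 := mul_le_mul ((norm_add_le _ _).trans (add_le_add h1 h2)) (h j) (norm_nonneg _)
    (add_nonneg hM0 hM0)
  have e3 := mul_le_mul h2 (h (j - 1)) (norm_nonneg _) hM0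
  linarith

theorem jumpLaplacian_sub (b₁ b₂ : ℝ) (u v : ℤ → ℂ) (j : ℤ) :
    jumpLaplacian b₁ b₂ (u - v) j = jumpLaplacian b₁ b₂ u j - jumpLaplacian b₁ b₂ v j := by
  simp only [jumpLaplacian, Pi.sub_apply]; ring

theorem jumpLaplacian_add (b₁ b₂ : ℝ) (u v : ℤ → ℂ) (j : ℤ) :
    jumpLaplacian b₁ b₂ (u + v) j = jumpLaplacian b₁ b₂ u j + jumpLaplacian b₁ b₂ v j := by
  simp only [jumpLaplacian, Pi.add_apply]; ring

theorem jumpLaplacian_smul (b₁ b₂ : ℝ) (z : ℂ) (u : ℤ → ℂ) (j : ℤ) :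
    jumpLaplacian b₁ b₂ (z • u) j = z * jumpLaplacian b₁ b₂ u j := by
  simp only [jumpLaplacian, Pi.smul_apply, smul_eq_mul]; ring

/-- Reflecting the lattice exchanges the two coefficients. -/
theorem jumpLaplacian_reflect (b₁ b₂ : ℝ) (u : ℤ → ℂ) (j : ℤ) :
    jumpLaplacian b₂ b₁ (fun n => u (-n)) j = jumpLaplacian b₁ b₂ u (-j) := by
  have h : ∀ x : ℝ, x ≠ 0 → stepCoeff b₂ b₁ x = stepCoeff b₁ b₂ (-x) := by
    intro x hx
    unfold stepCoeff
    rcases lt_or_gt_of_ne hx with h | h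
    · rw [if_pos h, if_neg (by linarith)]
    · rw [if_neg (by linarith), if_pos (by linarith)]
  -- The coefficient is evaluated only at half-integers, so the asymmetric convention at `x = 0`
  -- does not spoil the reflection.
  have h1 : ((j : ℝ) + 1 / 2) ≠ 0 := by
    intro h
    have : 2 * j + 1 = 0 := by
      have : (2 * j + 1 : ℝ) = 0 := by linarith
      exact_mod_cast this
    omega
  have h2 : ((j : ℝ) - 1 / 2) ≠ 0 := by
    intro h
    have : 2 * j - 1 = 0 := by
      have : (2 * j - 1 : ℝ) = 0 := by linarith
      exact_mod_cast this
    omega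
  simp only [jumpLaplacian, h _ h1, h _ h2]
  have e1 : -((j : ℝ) + 1 / 2) = ((-j : ℤ) : ℝ) - 1 / 2 := by push_cast; ring
  have e2 : -((j : ℝ) - 1 / 2) = ((-j : ℤ) : ℝ) + 1 / 2 := by push_cast; ring
  have e3 : -(j + 1) = -j - 1 := by ring
  have e4 : -(j - 1) = -j + 1 := by ring
  rw [e1, e2, e3, e4]
  ring

/-- A lattice function that vanishes initially, is locally bounded in time, and whose time
derivative is controlled by its supremum, vanishes identically. -/
theorem eq_zero_of_norm_deriv_le {d d' : ℝ → ℤ → ℂ} {A : ℝ}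
    (hd : ∀ t j, HasDerivAt (fun s => d s j) (d' t j) t)
    (hb : ∀ R, ∃ B, ∀ t, |t| ≤ R → ∀ j, ‖d t j‖ ≤ B)
    (hdd : ∀ t B, (∀ j, ‖d t j‖ ≤ B) → ∀ j, ‖d' t j‖ ≤ A * B)
    (h0 : ∀ j, d 0 j = 0) (t : ℝ) (j : ℤ) : d t j = 0 := by
  have main : ∀ {d d' : ℝ → ℤ → ℂ}, (∀ t j, HasDerivAt (fun s => d s j) (d' t j) t) →
      (∀ R, ∃ B, ∀ t, |t| ≤ R → ∀ j, ‖d t j‖ ≤ B) →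
      (∀ t B, (∀ j, ‖d t j‖ ≤ B) → ∀ j, ‖d' t j‖ ≤ A * B) →
      (∀ j, d 0 j = 0) → ∀ t, 0 ≤ t → ∀ j, d t j = 0 := by
    intro d d' hd hb hdd h0 T hT j
    obtain ⟨B, hB⟩ := hb T
    -- Picard iteration of the derivative bound. It runs coordinate by coordinate with a bound
    -- uniform in `j`, so the sup norm is never differentiated in time.
    have key : ∀ k : ℕ, ∀ t ∈ Set.Icc 0 T, ∀ j, ‖d t j‖ ≤ B * (A * t) ^ k / k.factorial := by
      intro k
      induction k with
      | zero =>
        intro t ht j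
        simpa using hB t (by rw [abs_of_nonneg ht.1]; exact ht.2) j
      | succ k ih =>
        intro t ht j
        have hder : ∀ x : ℝ, HasDerivAt (fun x => B * (A * x) ^ (k + 1) / (k + 1).factorial)
            (A * (B * (A * x) ^ k / k.factorial)) x := by
          intro x
          refine (((((hasDerivAt_id x).const_mul A).pow (k + 1)).const_mul B).div_const
            _).congr_deriv ?_
          rw [Nat.factorial_succ]
          have : (k.factorial : ℝ) ≠ 0 := by exact_mod_cast k.factorial_ne_zero
          have : (k + 1 : ℝ) ≠ 0 := by positivity
          push_cast
          simp only [id]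
          field_simp
        refine image_norm_le_of_norm_deriv_right_le_deriv_boundary' (a := 0) (b := T)
          (f := fun s => d s j) (f' := fun s => d' s j)
          (B := fun x => B * (A * x) ^ (k + 1) / (k + 1).factorial)
          (B' := fun x => A * (B * (A * x) ^ k / k.factorial))
          (fun x _ => (hd x j).continuousAt.continuousWithinAt)
          (fun x _ => (hd x j).hasDerivWithinAt) ?_
          (fun x _ => (hder x).continuousAt.continuousWithinAt)
          (fun x _ => (hder x).hasDerivWithinAt) ?_ ht
        · simp [h0]
        · intro x hx
          exact hdd x _ (ih x ⟨hx.1, hx.2.le⟩) j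
    have hlim : Filter.Tendsto (fun k : ℕ => B * ((A * T) ^ k / k.factorial)) Filter.atTop
        (nhds (B * 0)) := (FloorSemiring.tendsto_pow_div_factorial_atTop (A * T)).const_mul B
    rw [mul_zero] at hlim
    have : ‖d T j‖ ≤ 0 := by
      refine ge_of_tendsto' hlim fun k => ?_
      have := key k T ⟨hT, le_rfl⟩ j
      rwa [mul_div_assoc] at this
    exact norm_le_zero_iff.1 this
  rcases le_total 0 t with ht | ht
  · exact main hd hb hdd h0 t ht j
  · have := main (d := fun s j => d (-s) j) (d' := fun s j => -d' (-s) j) ?_ ?_ ?_ ?_ (-t)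
      (by linarith) j
    · simpa using this
    · intro s j
      simpa [Function.comp_def] using (hd (-s) j).scomp s (hasDerivAt_neg s)
    · intro R
      obtain ⟨B, hB⟩ := hb R
      exact ⟨B, fun s hs j => hB (-s) (by rwa [abs_neg]) j⟩
    · intro s B hs j
      rw [norm_neg]
      exact hdd (-s) B hs j
    · simpa using h0

/-- A coordinatewise solution of the Schrödinger equation that is bounded on the lattice, locally
uniformly in time. -/
structure IsBoundedJumpSolution (b₁ b₂ : ℝ) (φ : ℤ → ℂ) (w : ℝ → ℤ → ℂ) : Prop where
  hasDerivAt : ∀ t j, HasDerivAt (fun s => w s j) (Complex.I * jumpLaplacian b₁ b₂ (w t) j) t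
  bounded : ∀ R, ∃ B, ∀ t, |t| ≤ R → ∀ j, ‖w t j‖ ≤ B
  initial : ∀ j, w 0 j = φ j

theorem IsBoundedJumpSolution.eq {b₁ b₂ : ℝ} {φ : ℤ → ℂ} {v w : ℝ → ℤ → ℂ}
    (hv : IsBoundedJumpSolution b₁ b₂ φ v) (hw : IsBoundedJumpSolution b₁ b₂ φ w) (t : ℝ) (j : ℤ) :
    v t j = w t j := by
  rw [← sub_eq_zero]
  refine eq_zero_of_norm_deriv_le (d := fun t => v t - w t)
    (d' := fun t j => Complex.I * jumpLaplacian b₁ b₂ (v t - w t) j)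
    (A := 4 * ((b₁ ^ 2)⁻¹ + (b₂ ^ 2)⁻¹)) ?_ ?_ ?_ ?_ t j
  · intro t j
    refine ((hv.hasDerivAt t j).sub (hw.hasDerivAt t j)).congr_deriv ?_
    rw [jumpLaplacian_sub, mul_sub]
  · intro R
    obtain ⟨B, hB⟩ := hv.bounded R
    obtain ⟨B', hB'⟩ := hw.bounded R
    exact ⟨B + B', fun t ht j => (norm_sub_le _ _).trans (add_le_add (hB t ht j) (hB' t ht j))⟩
  · intro t B hB j
    rw [norm_mul, Complex.norm_I, one_mul]
    exact norm_jumpLaplacian_le hB j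
  · intro j
    simp [hv.initial, hw.initial]

/-- Two bounded solutions with the same value at the origin at all times coincide, the equation
being needed only away from the origin. -/
theorem IsBoundedJumpSolution.eq_of_eq_zero {b₁ b₂ : ℝ} {φ : ℤ → ℂ} {v w : ℝ → ℤ → ℂ}
    (hv : IsBoundedJumpSolution b₁ b₂ φ v) (hv0 : ∀ t, v t 0 = w t 0)
    (hw : ∀ t j, j ≠ 0 →
      HasDerivAt (fun s => w s j) (Complex.I * jumpLaplacian b₁ b₂ (w t) j) t)
    (hwb : ∀ R, ∃ B, ∀ t, |t| ≤ R → ∀ j, ‖w t j‖ ≤ B)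
    (hwi : ∀ j, w 0 j = φ j) (t : ℝ) (j : ℤ) :
    v t j = w t j := by
  rw [← sub_eq_zero]
  refine eq_zero_of_norm_deriv_le (d := fun t => v t - w t)
    -- The difference vanishes at the origin at all times, so its derivative there is zero and no
    -- equation is required at that site.
    (d' := fun t j => if j = 0 then 0 else Complex.I * jumpLaplacian b₁ b₂ (v t - w t) j)
    (A := 4 * ((b₁ ^ 2)⁻¹ + (b₂ ^ 2)⁻¹)) ?_ ?_ ?_ ?_ t j
  · intro t j
    split_ifs with h
    · subst h
      simp only [Pi.sub_apply, hv0, sub_self]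
      exact hasDerivAt_const t 0
    · refine ((hv.hasDerivAt t j).sub (hw t j h)).congr_deriv ?_
      rw [jumpLaplacian_sub, mul_sub]
  · intro R
    obtain ⟨B, hB⟩ := hv.bounded R
    obtain ⟨B', hB'⟩ := hwb R
    exact ⟨B + B', fun t ht j => (norm_sub_le _ _).trans (add_le_add (hB t ht j) (hB' t ht j))⟩
  · intro t B hB j
    have hB0 : 0 ≤ B := (norm_nonneg _).trans (hB 0)
    split_ifs with h
    · rw [norm_zero]; positivity
    · rw [norm_mul, Complex.norm_I, one_mul]
      exact norm_jumpLaplacian_le hB j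
  · intro j
    simp [hv.initial, hwi]

theorem IsBoundedJumpSolution.reflect {b₁ b₂ : ℝ} {φ : ℤ → ℂ} {w : ℝ → ℤ → ℂ}
    (hw : IsBoundedJumpSolution b₁ b₂ φ w) :
    IsBoundedJumpSolution b₂ b₁ (fun j => φ (-j)) (fun t j => w t (-j)) where
  hasDerivAt t j := by
    rw [jumpLaplacian_reflect]
    exact hw.hasDerivAt t (-j)
  bounded R := (hw.bounded R).imp fun _ hB t ht j => hB t ht (-j)
  initial j := hw.initial (-j)

/-! ### The group on `ℓ²` and well-posedness -/

/-- Coordinatewise domination preserves square summability. -/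
theorem memℓp_stepCoeff_mul (b₁ b₂ : ℝ) (e : ℤ → ℝ) (τ : ℤ ≃ ℤ) {u : ℤ → ℂ} (hu : Memℓp u 2) :
    Memℓp (fun j => (stepCoeff b₁ b₂ (e j) : ℂ) * u (τ j)) 2 := by
  have hp : (0 : ℝ) < (2 : ℝ≥0∞).toReal := by norm_num
  have hs := (memℓp_gen_iff hp).1 hu
  have hs' := ((Equiv.summable_iff τ).2 hs).mul_left
    (((b₁ ^ 2)⁻¹ + (b₂ ^ 2)⁻¹) ^ (2 : ℝ≥0∞).toReal)
  refine memℓp_gen (Summable.of_nonneg_of_le (fun j => by positivity) (fun j => ?_) hs')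
  rw [norm_mul, Real.mul_rpow (norm_nonneg _) (norm_nonneg _)]
  have := norm_stepCoeff_le b₁ b₂ (e j)
  simp only [Function.comp]
  gcongr

theorem memℓp_jumpLaplacian (b₁ b₂ : ℝ) {u : ℤ → ℂ} (hu : Memℓp u 2) :
    Memℓp (jumpLaplacian b₁ b₂ u) 2 := by
  have h1 := memℓp_stepCoeff_mul b₁ b₂ (fun j => (j : ℝ) + 1 / 2) (Equiv.addRight 1) hu
  have h2 := memℓp_stepCoeff_mul b₁ b₂ (fun j => (j : ℝ) + 1 / 2) (Equiv.refl ℤ) hu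
  have h3 := memℓp_stepCoeff_mul b₁ b₂ (fun j => (j : ℝ) - 1 / 2) (Equiv.refl ℤ) hu
  have h4 := memℓp_stepCoeff_mul b₁ b₂ (fun j => (j : ℝ) - 1 / 2) (Equiv.subRight 1) hu
  convert (h1.sub (h2.add h3)).add h4 using 1
  ext j
  simp [jumpLaplacian, add_mul]

/-- The operator `u ↦ ∂(a∂u)` as a linear map of `ℓ²(ℤ)`. -/
noncomputable def jumpLinearMap (b₁ b₂ : ℝ) :
    lp (fun _ : ℤ => ℂ) 2 →ₗ[ℂ] lp (fun _ : ℤ => ℂ) 2 where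
  toFun u := ⟨jumpLaplacian b₁ b₂ u, memℓp_jumpLaplacian b₁ b₂ (lp.memℓp u)⟩
  map_add' u v := by
    ext j
    exact jumpLaplacian_add b₁ b₂ u v j
  map_smul' z u := by
    ext j
    exact jumpLaplacian_smul b₁ b₂ z u j

theorem lp.continuous_apply (j : ℤ) : Continuous fun u : lp (fun _ : ℤ => ℂ) 2 => u j :=
  (lp.evalCLM ℂ (fun _ : ℤ => ℂ) 2 j).continuous

theorem continuous_jumpLaplacian_apply (b₁ b₂ : ℝ) (j : ℤ) :
    Continuous fun u : lp (fun _ : ℤ => ℂ) 2 => jumpLaplacian b₁ b₂ u j := by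
  have h1 := lp.continuous_apply (j + 1)
  have h2 := lp.continuous_apply j
  have h3 := lp.continuous_apply (j - 1)
  exact ((continuous_const.mul h1).sub (continuous_const.mul h2)).add (continuous_const.mul h3)

/-- Closed graph theorem: each coordinate of the image depends continuously on `u`, so limits can be
compared coordinatewise. -/
theorem continuous_jumpLinearMap (b₁ b₂ : ℝ) : Continuous (jumpLinearMap b₁ b₂) := by
  refine LinearMap.continuous_of_seq_closed_graph _ fun u x y hu hy => ?_
  ext j
  have h1 := ((lp.continuous_apply j).tendsto y).comp hy
  have h2 := ((continuous_jumpLaplacian_apply b₁ b₂ j).tendsto x).comp hu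
  exact tendsto_nhds_unique h1 h2

/-- The operator `u ↦ i ∂(a∂u)` as a bounded operator of `ℓ²(ℤ)`. -/
noncomputable def jumpGenerator (b₁ b₂ : ℝ) :
    lp (fun _ : ℤ => ℂ) 2 →L[ℂ] lp (fun _ : ℤ => ℂ) 2 :=
  Complex.I • ⟨jumpLinearMap b₁ b₂, continuous_jumpLinearMap b₁ b₂⟩

theorem jumpGenerator_apply (b₁ b₂ : ℝ) (u : lp (fun _ : ℤ => ℂ) 2) (j : ℤ) :
    jumpGenerator b₁ b₂ u j = Complex.I * jumpLaplacian b₁ b₂ u j := rfl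

/-- The Schrödinger group on `ℓ²(ℤ)`. -/
noncomputable def jumpGroup (b₁ b₂ t : ℝ) : lp (fun _ : ℤ => ℂ) 2 →L[ℂ] lp (fun _ : ℤ => ℂ) 2 :=
  NormedSpace.exp (t • jumpGenerator b₁ b₂)

theorem jumpGroup_zero (b₁ b₂ : ℝ) : jumpGroup b₁ b₂ 0 = 1 := by
  simp [jumpGroup]

/-- Both orders of the product matter: generator on the left gives the equation in the first index
of the kernel, generator on the right the equation in the second. -/
theorem hasDerivAt_jumpGroup_left (b₁ b₂ t : ℝ) :
    HasDerivAt (jumpGroup b₁ b₂) (jumpGroup b₁ b₂ t * jumpGenerator b₁ b₂) t :=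
  hasDerivAt_exp_smul_const (jumpGenerator b₁ b₂) t

theorem hasDerivAt_jumpGroup_right (b₁ b₂ t : ℝ) :
    HasDerivAt (jumpGroup b₁ b₂) (jumpGenerator b₁ b₂ * jumpGroup b₁ b₂ t) t :=
  hasDerivAt_exp_smul_const' (jumpGenerator b₁ b₂) t

/-- Evaluation of an operator at a vector and a coordinate. -/
noncomputable def lp.evalOp (u : lp (fun _ : ℤ => ℂ) 2) (j : ℤ) :
    (lp (fun _ : ℤ => ℂ) 2 →L[ℂ] lp (fun _ : ℤ => ℂ) 2) →L[ℝ] ℂ :=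
  ((lp.evalCLM ℂ (fun _ : ℤ => ℂ) 2 j).comp
    (ContinuousLinearMap.apply ℂ (lp (fun _ : ℤ => ℂ) 2) u)).restrictScalars ℝ

theorem exists_norm_jumpGroup_le (b₁ b₂ R : ℝ) : ∃ B, ∀ t, |t| ≤ R → ‖jumpGroup b₁ b₂ t‖ ≤ B := by
  have hc : Continuous (jumpGroup b₁ b₂) :=
    continuous_iff_continuousAt.2 fun t => (hasDerivAt_jumpGroup_left b₁ b₂ t).continuousAt
  obtain ⟨B, hB⟩ := (isCompact_Icc (a := -R) (b := R)).exists_bound_of_continuousOn hc.continuousOn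
  exact ⟨B, fun t ht => hB t (abs_le.1 ht)⟩

theorem norm_jumpGroup_apply_apply_le (b₁ b₂ t : ℝ) (u : lp (fun _ : ℤ => ℂ) 2) (j : ℤ) :
    ‖jumpGroup b₁ b₂ t u j‖ ≤ ‖jumpGroup b₁ b₂ t‖ * ‖u‖ :=
  (lp.norm_apply_le_norm two_ne_zero _ j).trans ((jumpGroup b₁ b₂ t).le_opNorm u)

theorem isBoundedJumpSolution_jumpGroup (b₁ b₂ : ℝ) (u : lp (fun _ : ℤ => ℂ) 2) :
    IsBoundedJumpSolution b₁ b₂ u (fun t j => jumpGroup b₁ b₂ t u j) where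
  hasDerivAt t j :=
    (lp.evalOp u j).hasFDerivAt.comp_hasDerivAt t (hasDerivAt_jumpGroup_right b₁ b₂ t)
  bounded R := by
    obtain ⟨B, hB⟩ := exists_norm_jumpGroup_le b₁ b₂ R
    refine ⟨B * ‖u‖, fun t ht j => (norm_jumpGroup_apply_apply_le b₁ b₂ t u j).trans ?_⟩
    have := hB t ht
    gcongr
  initial j := by rw [jumpGroup_zero]; rfl

theorem isJumpSolution_jumpGroup (b₁ b₂ : ℝ) (u : lp (fun _ : ℤ => ℂ) 2) :
    IsJumpSolution b₁ b₂ u (fun t => jumpGroup b₁ b₂ t u) := by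
  have h := isBoundedJumpSolution_jumpGroup b₁ b₂ u
  refine ⟨?_, fun t _ j => (h.hasDerivAt t j).differentiableAt, fun t _ j => ?_, h.initial⟩
  · have hc : Continuous (jumpGroup b₁ b₂) :=
      continuous_iff_continuousAt.2 fun t => (hasDerivAt_jumpGroup_left b₁ b₂ t).continuousAt
    exact hc.clm_apply continuous_const
  · rw [(h.hasDerivAt t j).deriv, ← mul_assoc, Complex.I_mul_I]
    ring

/-- At `t = 0` the equation is not assumed. Away from `0` the derivative equals an expression
continuous in time, so the derivative extends to `0` with the same formula. -/
theorem IsJumpSolution.isBoundedJumpSolution {b₁ b₂ : ℝ} {φ : ℤ → ℂ}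
    {u : ℝ → lp (fun _ : ℤ => ℂ) 2} (hu : IsJumpSolution b₁ b₂ φ u) :
    IsBoundedJumpSolution b₁ b₂ φ (fun t j => u t j) where
  hasDerivAt := by
    have hne : ∀ t, t ≠ 0 → ∀ j, HasDerivAt (fun s => u s j)
        (Complex.I * jumpLaplacian b₁ b₂ (u t) j) t := by
      intro t ht j
      refine (hu.differentiableAt t ht j).hasDerivAt.congr_deriv ?_
      have h1 := congrArg (fun z => Complex.I * z) (hu.equation t ht j)
      simp only [mul_add, ← mul_assoc, Complex.I_mul_I, mul_zero] at h1
      linear_combination -h1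
    intro t j
    by_cases ht : t = 0
    · subst ht
      refine hasDerivAt_of_hasDerivAt_of_ne (f := fun s => u s j)
        (g := fun t => Complex.I * jumpLaplacian b₁ b₂ (u t) j) (fun y hy => hne y hy j) ?_ ?_
      · exact ((lp.continuous_apply j).comp hu.continuous).continuousAt
      · exact (continuous_const.mul
          ((continuous_jumpLaplacian_apply b₁ b₂ j).comp hu.continuous)).continuousAt
    · exact hne t ht j
  bounded R := by
    obtain ⟨B, hB⟩ := (isCompact_Icc (a := -R) (b := R)).exists_bound_of_continuousOn
      hu.continuous.continuousOn
    exact ⟨B, fun t ht j => (lp.norm_apply_le_norm two_ne_zero _ j).trans (hB t (abs_le.1 ht))⟩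
  initial := hu.initial

theorem existsUnique_isJumpSolution (b₁ b₂ : ℝ) (φ : lp (fun _ : ℤ => ℂ) 2) :
    ∃! u : ℝ → lp (fun _ : ℤ => ℂ) 2, IsJumpSolution b₁ b₂ φ u := by
  refine ⟨fun t => jumpGroup b₁ b₂ t φ, isJumpSolution_jumpGroup b₁ b₂ φ, fun u hu => ?_⟩
  ext t j
  exact hu.isBoundedJumpSolution.eq (isBoundedJumpSolution_jumpGroup b₁ b₂ φ) t j

/-! ### The kernel and the passage from `ℓ¹` to `ℓ^∞` -/

/-- The matrix entries of the Schrödinger group. -/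
noncomputable def jumpKernel (b₁ b₂ t : ℝ) (n m : ℤ) : ℂ :=
  jumpGroup b₁ b₂ t (lp.single 2 m (1 : ℂ)) n

theorem isBoundedJumpSolution_jumpKernel (b₁ b₂ : ℝ) (m : ℤ) :
    IsBoundedJumpSolution b₁ b₂ (Pi.single m 1) (fun t n => jumpKernel b₁ b₂ t n m) := by
  exact isBoundedJumpSolution_jumpGroup b₁ b₂ (lp.single 2 m (1 : ℂ))

/-- The columns of the generator carry the same coefficients `a(n ± 1/2)` as its rows. This is the
symmetry of the operator. -/
theorem jumpGenerator_single (b₁ b₂ : ℝ) (n : ℤ) :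
    jumpGenerator b₁ b₂ (lp.single 2 n (1 : ℂ)) =
      Complex.I • ((stepCoeff b₁ b₂ ((n : ℝ) + 1 / 2) : ℂ) • lp.single 2 (n + 1) (1 : ℂ) -
        ((stepCoeff b₁ b₂ ((n : ℝ) + 1 / 2) : ℂ) + (stepCoeff b₁ b₂ ((n : ℝ) - 1 / 2) : ℂ)) •
          lp.single 2 n (1 : ℂ) +
        (stepCoeff b₁ b₂ ((n : ℝ) - 1 / 2) : ℂ) • lp.single 2 (n - 1) (1 : ℂ)) := by
  ext j
  rw [jumpGenerator_apply]
  simp only [jumpLaplacian, lp.coeFn_smul, lp.coeFn_add, lp.coeFn_sub, Pi.smul_apply, Pi.add_apply,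
    Pi.sub_apply, smul_eq_mul, lp.single_apply, Pi.single_apply]
  congr 1
  rcases lt_trichotomy j n with h | rfl | h
  · by_cases h1 : j = n - 1
    · subst h1
      have : (((n - 1 : ℤ) : ℝ) + 1 / 2) = (n : ℝ) - 1 / 2 := by push_cast; ring
      have e1 : n - 1 ≠ n := by omega
      have e2 : n - 1 ≠ n + 1 := by omega
      have e3 : n - 1 - 1 ≠ n := by omega
      rw [this]
      simp [e1, e2, e3]
    · have e1 : j + 1 ≠ n := by omega
      have e2 : j ≠ n + 1 := by omega
      have e3 : j - 1 ≠ n := by omega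
      simp [h.ne, e1, e2, e3, h1]
  · have e1 : j + 1 ≠ j := by omega
    have e2 : j ≠ j + 1 := by omega
    have e3 : j - 1 ≠ j := by omega
    have e4 : j ≠ j - 1 := by omega
    simp [e1, e2, e3, e4]
  · by_cases h1 : j = n + 1
    · subst h1
      have : (((n + 1 : ℤ) : ℝ) - 1 / 2) = (n : ℝ) + 1 / 2 := by push_cast; ring
      have e1 : n + 1 ≠ n := by omega
      have e2 : n + 1 ≠ n - 1 := by omega
      have e3 : n + 1 + 1 ≠ n := by omega
      rw [this]
      simp [e1, e2, e3]
    · have e1 : j + 1 ≠ n := by omega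
      have e2 : j ≠ n - 1 := by omega
      have e3 : j - 1 ≠ n := by omega
      simp [h.ne', e1, e2, e3, h1]

/-- The Schrödinger kernel is symmetric. -/
theorem jumpKernel_symm (b₁ b₂ t : ℝ) (n m : ℤ) :
    jumpKernel b₁ b₂ t n m = jumpKernel b₁ b₂ t m n := by
  refine (isBoundedJumpSolution_jumpKernel b₁ b₂ m).eq (w := fun t n => jumpKernel b₁ b₂ t m n)
    ⟨fun t n => ?_, fun R => ?_, fun n => ?_⟩ t n
  -- As a function of the second index the kernel solves the same equation: the generator acts first
  -- on the basis vector at `n`, and its column there expands into the neighbours.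
  · refine ((lp.evalOp (lp.single 2 n (1 : ℂ)) m).hasFDerivAt.comp_hasDerivAt t
      (hasDerivAt_jumpGroup_left b₁ b₂ t)).congr_deriv ?_
    change jumpGroup b₁ b₂ t (jumpGenerator b₁ b₂ (lp.single 2 n (1 : ℂ))) m = _
    rw [jumpGenerator_single]
    simp only [map_smul, map_add, map_sub]
    rfl
  · obtain ⟨B, hB⟩ := exists_norm_jumpGroup_le b₁ b₂ R
    refine ⟨B, fun t ht n => (norm_jumpGroup_apply_apply_le b₁ b₂ t _ m).trans ?_⟩
    rw [lp.norm_single (by norm_num), norm_one, mul_one]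
    exact hB t ht
  · simp only [jumpKernel, jumpGroup_zero]
    change (lp.single 2 n (1 : ℂ) : ℤ → ℂ) m = _
    rw [lp.single_apply, Pi.single_apply, Pi.single_apply]
    simp only [eq_comm]

/-- A uniform bound of the kernel gives the `ℓ¹ → ℓ^∞` bound of the solutions. -/
theorem norm_solution_le_of_norm_jumpKernel_le {b₁ b₂ t M : ℝ}
    (hM : ∀ n m, ‖jumpKernel b₁ b₂ t n m‖ ≤ M) (φ : lp (fun _ : ℤ => ℂ) 1)
    {u : ℝ → lp (fun _ : ℤ => ℂ) 2} (hu : IsJumpSolution b₁ b₂ φ u) :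
    ‖lp.linearMapOfLE ℂ (fun _ : ℤ => ℂ) (le_top : (2 : ℝ≥0∞) ≤ ∞) (u t)‖ ≤ M * ‖φ‖ := by
  have hM0 : 0 ≤ M := (norm_nonneg _).trans (hM 0 0)
  refine lp.norm_le_of_forall_le (by positivity) fun n => ?_
  rw [lp.coe_linearMapOfLE_apply]
  have hu0 : ∀ j, u t j = jumpGroup b₁ b₂ t (u 0) j := by
    intro j
    have h := isBoundedJumpSolution_jumpGroup b₁ b₂ (u 0)
    exact hu.isBoundedJumpSolution.eq ⟨h.hasDerivAt, h.bounded,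
      fun j => (h.initial j).trans (hu.initial j)⟩ t j
  -- The basis expansion of `u 0` converges in `ℓ²`; a continuous functional is applied to it. The
  -- `ℓ¹` norm of `φ` enters only when the resulting series is bounded termwise.
  have hs : HasSum (fun m => φ m * jumpKernel b₁ b₂ t n m) (u t n) := by
    rw [hu0]
    have h1 := lp.hasSum_single (p := 2) (by norm_num) (u 0)
    have h2 := (((lp.evalCLM ℂ (fun _ : ℤ => ℂ) 2 n).comp (jumpGroup b₁ b₂ t)).hasSum h1)
    have e : ∀ m, ((lp.evalCLM ℂ (fun _ : ℤ => ℂ) 2 n).comp (jumpGroup b₁ b₂ t))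
        (lp.single 2 m (u 0 m)) = φ m * jumpKernel b₁ b₂ t n m := by
      intro m
      have e : (lp.single 2 m (u 0 m) : lp (fun _ : ℤ => ℂ) 2) =
          φ m • lp.single 2 m (1 : ℂ) := by
        rw [← lp.single_smul, smul_eq_mul, mul_one, hu.initial]
      rw [e, map_smul]
      rfl
    simp only [e] at h2
    exact h2
  have hn : HasSum (fun m => ‖φ m‖) ‖φ‖ := by
    simpa using lp.hasSum_norm (p := 1) (by norm_num) φ
  rw [← hs.tsum_eq]
  refine tsum_of_norm_bounded (hn.mul_left M) fun m => ?_
  rw [norm_mul, mul_comm]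
  exact mul_le_mul_of_nonneg_right (hM n m) (norm_nonneg _)

/-! ### A square root on the unit disc -/

open Complex in
theorem re_one_sub_mul_cexp_nonneg {z : ℂ} (hz : ‖z‖ ≤ 1) (β : ℝ) :
    0 ≤ (1 - z * exp (β * I)).re := by
  have h : (z * exp (β * I)).re ≤ 1 := by
    refine (re_le_norm _).trans ?_
    rwa [norm_mul, norm_exp_ofReal_mul_I, mul_one]
  rw [sub_re, one_re]
  linarith

open Complex in
theorem one_sub_mul_cexp_mem_slitPlane {z : ℂ} (hz : ‖z‖ < 1) (β : ℝ) :
    1 - z * exp (β * I) ∈ slitPlane := by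
  refine Or.inl ?_
  have h : (z * exp (β * I)).re < 1 := by
    refine (re_le_norm _).trans_lt ?_
    rwa [norm_mul, norm_exp_ofReal_mul_I, mul_one]
  rw [sub_re, one_re]
  linarith

open Complex in
/-- The principal square root of `1 - e^{iβ}`. -/
theorem cpow_one_sub_cexp {β : ℝ} (h0 : 0 ≤ β) (h1 : β ≤ 2 * Real.pi) :
    (1 - exp (β * I)) ^ (2⁻¹ : ℂ) =
      (√(2 * Real.sin (β / 2)) : ℝ) * exp ((((β - Real.pi) / 4 : ℝ) : ℂ) * I) := by
  set v : ℂ := (√(2 * Real.sin (β / 2)) : ℝ) * exp ((((β - Real.pi) / 4 : ℝ) : ℂ) * I) with hv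
  have hsin : 0 ≤ Real.sin (β / 2) :=
    Real.sin_nonneg_of_nonneg_of_le_pi (by linarith) (by linarith)
  have hsq : v ^ 2 = 1 - exp (β * I) := by
    have e1 : ((√(2 * Real.sin (β / 2)) : ℝ) : ℂ) ^ 2 = 2 * sin ((β : ℂ) / 2) := by
      rw [← ofReal_pow, Real.sq_sqrt (by positivity)]
      push_cast
      ring
    have e2 : exp ((((β - Real.pi) / 4 : ℝ) : ℂ) * I) ^ 2 = exp ((β : ℂ) / 2 * I) * -I := by
      have : exp (-(Real.pi / 2 * I)) = -I := by
        rw [exp_neg, exp_pi_div_two_mul_I, inv_I]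
      rw [← this, ← exp_add, ← exp_nat_mul]
      congr 1
      push_cast
      ring
    rw [hv, mul_pow, e1, e2, Complex.sin]
    have e3 : exp (β * I) = exp ((β : ℂ) / 2 * I) * exp ((β : ℂ) / 2 * I) := by
      rw [← exp_add]; ring_nf
    have e4 : exp (-((β : ℂ) / 2) * I) * exp ((β : ℂ) / 2 * I) = 1 := by
      rw [← exp_add]; simp
    rw [e3]
    linear_combination (-(exp (-((β : ℂ) / 2) * I) * exp ((β : ℂ) / 2 * I)) +
      exp ((β : ℂ) / 2 * I) * exp ((β : ℂ) / 2 * I)) * I_sq + e4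
  rw [← hsq]
  rcases (Real.sqrt_nonneg (2 * Real.sin (β / 2))).eq_or_lt with h | h
  · have : v = 0 := by rw [hv, ← h]; simp
    rw [this]
    norm_num
  -- The argument `(β - π)/4` of `v` lies in `[-π/4, π/4]`, so `v` has positive real part and is the
  -- principal root of its square.
  · refine sq_cpow_two_inv ?_
    rw [hv, re_ofReal_mul, exp_ofReal_mul_I_re]
    refine mul_pos h (Real.cos_pos_of_mem_Ioo ⟨?_, ?_⟩) <;> linarith [Real.pi_pos]

open Complex in
/-- The branch on the unit disc of the square root of `κ ^ 2 (1 - z) ^ 2 + 4 z`. -/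
noncomputable def discRoot (κ : ℝ) (z : ℂ) : ℂ :=
  κ * (1 - z * exp ((-bandEdge κ : ℝ) * I)) ^ (2⁻¹ : ℂ) *
    (1 - z * exp ((bandEdge κ : ℝ) * I)) ^ (2⁻¹ : ℂ)

theorem cos_bandEdge {κ : ℝ} (hκ : 1 < κ) : Real.cos (bandEdge κ) = 1 - 2 / κ ^ 2 := by
  have := Real.cos_two_mul (bandEdge κ / 2)
  rw [mul_div_cancel₀ _ two_ne_zero, Real.cos_sq', sin_bandEdge_half hκ] at this
  rw [this]
  field_simp
  ring

-- The points `e^{± i bandEdge κ}` are the zeros of the right-hand side: their product is `1` and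
-- their sum is `2 (1 - 2/κ²)`. Taking the root of each linear factor separately keeps the bases in
-- the closed right half plane.
open Complex in
theorem discRoot_sq {κ : ℝ} (hκ : 1 < κ) (z : ℂ) :
    discRoot κ z ^ 2 = κ ^ 2 * (1 - z) ^ 2 + 4 * z := by
  have hκ0 : (κ : ℂ) ≠ 0 := by
    have : κ ≠ 0 := by linarith
    exact_mod_cast this
  have h1 : exp ((-bandEdge κ : ℝ) * I) * exp ((bandEdge κ : ℝ) * I) = 1 := by
    rw [← exp_add]; simp
  have h2 : exp ((-bandEdge κ : ℝ) * I) + exp ((bandEdge κ : ℝ) * I) = 2 * (1 - 2 / κ ^ 2) := by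
    have : ((Real.cos (bandEdge κ) : ℝ) : ℂ) = 1 - 2 / κ ^ 2 := by
      rw [cos_bandEdge hκ]; push_cast; rfl
    rw [← this, ofReal_cos, Complex.cos]
    push_cast
    ring
  rw [discRoot, mul_pow, mul_pow, cpow_ofNat_inv_pow, cpow_ofNat_inv_pow]
  have h3 : κ ^ 2 * (2 / (κ : ℂ) ^ 2) = 2 := by field_simp
  linear_combination κ ^ 2 * z ^ 2 * h1 - κ ^ 2 * z * h2 + 2 * z * h3

-- On the boundary a base may reach the imaginary axis or vanish, but it keeps nonnegative real
-- part, and the principal square root is continuous there, including at `0`.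
open Complex in
theorem continuousOn_discRoot (κ : ℝ) : ContinuousOn (discRoot κ) (Metric.closedBall 0 1) := by
  have h : ∀ β : ℝ, ContinuousOn (fun z : ℂ => (1 - z * exp (β * I)) ^ (2⁻¹ : ℂ))
      (Metric.closedBall 0 1) := by
    intro β z hz
    rw [mem_closedBall_zero_iff] at hz
    refine ContinuousAt.continuousWithinAt ?_
    refine ContinuousAt.comp (g := fun w : ℂ => w ^ (2⁻¹ : ℂ))
      (f := fun z : ℂ => 1 - z * exp (β * I))
      (continuousAt_cpow_const_of_re_pos (Or.inl (re_one_sub_mul_cexp_nonneg hz β)) ?_) ?_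
    · norm_num
    · fun_prop
  exact (continuousOn_const.mul (h _)).mul (h _)

open Complex in
theorem differentiableOn_discRoot (κ : ℝ) : DifferentiableOn ℂ (discRoot κ) (Metric.ball 0 1) := by
  have h : ∀ β : ℝ, DifferentiableOn ℂ (fun z : ℂ => (1 - z * exp (β * I)) ^ (2⁻¹ : ℂ))
      (Metric.ball 0 1) := by
    intro β z hz
    rw [mem_ball_zero_iff] at hz
    refine DifferentiableAt.differentiableWithinAt ?_
    exact DifferentiableAt.cpow_const (by fun_prop) (one_sub_mul_cexp_mem_slitPlane hz β)
  exact ((differentiableOn_const _).mul (h _)).mul (h _)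

theorem discRoot_zero (κ : ℝ) : discRoot κ 0 = κ := by
  simp [discRoot]

-- Conjugation exchanges the two branch points, and principal powers commute with it because the
-- bases never have argument `π`.
open Complex ComplexConjugate in
theorem discRoot_conj (κ : ℝ) {z : ℂ} (hz : ‖z‖ ≤ 1) :
    discRoot κ (conj z) = conj (discRoot κ z) := by
  have h : ∀ β : ℝ, (1 - conj z * exp ((-β : ℝ) * I)) ^ (2⁻¹ : ℂ) =
      conj ((1 - z * exp (β * I)) ^ (2⁻¹ : ℂ)) := by
    intro β
    have harg : (1 - z * exp (β * I)).arg ≠ Real.pi := by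
      intro h
      have h1 := abs_arg_le_pi_div_two_iff.2 (re_one_sub_mul_cexp_nonneg hz β)
      rw [h, abs_of_pos Real.pi_pos] at h1
      linarith [Real.pi_pos]
    have := conj_cpow _ (2⁻¹ : ℂ) harg
    rw [map_inv₀, map_ofNat] at this
    rw [← this]
    congr 1
    rw [map_sub, map_mul, map_one, ← exp_conj]
    simp
  have h1 := h (bandEdge κ)
  have h2 := h (-bandEdge κ)
  rw [neg_neg] at h2
  simp only [discRoot, map_mul, conj_ofReal]
  rw [h1, h2]
  ring

-- This fixes the sign of the boundary values: a nonnegative root inside the common band and `-i`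
-- times a nonnegative root beyond it. That sign makes the right root have modulus at most `1`.
open Complex in
theorem discRoot_cexp {κ θ : ℝ} (hκ : 1 < κ) (h0 : 0 ≤ θ) (h1 : θ ≤ Real.pi) :
    discRoot κ (exp (θ * I)) = 2 * exp ((θ : ℂ) / 2 * I) * bandRoot κ θ := by
  have hκ0 : 0 < κ := by linarith
  obtain ⟨hα0, hα1⟩ := bandEdge_mem hκ
  have hmul : ∀ β : ℝ, exp (θ * I) * exp (β * I) = exp ((θ + β : ℝ) * I) := by
    intro β; rw [← exp_add]; push_cast; ring_nf
  have hcosθ : Real.cos θ = 1 - 2 * Real.sin (θ / 2) ^ 2 := by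
    have := Real.cos_two_mul (θ / 2)
    rw [mul_div_cancel₀ θ two_ne_zero] at this
    rw [this, Real.cos_sq']
    ring
  have hprod : 4 * (Real.sin ((θ - bandEdge κ) / 2) * Real.sin ((θ + bandEdge κ) / 2)) =
      (2 / κ) ^ 2 * ((κ * Real.sin (θ / 2)) ^ 2 - 1) := by
    have h : 4 * (Real.sin ((θ - bandEdge κ) / 2) * Real.sin ((θ + bandEdge κ) / 2)) =
        2 * (Real.cos (bandEdge κ) - Real.cos θ) := by
      have h2 := Real.cos_sub_cos (bandEdge κ) θ
      have e1 : (bandEdge κ + θ) / 2 = (θ + bandEdge κ) / 2 := by ring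
      have e2 : (bandEdge κ - θ) / 2 = -((θ - bandEdge κ) / 2) := by ring
      rw [e1, e2, Real.sin_neg] at h2
      linarith
    rw [h, cos_bandEdge hκ, hcosθ]
    field_simp
    ring
  have hs2 := cpow_one_sub_cexp (β := θ + bandEdge κ) (by linarith) (by linarith)
  have hsin2 : 0 ≤ Real.sin ((θ + bandEdge κ) / 2) :=
    Real.sin_nonneg_of_nonneg_of_le_pi (by linarith) (by linarith)
  rw [discRoot, hmul, hmul, hs2]
  rcases le_total θ (bandEdge κ) with h | h
  -- Below the edge `θ - bandEdge κ` is nonpositive; a full turn brings it into `[0, 2π]`, where the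
  -- root formula applies.
  · have hs1 := cpow_one_sub_cexp (β := θ + -bandEdge κ + 2 * Real.pi) (by linarith) (by linarith)
    have e : exp ((θ + -bandEdge κ + 2 * Real.pi : ℝ) * I) = exp ((θ + -bandEdge κ : ℝ) * I) := by
      have : ((θ + -bandEdge κ + 2 * Real.pi : ℝ) : ℂ) * I =
          ((θ + -bandEdge κ : ℝ) : ℂ) * I + 2 * Real.pi * I := by push_cast; ring
      rw [this, exp_add, exp_two_pi_mul_I, mul_one]
    rw [e] at hs1
    rw [hs1]
    have hsin : Real.sin ((θ + -bandEdge κ + 2 * Real.pi) / 2) =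
        -Real.sin ((θ - bandEdge κ) / 2) := by
      rw [← Real.sin_add_pi]; congr 1; ring
    rw [hsin]
    have hsin1 : 0 ≤ -Real.sin ((θ - bandEdge κ) / 2) := by
      rw [← Real.sin_neg]
      exact Real.sin_nonneg_of_nonneg_of_le_pi (by linarith) (by linarith)
    have hx := mul_sin_half_le_one hκ h0 h
    have hQ : bandRoot κ θ = (√(1 - (κ * Real.sin (θ / 2)) ^ 2) : ℝ) := by
      rw [bandRoot, Real.sqrt_eq_zero_of_nonpos (x := (κ * Real.sin (θ / 2)) ^ 2 - 1) (by nlinarith)]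
      simp
    have hroot : κ * √(2 * -Real.sin ((θ - bandEdge κ) / 2)) *
        √(2 * Real.sin ((θ + bandEdge κ) / 2)) = 2 * √(1 - (κ * Real.sin (θ / 2)) ^ 2) := by
      rw [mul_assoc, ← Real.sqrt_mul (by positivity)]
      have : 2 * -Real.sin ((θ - bandEdge κ) / 2) * (2 * Real.sin ((θ + bandEdge κ) / 2)) =
          (2 / κ) ^ 2 * (1 - (κ * Real.sin (θ / 2)) ^ 2) := by linarith
      rw [this, Real.sqrt_mul (by positivity), Real.sqrt_sq (by positivity)]
      field_simp
    have hexp : exp ((((θ + -bandEdge κ + 2 * Real.pi - Real.pi) / 4 : ℝ) : ℂ) * I) *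
        exp ((((θ + bandEdge κ - Real.pi) / 4 : ℝ) : ℂ) * I) = exp ((θ : ℂ) / 2 * I) := by
      rw [← exp_add]; congr 1; push_cast; ring
    have hroot' := congrArg (fun x : ℝ => (x : ℂ)) hroot
    push_cast at hroot' hexp ⊢
    rw [hQ, ← hexp]
    linear_combination (exp ((θ + -(bandEdge κ : ℂ) + 2 * Real.pi - Real.pi) / 4 * I) *
        exp ((θ + (bandEdge κ : ℂ) - Real.pi) / 4 * I)) * hroot'
  · have hs1 := cpow_one_sub_cexp (β := θ + -bandEdge κ) (by linarith) (by linarith)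
    rw [hs1]
    have hsin : Real.sin ((θ + -bandEdge κ) / 2) = Real.sin ((θ - bandEdge κ) / 2) := by
      rw [sub_eq_add_neg]
    rw [hsin]
    have hsin1 : 0 ≤ Real.sin ((θ - bandEdge κ) / 2) :=
      Real.sin_nonneg_of_nonneg_of_le_pi (by linarith) (by linarith)
    have hx := one_le_mul_sin_half hκ h h1
    have hQ : bandRoot κ θ = (√((κ * Real.sin (θ / 2)) ^ 2 - 1) : ℝ) * -I := by
      rw [bandRoot, Real.sqrt_eq_zero_of_nonpos (x := 1 - (κ * Real.sin (θ / 2)) ^ 2) (by nlinarith)]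
      simp
    have hroot : κ * √(2 * Real.sin ((θ - bandEdge κ) / 2)) *
        √(2 * Real.sin ((θ + bandEdge κ) / 2)) = 2 * √((κ * Real.sin (θ / 2)) ^ 2 - 1) := by
      rw [mul_assoc, ← Real.sqrt_mul (by positivity)]
      have : 2 * Real.sin ((θ - bandEdge κ) / 2) * (2 * Real.sin ((θ + bandEdge κ) / 2)) =
          (2 / κ) ^ 2 * ((κ * Real.sin (θ / 2)) ^ 2 - 1) := by linarith
      rw [this, Real.sqrt_mul (by positivity), Real.sqrt_sq (by positivity)]
      field_simp
    have hexp : exp ((((θ + -bandEdge κ - Real.pi) / 4 : ℝ) : ℂ) * I) *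
        exp ((((θ + bandEdge κ - Real.pi) / 4 : ℝ) : ℂ) * I) = exp ((θ : ℂ) / 2 * I) * -I := by
      have : exp (-(Real.pi / 2 * I)) = -I := by
        rw [exp_neg, exp_pi_div_two_mul_I, inv_I]
      rw [← this, ← exp_add, ← exp_add]; congr 1; push_cast; ring
    have hroot' := congrArg (fun x : ℝ => (x : ℂ)) hroot
    push_cast at hroot' hexp ⊢
    rw [hQ]
    linear_combination (exp ((θ + -(bandEdge κ : ℂ) - Real.pi) / 4 * I) *
        exp ((θ + (bandEdge κ : ℂ) - Real.pi) / 4 * I)) * hroot' +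
        2 * (√((κ * Real.sin (θ / 2)) ^ 2 - 1) : ℝ) * hexp

/-! ### Reflection and transmission data -/

/-- The decaying root on the right half line, as a function of the root `z` on the left one. -/
noncomputable def rightRoot (κ : ℝ) (z : ℂ) : ℂ := 4 * z / (discRoot κ z + κ * (1 - z)) ^ 2

/-- Half the transmission coefficient. -/
noncomputable def transCoeff (κ : ℝ) (z : ℂ) : ℂ := κ * (1 + z) / (κ * (1 + z) + discRoot κ z)

/-- With `S = discRoot κ z`, the product `(S + κ(1 - z)) (S - κ(1 - z))` is `4z`. A zero of the
first factor forces `z = 0`, where that factor is `2κ`. -/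
theorem discRoot_add_ne_zero {κ : ℝ} (hκ : 1 < κ) (z : ℂ) : discRoot κ z + κ * (1 - z) ≠ 0 := by
  have hκ0 : (κ : ℂ) ≠ 0 := by
    have : κ ≠ 0 := by linarith
    exact_mod_cast this
  intro h
  have hz : z = 0 := by
    have := discRoot_sq hκ z
    linear_combination (-1 / 4) * this + (discRoot κ z - κ * (1 - z)) / 4 * h
  subst hz
  rw [discRoot_zero] at h
  apply hκ0
  linear_combination h / 2

/-- As before, now with `κ²(1 + z)² - S² = 4(κ² - 1)z`; this is where `κ ≠ 1` enters. -/
theorem add_discRoot_ne_zero {κ : ℝ} (hκ : 1 < κ) (z : ℂ) : κ * (1 + z) + discRoot κ z ≠ 0 := by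
  have hκ0 : (κ : ℂ) ≠ 0 := by
    have : κ ≠ 0 := by linarith
    exact_mod_cast this
  have hκ1 : (κ : ℂ) ^ 2 - 1 ≠ 0 := by
    have : κ ^ 2 - 1 ≠ 0 := by nlinarith
    exact_mod_cast this
  intro h
  have hz : z = 0 := by
    have := discRoot_sq hκ z
    have h2 : ((κ : ℂ) ^ 2 - 1) * z = 0 := by
      linear_combination (1 / 4) * this + (κ * (1 + z) - discRoot κ z) / 4 * h
    exact (mul_eq_zero.1 h2).resolve_left hκ1
  subst hz
  rw [discRoot_zero] at h
  apply hκ0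
  linear_combination h / 2

/-- Reflection and transmission data for the step coefficient: `r` is the root on the right half
line corresponding to the root `z` on the left one, `T` is half the transmission coefficient. -/
structure IsScatteringData (b₁ b₂ : ℝ) (r T : ℂ → ℂ) : Prop where
  root_diffContOnCl : DiffContOnCl ℂ r (Metric.ball 0 1)
  trans_diffContOnCl : DiffContOnCl ℂ T (Metric.ball 0 1)
  root_zero : r 0 = 0
  trans_zero : T 0 = 1 / 2
  norm_root_le : ∀ z, ‖z‖ = 1 → ‖r z‖ ≤ 1
  dispersion : ∀ z, ‖z‖ = 1 →
    ((b₂ ^ 2)⁻¹ : ℝ) * (r z ^ 2 - 2 * r z + 1) = ((b₁ ^ 2)⁻¹ : ℝ) * (z - 2 + z⁻¹) * r z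
  junction : ∀ z, ‖z‖ = 1 →
    2 * T z * (((b₁ ^ 2)⁻¹ : ℝ) * (z - 1) + ((b₂ ^ 2)⁻¹ : ℝ) * (r z - 1) -
      ((b₁ ^ 2)⁻¹ : ℝ) * (z - 2 + z⁻¹)) = ((b₁ ^ 2)⁻¹ : ℝ) * (z - z⁻¹)

theorem isScatteringData_id {b : ℝ} : IsScatteringData b b id (fun _ => 1 / 2) where
  root_diffContOnCl := differentiable_id.diffContOnCl
  trans_diffContOnCl := diffContOnCl_const
  root_zero := rfl
  trans_zero := rfl
  norm_root_le z hz := hz.le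
  dispersion z hz := by
    have : z ≠ 0 := by rintro rfl; simp at hz
    simp only [id]
    field_simp
  junction z hz := by
    simp only [id]
    ring

theorem bandRoot_sq (κ θ : ℝ) : bandRoot κ θ ^ 2 = 1 - (κ * Real.sin (θ / 2)) ^ 2 := by
  unfold bandRoot
  set x := κ * Real.sin (θ / 2) with hx
  have hxc : ((x : ℝ) : ℂ) = κ * Real.sin (θ / 2) := by rw [hx]; push_cast; rfl
  rw [← hxc]
  rcases le_total (x ^ 2) 1 with h | h
  · rw [Real.sqrt_eq_zero_of_nonpos (x := x ^ 2 - 1) (by linarith)]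
    have : ((√(1 - x ^ 2) : ℝ) : ℂ) ^ 2 = 1 - x ^ 2 := by
      rw [← Complex.ofReal_pow, Real.sq_sqrt (by linarith)]; push_cast; rfl
    simp [this]
  · rw [Real.sqrt_eq_zero_of_nonpos (x := 1 - x ^ 2) (by linarith)]
    have : ((√(x ^ 2 - 1) : ℝ) : ℂ) ^ 2 = x ^ 2 - 1 := by
      rw [← Complex.ofReal_pow, Real.sq_sqrt (by linarith)]; push_cast; rfl
    rw [Complex.ofReal_zero, zero_sub, neg_sq, mul_pow, this, Complex.I_sq]
    ring

theorem one_add_cexp (θ : ℝ) : 1 + Complex.exp (θ * Complex.I) =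
    2 * Complex.exp ((θ : ℂ) / 2 * Complex.I) * Real.cos (θ / 2) := by
  have e3 : Complex.exp (θ * Complex.I) =
      Complex.exp ((θ : ℂ) / 2 * Complex.I) * Complex.exp ((θ : ℂ) / 2 * Complex.I) := by
    rw [← Complex.exp_add]; ring_nf
  have e4 : Complex.exp (-((θ : ℂ) / 2) * Complex.I) * Complex.exp ((θ : ℂ) / 2 * Complex.I) = 1 := by
    rw [← Complex.exp_add]; simp
  rw [e3]
  push_cast
  rw [Complex.cos]
  linear_combination -e4

theorem one_sub_cexp (θ : ℝ) : 1 - Complex.exp (θ * Complex.I) =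
    -(2 * Complex.exp ((θ : ℂ) / 2 * Complex.I) * (Real.sin (θ / 2) * Complex.I)) := by
  have e3 : Complex.exp (θ * Complex.I) =
      Complex.exp ((θ : ℂ) / 2 * Complex.I) * Complex.exp ((θ : ℂ) / 2 * Complex.I) := by
    rw [← Complex.exp_add]; ring_nf
  have e4 : Complex.exp (-((θ : ℂ) / 2) * Complex.I) * Complex.exp ((θ : ℂ) / 2 * Complex.I) = 1 := by
    rw [← Complex.exp_add]; simp
  rw [e3]
  push_cast
  rw [Complex.sin]
  linear_combination -e4 + (Complex.exp (-((θ : ℂ) / 2) * Complex.I) *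
    Complex.exp ((θ : ℂ) / 2 * Complex.I) - Complex.exp ((θ : ℂ) / 2 * Complex.I) *
    Complex.exp ((θ : ℂ) / 2 * Complex.I)) * Complex.I_sq

theorem rightRoot_cexp {κ θ : ℝ} (hκ : 1 < κ) (h0 : 0 ≤ θ) (h1 : θ ≤ Real.pi) :
    rightRoot κ (Complex.exp (θ * Complex.I)) =
      (bandRoot κ θ + κ * Real.sin (θ / 2) * Complex.I) ^ 2 := by
  have hne := discRoot_add_ne_zero hκ (Complex.exp (θ * Complex.I))
  have e3 : Complex.exp (θ * Complex.I) = Complex.exp ((θ : ℂ) / 2 * Complex.I) ^ 2 := by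
    rw [sq, ← Complex.exp_add]; ring_nf
  have hprod : (bandRoot κ θ + κ * Real.sin (θ / 2) * Complex.I) *
      (bandRoot κ θ - κ * Real.sin (θ / 2) * Complex.I) = 1 := by
    linear_combination bandRoot_sq κ θ - (κ * Real.sin (θ / 2)) ^ 2 * Complex.I_sq
  rw [rightRoot, div_eq_iff (pow_ne_zero 2 hne), one_sub_cexp, discRoot_cexp hκ h0 h1, e3]
  set ζ := Complex.exp ((θ : ℂ) / 2 * Complex.I)
  set Q := bandRoot κ θ
  set x : ℂ := κ * Real.sin (θ / 2) * Complex.I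
  have : 2 * ζ * Q + κ * -(2 * ζ * (Real.sin (θ / 2) * Complex.I)) = 2 * ζ * (Q - x) := by ring
  rw [this]
  linear_combination (-(4 * ζ ^ 2 * ((Q + x) * (Q - x) + 1))) * hprod

/-- Rationalising the denominator leaves the constant `κ² - 1`, so on the circle the transmission
amplitude is polynomial in `cos (θ/2)` and the band root, hence a combination of monotone pieces. -/
theorem transCoeff_cexp {κ θ : ℝ} (hκ : 1 < κ) (h0 : 0 ≤ θ) (h1 : θ ≤ Real.pi) :
    transCoeff κ (Complex.exp (θ * Complex.I)) =
      κ * Real.cos (θ / 2) * (κ * Real.cos (θ / 2) - bandRoot κ θ) / (κ ^ 2 - 1) := by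
  have hκ1 : (κ : ℂ) ^ 2 - 1 ≠ 0 := by
    have : κ ^ 2 - 1 ≠ 0 := by nlinarith
    exact_mod_cast this
  have hne := add_discRoot_ne_zero hκ (Complex.exp (θ * Complex.I))
  have hcs : ((Real.cos (θ / 2) : ℝ) : ℂ) ^ 2 + ((Real.sin (θ / 2) : ℝ) : ℂ) ^ 2 = 1 := by
    exact_mod_cast Real.cos_sq_add_sin_sq (θ / 2)
  rw [transCoeff, div_eq_div_iff hne hκ1, one_add_cexp, discRoot_cexp hκ h0 h1]
  linear_combination (2 * Complex.exp ((θ : ℂ) / 2 * Complex.I) * κ * Real.cos (θ / 2)) *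
    (bandRoot_sq κ θ - κ ^ 2 * hcs)

theorem norm_bandRoot_add_le {κ θ : ℝ} (hκ : 1 < κ) (h0 : 0 ≤ θ) (h1 : θ ≤ Real.pi) :
    ‖bandRoot κ θ + κ * Real.sin (θ / 2) * Complex.I‖ ≤ 1 := by
  have hx : 0 ≤ κ * Real.sin (θ / 2) := by
    have := Real.sin_nonneg_of_nonneg_of_le_pi (x := θ / 2) (by linarith)
      (by linarith [Real.pi_pos])
    positivity
  unfold bandRoot
  set x := κ * Real.sin (θ / 2) with hxd
  have hxc : ((x : ℝ) : ℂ) = κ * Real.sin (θ / 2) := by rw [hxd]; push_cast; rfl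
  rw [← hxc]
  rcases le_total x 1 with h | h
  · rw [Real.sqrt_eq_zero_of_nonpos (x := x ^ 2 - 1) (by nlinarith), Complex.ofReal_zero, zero_mul,
      sub_zero, sqrt_add_mul_I_eq_cexp_arcsin (by linarith) h, Complex.norm_exp_ofReal_mul_I]
  · rw [Real.sqrt_eq_zero_of_nonpos (x := 1 - x ^ 2) (by nlinarith)]
    have : ((0 : ℝ) : ℂ) - (√(x ^ 2 - 1) : ℝ) * Complex.I + x * Complex.I =
        ((x - √(x ^ 2 - 1) : ℝ) : ℂ) * Complex.I := by push_cast; ring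
    have hm := sub_sqrt_sq_sub_one_mem h
    rw [this, norm_mul, Complex.norm_I, mul_one, Complex.norm_real, Real.norm_eq_abs,
      abs_of_nonneg hm.1]
    exact hm.2

open ComplexConjugate in
theorem rightRoot_conj (κ : ℝ) {z : ℂ} (hz : ‖z‖ ≤ 1) :
    rightRoot κ (conj z) = conj (rightRoot κ z) := by
  simp [rightRoot, discRoot_conj κ hz, map_ofNat (starRingEnd ℂ) 4]

open ComplexConjugate in
theorem transCoeff_conj (κ : ℝ) {z : ℂ} (hz : ‖z‖ ≤ 1) :
    transCoeff κ (conj z) = conj (transCoeff κ z) := by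
  simp [transCoeff, discRoot_conj κ hz]

open ComplexConjugate in
theorem norm_rightRoot_le {κ : ℝ} (hκ : 1 < κ) {z : ℂ} (hz : ‖z‖ = 1) : ‖rightRoot κ z‖ ≤ 1 := by
  have main : ∀ θ : ℝ, 0 ≤ θ → θ ≤ Real.pi → ‖rightRoot κ (Complex.exp (θ * Complex.I))‖ ≤ 1 := by
    intro θ h0 h1
    rw [rightRoot_cexp hκ h0 h1, norm_pow]
    exact pow_le_one₀ (norm_nonneg _) (norm_bandRoot_add_le hκ h0 h1)
  have hz' : z = Complex.exp (z.arg * Complex.I) := by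
    have := Complex.norm_mul_exp_arg_mul_I z
    rw [hz, Complex.ofReal_one, one_mul] at this
    exact this.symm
  rcases le_total 0 z.arg with h | h
  · rw [hz']
    exact main _ h (Complex.arg_le_pi z)
  · have h2 := main (-z.arg) (by linarith) (by linarith [Complex.neg_pi_lt_arg z])
    have h3 : Complex.exp ((-z.arg : ℝ) * Complex.I) = conj z := by
      conv_rhs => rw [hz']
      rw [← Complex.exp_conj]
      simp
    rwa [h3, rightRoot_conj κ hz.le, RCLike.norm_conj] at h2

/-- All relations follow from the equation for `S² = discRoot κ z ^ 2`, which also gives `r = (S -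
κ(1 - z)) / (S + κ(1 - z))`. The defining form of `rightRoot` makes the zero at `z = 0` visible. -/
theorem isScatteringData_rightRoot {b₁ b₂ : ℝ} (h₁ : 0 < b₁) (h : b₁ < b₂) :
    IsScatteringData b₁ b₂ (rightRoot (b₂ / b₁)) (transCoeff (b₂ / b₁)) := by
  have h₂ : 0 < b₂ := h₁.trans h
  have hκ : 1 < b₂ / b₁ := (one_lt_div h₁).2 h
  have hb : ((b₁ ^ 2)⁻¹ : ℝ) = (b₂ / b₁) ^ 2 * (b₂ ^ 2)⁻¹ := by field_simp
  set κ := b₂ / b₁ with hκd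
  set c : ℝ := (b₂ ^ 2)⁻¹ with hc
  have hκ0 : (κ : ℂ) ≠ 0 := by
    have : κ ≠ 0 := by linarith
    exact_mod_cast this
  have hS : DiffContOnCl ℂ (discRoot κ) (Metric.ball 0 1) :=
    ⟨differentiableOn_discRoot κ, by
      rw [closure_ball _ one_ne_zero]; exact continuousOn_discRoot κ⟩
  have h1z' : DiffContOnCl ℂ (fun z : ℂ => (κ : ℂ) * (1 + z)) (Metric.ball 0 1) :=
    (Differentiable.diffContOnCl (by fun_prop))
  have h4z : DiffContOnCl ℂ (fun z : ℂ => 4 * z) (Metric.ball 0 1) :=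
    (Differentiable.diffContOnCl (by fun_prop))
  refine ⟨?_, ?_, ?_, ?_, fun z hz => norm_rightRoot_le hκ hz, ?_, ?_⟩
  · have hp : DiffContOnCl ℂ (fun z => discRoot κ z + κ * (1 - z)) (Metric.ball 0 1) :=
      hS.add (Differentiable.diffContOnCl (by fun_prop))
    have hp2 : DiffContOnCl ℂ (fun z => (discRoot κ z + κ * (1 - z)) ^ 2) (Metric.ball 0 1) := by
      simpa [sq, smul_eq_mul] using hp.smul hp
    have := h4z.smul (hp2.inv fun z _ => pow_ne_zero 2 (discRoot_add_ne_zero hκ z))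
    change DiffContOnCl ℂ (fun z => 4 * z / (discRoot κ z + κ * (1 - z)) ^ 2) _
    simpa [div_eq_mul_inv, smul_eq_mul, Pi.smul_def', Pi.inv_def] using this
  · have hp : DiffContOnCl ℂ (fun z => κ * (1 + z) + discRoot κ z) (Metric.ball 0 1) :=
      h1z'.add hS
    have := h1z'.smul (hp.inv fun z _ => add_discRoot_ne_zero hκ z)
    change DiffContOnCl ℂ (fun z => κ * (1 + z) / (κ * (1 + z) + discRoot κ z)) _
    simpa [div_eq_mul_inv, smul_eq_mul, Pi.smul_def', Pi.inv_def] using this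
  · simp [rightRoot]
  · simp only [transCoeff, discRoot_zero, add_zero, mul_one]
    field_simp
    norm_num
  · intro z hz
    have hz0 : z ≠ 0 := by rintro rfl; simp at hz
    have hp := discRoot_add_ne_zero hκ z
    have hsq := discRoot_sq hκ z
    have hm : rightRoot κ z * (discRoot κ z + κ * (1 - z)) = discRoot κ z - κ * (1 - z) := by
      rw [rightRoot]
      field_simp
      linear_combination -hsq
    have hr : rightRoot κ z ^ 2 - 2 * rightRoot κ z + 1 = κ ^ 2 * (z - 2 + z⁻¹) * rightRoot κ z := by
      have h1 : (1 - rightRoot κ z) * (discRoot κ z + κ * (1 - z)) = 2 * (κ * (1 - z)) := by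
        linear_combination -hm
      have h2 : rightRoot κ z * (discRoot κ z + κ * (1 - z)) ^ 2 = 4 * z := by
        rw [rightRoot]; field_simp
      have h3 : z * (rightRoot κ z ^ 2 - 2 * rightRoot κ z + 1) =
          κ ^ 2 * (z ^ 2 - 2 * z + 1) * rightRoot κ z := by
        refine mul_right_cancel₀ (pow_ne_zero 2 hp) ?_
        linear_combination z * ((1 - rightRoot κ z) * (discRoot κ z + κ * (1 - z)) +
          2 * (κ * (1 - z))) * h1 - κ ^ 2 * (z ^ 2 - 2 * z + 1) * h2
      refine mul_left_cancel₀ hz0 ?_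
      rw [h3]
      field_simp
    rw [hr, hb, ← hc]
    push_cast
    ring
  · intro z hz
    have hz0 : z ≠ 0 := by rintro rfl; simp at hz
    have hp := discRoot_add_ne_zero hκ z
    have hq := add_discRoot_ne_zero hκ z
    have hsq := discRoot_sq hκ z
    have hm : rightRoot κ z * (discRoot κ z + κ * (1 - z)) = discRoot κ z - κ * (1 - z) := by
      rw [rightRoot]
      field_simp
      linear_combination -hsq
    have hT : transCoeff κ z * (κ * (1 + z) + discRoot κ z) = κ * (1 + z) := by
      rw [transCoeff]; field_simp
    -- The junction bracket is a multiple of the denominator of `transCoeff`; this is what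
    -- determines the transmission coefficient.
    have hD : z * (κ ^ 2 * (z - 1) + (rightRoot κ z - 1) - κ ^ 2 * (z - 2 + z⁻¹)) * 2 =
        -(κ * (1 - z) * (κ * (1 + z) + discRoot κ z)) := by
      have e : z * z⁻¹ = 1 := mul_inv_cancel₀ hz0
      refine mul_right_cancel₀ hp ?_
      linear_combination (2 * z) * hm - (2 * κ ^ 2 * (discRoot κ z + κ * (1 - z))) * e +
        κ * (1 - z) * hsq
    refine mul_left_cancel₀ hz0 ?_
    rw [hb, ← hc]
    have e : z * z⁻¹ = 1 := mul_inv_cancel₀ hz0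
    push_cast
    linear_combination c * transCoeff κ z * hD - c * κ * (1 - z) * hT + c * κ ^ 2 * e

/-! ### Oscillatory averages over the circle and the free kernel -/

/-- The oscillating factor `e^{itλ}` with `λ = c (z - 2 + z⁻¹)` on the unit circle. -/
noncomputable def circlePhase (c t : ℝ) (z : ℂ) : ℂ :=
  Complex.exp ((t * (c * (2 * z.re - 2)) : ℝ) * Complex.I)

/-- The oscillatory average of `g` over the unit circle. -/
noncomputable def oscAverage (c t : ℝ) (g : ℂ → ℂ) : ℂ :=
  Real.circleAverage (fun z => circlePhase c t z * g z) 0 1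

theorem continuous_circlePhase (c t : ℝ) : Continuous (circlePhase c t) := by
  unfold circlePhase
  have := Complex.continuous_re
  fun_prop

theorem norm_circlePhase (c t : ℝ) (z : ℂ) : ‖circlePhase c t z‖ = 1 :=
  Complex.norm_exp_ofReal_mul_I _

theorem circlePhase_zero (c : ℝ) (z : ℂ) : circlePhase c 0 z = 1 := by
  simp [circlePhase]

theorem two_mul_re_of_norm_eq_one {z : ℂ} (hz : ‖z‖ = 1) : 2 * (z.re : ℂ) = z + z⁻¹ := by
  rw [Complex.inv_eq_conj hz, Complex.add_conj]
  push_cast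
  rfl

theorem oscAverage_eq_integral (c t : ℝ) (g : ℂ → ℂ) :
    oscAverage c t g = (2 * Real.pi)⁻¹ •
      ∫ θ in 0..2 * Real.pi, circlePhase c t (circleMap 0 1 θ) * g (circleMap 0 1 θ) := rfl

theorem circleIntegrable_circlePhase_mul (c t : ℝ) {g : ℂ → ℂ}
    (hg : ContinuousOn g (Metric.sphere 0 1)) :
    CircleIntegrable (fun z => circlePhase c t z * g z) 0 1 :=
  ContinuousOn.circleIntegrable zero_le_one ((continuous_circlePhase c t).continuousOn.mul hg)

theorem oscAverage_congr (c t : ℝ) {g h : ℂ → ℂ} (hgh : ∀ z, ‖z‖ = 1 → g z = h z) :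
    oscAverage c t g = oscAverage c t h := by
  refine Real.circleAverage_congr_sphere fun z hz => ?_
  rw [abs_one, mem_sphere_zero_iff_norm] at hz
  simp only [hgh z hz]

theorem oscAverage_add (c t : ℝ) {g h : ℂ → ℂ} (hg : ContinuousOn g (Metric.sphere 0 1))
    (hh : ContinuousOn h (Metric.sphere 0 1)) :
    oscAverage c t (fun z => g z + h z) = oscAverage c t g + oscAverage c t h := by
  unfold oscAverage
  rw [← Real.circleAverage_fun_add (circleIntegrable_circlePhase_mul c t hg)
    (circleIntegrable_circlePhase_mul c t hh)]
  simp only [mul_add]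

theorem oscAverage_const_mul (c t : ℝ) (a : ℂ) (g : ℂ → ℂ) :
    oscAverage c t (fun z => a * g z) = a * oscAverage c t g := by
  unfold oscAverage
  have := Real.circleAverage_fun_smul (a := a) (f := fun z => circlePhase c t z * g z)
    (c := 0) (R := 1)
  simp only [smul_eq_mul] at this
  rw [← this]
  congr 1
  funext z
  ring

/-- Linearity of the oscillatory average, for three terms. -/
theorem oscAverage_linear_comb (c t : ℝ) (a₁ a₂ a₃ : ℂ) {g₁ g₂ g₃ : ℂ → ℂ}
    (h₁ : ContinuousOn g₁ (Metric.sphere 0 1)) (h₂ : ContinuousOn g₂ (Metric.sphere 0 1))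
    (h₃ : ContinuousOn g₃ (Metric.sphere 0 1)) :
    oscAverage c t (fun z => a₁ * g₁ z + a₂ * g₂ z + a₃ * g₃ z) =
      a₁ * oscAverage c t g₁ + a₂ * oscAverage c t g₂ + a₃ * oscAverage c t g₃ := by
  have k₁ : ContinuousOn (fun z => a₁ * g₁ z) (Metric.sphere 0 1) := continuousOn_const.mul h₁
  have k₂ : ContinuousOn (fun z => a₂ * g₂ z) (Metric.sphere 0 1) := continuousOn_const.mul h₂
  have k₃ : ContinuousOn (fun z => a₃ * g₃ z) (Metric.sphere 0 1) := continuousOn_const.mul h₃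
  have k₁₂ : ContinuousOn (fun z => a₁ * g₁ z + a₂ * g₂ z) (Metric.sphere 0 1) := k₁.add k₂
  rw [oscAverage_add c t k₁₂ k₃, oscAverage_add c t k₁ k₂]
  simp only [oscAverage_const_mul]

theorem norm_oscAverage_le (c t : ℝ) {g : ℂ → ℂ} {B : ℝ} (hB : ∀ z, ‖z‖ = 1 → ‖g z‖ ≤ B) :
    ‖oscAverage c t g‖ ≤ B := by
  have hpi := Real.pi_pos
  rw [oscAverage_eq_integral, norm_smul]
  have h := intervalIntegral.norm_integral_le_of_norm_le_const (a := 0) (b := 2 * Real.pi) (C := B)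
    (f := fun θ => circlePhase c t (circleMap 0 1 θ) * g (circleMap 0 1 θ)) (fun θ _ => by
      rw [norm_mul, norm_circlePhase, one_mul]
      exact hB _ (by simp))
  rw [sub_zero, abs_of_pos (by positivity)] at h
  rw [norm_inv, Real.norm_eq_abs, abs_of_pos (by positivity), inv_mul_le_iff₀ (by positivity)]
  linarith

/-- Differentiation under the integral; on the unit circle `2 Re z = z + z⁻¹`, so the time
derivative multiplies `g` by `i` times the symbol of the constant coefficient operator. -/
theorem hasDerivAt_oscAverage (c t : ℝ) {g : ℂ → ℂ} (hg : ContinuousOn g (Metric.sphere 0 1)) :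
    HasDerivAt (fun t => oscAverage c t g)
      (oscAverage c t (fun z => Complex.I * (c * (z - 2 + z⁻¹)) * g z)) t := by
  have hgc : Continuous fun θ => g (circleMap 0 1 θ) :=
    hg.comp_continuous (continuous_circleMap 0 1) (fun θ => circleMap_mem_sphere 0 zero_le_one θ)
  have hre : Continuous fun θ => (circleMap 0 1 θ).re :=
    Complex.continuous_re.comp (continuous_circleMap 0 1)
  have hphase : ∀ t, Continuous fun θ => circlePhase c t (circleMap 0 1 θ) := fun t =>
    (continuous_circlePhase c t).comp (continuous_circleMap 0 1)
  set F' : ℝ → ℝ → ℂ := fun t θ => circlePhase c t (circleMap 0 1 θ) *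
    (((c * (2 * (circleMap 0 1 θ).re - 2) : ℝ) : ℂ) * Complex.I * g (circleMap 0 1 θ)) with hF'
  have hmul : Continuous fun θ => ((c * (2 * (circleMap 0 1 θ).re - 2) : ℝ) : ℂ) * Complex.I *
      g (circleMap 0 1 θ) :=
    ((Complex.continuous_ofReal.comp (by fun_prop)).mul continuous_const).mul hgc
  have hF'c : ∀ t, Continuous (F' t) := fun t => (hphase t).mul hmul
  have key := intervalIntegral.hasDerivAt_integral_of_dominated_loc_of_deriv_le
    (μ := MeasureTheory.volume) (a := 0) (b := 2 * Real.pi)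
    (F := fun t θ => circlePhase c t (circleMap 0 1 θ) * g (circleMap 0 1 θ))
    (F' := F') (x₀ := t) (s := Set.univ)
    (bound := fun θ => ‖((c * (2 * (circleMap 0 1 θ).re - 2) : ℝ) : ℂ) * Complex.I *
      g (circleMap 0 1 θ)‖) Filter.univ_mem
    (Filter.Eventually.of_forall fun s => ((hphase s).mul hgc).aestronglyMeasurable)
    (((hphase t).mul hgc).intervalIntegrable _ _)
    (hF'c t).aestronglyMeasurable
    (Filter.Eventually.of_forall fun θ _ s _ => by
      simp only [hF']
      rw [norm_mul, norm_circlePhase, one_mul])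
    (hmul.norm.intervalIntegrable _ _)
    (Filter.Eventually.of_forall fun θ _ s _ => by
      have h1 : HasDerivAt (fun s : ℝ => s * (c * (2 * (circleMap 0 1 θ).re - 2)))
          (c * (2 * (circleMap 0 1 θ).re - 2)) s := by
        simpa using (hasDerivAt_id s).mul_const (c * (2 * (circleMap 0 1 θ).re - 2))
      refine ((h1.ofReal_comp.mul_const Complex.I).cexp.mul_const
        (g (circleMap 0 1 θ))).congr_deriv ?_
      simp only [hF', circlePhase]
      ring)
  have h2 := key.2.const_smul (2 * Real.pi)⁻¹
  refine h2.congr_deriv ?_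
  rw [oscAverage_eq_integral]
  congr 1
  refine intervalIntegral.integral_congr fun θ _ => ?_
  have := two_mul_re_of_norm_eq_one (z := circleMap 0 1 θ) (by simp)
  simp only [hF']
  push_cast
  rw [this]
  ring

/-- Mean value property: at time zero the phase is `1`. All initial conditions below are read off
from it. -/
theorem oscAverage_zero_of_diffContOnCl (c : ℝ) {g : ℂ → ℂ}
    (hg : DiffContOnCl ℂ g (Metric.ball 0 1)) : oscAverage c 0 g = g 0 := by
  unfold oscAverage
  simp only [circlePhase_zero, one_mul]
  exact DiffContOnCl.circleAverage (by rwa [abs_one])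

/-- The kernel of the Schrödinger group with constant coefficient. -/
noncomputable def freeKernel (c t : ℝ) (p : ℤ) : ℂ := oscAverage c t (fun z => z ^ p)

theorem continuousOn_zpow_sphere (p : ℤ) :
    ContinuousOn (fun z : ℂ => z ^ p) (Metric.sphere 0 1) := by
  intro z hz
  rw [mem_sphere_zero_iff_norm] at hz
  have : z ≠ 0 := by rintro rfl; simp at hz
  exact (continuousAt_zpow₀ z p (Or.inl this)).continuousWithinAt

theorem freeKernel_neg (c t : ℝ) (p : ℤ) : freeKernel c t (-p) = freeKernel c t p := by
  unfold freeKernel oscAverage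
  rw [← Real.circleAverage_zero_one_congr_inv]
  refine Real.circleAverage_congr_sphere fun z hz => ?_
  rw [abs_one, mem_sphere_zero_iff_norm] at hz
  simp only [circlePhase, Complex.inv_eq_conj hz, Complex.conj_re]
  rw [← Complex.inv_eq_conj hz]
  simp

theorem freeKernel_time_zero (c : ℝ) (p : ℤ) : freeKernel c 0 p = if p = 0 then 1 else 0 := by
  have h : ∀ k : ℕ, freeKernel c 0 k = if (k : ℤ) = 0 then 1 else 0 := by
    intro k
    have h1 : DiffContOnCl ℂ (fun z : ℂ => z ^ (k : ℤ)) (Metric.ball 0 1) := by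
      simp only [zpow_natCast]
      exact (differentiable_pow k).diffContOnCl
    rw [freeKernel, oscAverage_zero_of_diffContOnCl c h1, zpow_natCast]
    rcases k with _ | k
    · simp
    · simp; omega
  obtain ⟨k, rfl | rfl⟩ := p.eq_nat_or_neg
  · exact h k
  · rw [freeKernel_neg, h k]
    simp

theorem hasDerivAt_freeKernel (c t : ℝ) (p : ℤ) :
    HasDerivAt (fun t => freeKernel c t p)
      (Complex.I * (c * (freeKernel c t (p + 1) - 2 * freeKernel c t p + freeKernel c t (p - 1))))
      t := by
  refine (hasDerivAt_oscAverage c t (continuousOn_zpow_sphere p)).congr_deriv ?_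
  have h := oscAverage_linear_comb c t (Complex.I * c) (-2 * Complex.I * c) (Complex.I * c)
    (continuousOn_zpow_sphere (p + 1)) (continuousOn_zpow_sphere p) (continuousOn_zpow_sphere (p - 1))
  have e : oscAverage c t (fun z => Complex.I * (c * (z - 2 + z⁻¹)) * z ^ p) = oscAverage c t
      (fun z => Complex.I * c * z ^ (p + 1) + -2 * Complex.I * c * z ^ p +
        Complex.I * c * z ^ (p - 1)) := by
    refine oscAverage_congr c t fun z hz => ?_
    have hz0 : z ≠ 0 := by rintro rfl; simp at hz
    rw [zpow_add_one₀ hz0, zpow_sub_one₀ hz0]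
    ring
  rw [e, h]
  simp only [freeKernel]
  ring

theorem norm_freeKernel_le_one (c t : ℝ) (p : ℤ) : ‖freeKernel c t p‖ ≤ 1 :=
  norm_oscAverage_le c t fun z hz => by rw [norm_zpow, hz, one_zpow]

/-! ### Representation of the kernel with source at the origin -/

/-- The generalized eigenfunction decaying on both sides when `|z| < 1`. -/
noncomputable def jumpWave (r : ℂ → ℂ) (n : ℤ) (z : ℂ) : ℂ := (if n < 0 then z else r z) ^ n.natAbs

/-- The integrand of the non-Dirichlet part of the kernel. -/
noncomputable def transIntegrand (r T : ℂ → ℂ) (n m : ℤ) (z : ℂ) : ℂ :=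
  2 * T z * jumpWave r n z * jumpWave r m z

namespace IsScatteringData

variable {b₁ b₂ : ℝ} {r T : ℂ → ℂ}

theorem diffContOnCl_jumpWave (h : IsScatteringData b₁ b₂ r T) (n : ℤ) :
    DiffContOnCl ℂ (jumpWave r n) (Metric.ball 0 1) := by
  unfold jumpWave
  split_ifs
  · exact (differentiable_pow _).diffContOnCl
  · exact ⟨h.root_diffContOnCl.1.fun_pow _, h.root_diffContOnCl.2.pow _⟩

theorem diffContOnCl_transIntegrand (h : IsScatteringData b₁ b₂ r T) (n m : ℤ) :
    DiffContOnCl ℂ (transIntegrand r T n m) (Metric.ball 0 1) := by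
  have h1 := h.diffContOnCl_jumpWave n
  have h2 := h.diffContOnCl_jumpWave m
  have h3 := h.trans_diffContOnCl
  exact ⟨((h3.1.const_mul 2).fun_mul h1.1).fun_mul h2.1,
    ((continuousOn_const.mul h3.2).mul h1.2).mul h2.2⟩

theorem continuousOn_transIntegrand (h : IsScatteringData b₁ b₂ r T) (n m : ℤ) :
    ContinuousOn (transIntegrand r T n m) (Metric.sphere 0 1) := by
  refine (h.diffContOnCl_transIntegrand n m).2.mono ?_
  rw [closure_ball _ one_ne_zero]
  exact Metric.sphere_subset_closedBall

theorem jumpWave_apply_zero (h : IsScatteringData b₁ b₂ r T) (n : ℤ) :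
    jumpWave r n 0 = if n = 0 then 1 else 0 := by
  unfold jumpWave
  rw [h.root_zero, ite_self]
  by_cases hn : n = 0
  · simp [hn]
  · simp [hn]

/-- The waves are holomorphic in the disc and vanish at its centre unless the index is `0`, so the
transmitted part carries no initial mass except for a source at the origin, where `2 T(0) = 1`. -/
theorem oscAverage_transIntegrand_time_zero (h : IsScatteringData b₁ b₂ r T) (c : ℝ) (n m : ℤ) :
    oscAverage c 0 (transIntegrand r T n m) = if n = 0 ∧ m = 0 then 1 else 0 := by
  rw [oscAverage_zero_of_diffContOnCl c (h.diffContOnCl_transIntegrand n m), transIntegrand,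
    h.trans_zero, h.jumpWave_apply_zero, h.jumpWave_apply_zero]
  by_cases hn : n = 0 <;> by_cases hm : m = 0 <;> simp [hn, hm]

theorem exists_norm_transIntegrand_le (h : IsScatteringData b₁ b₂ r T) :
    ∃ B, ∀ n m z, ‖z‖ = 1 → ‖transIntegrand r T n m z‖ ≤ B := by
  have hT : ContinuousOn T (Metric.sphere 0 1) := by
    refine h.trans_diffContOnCl.2.mono ?_
    rw [closure_ball _ one_ne_zero]
    exact Metric.sphere_subset_closedBall
  obtain ⟨B, hB⟩ := (isCompact_sphere (0 : ℂ) 1).exists_bound_of_continuousOn hT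
  have hw : ∀ n z, ‖z‖ = 1 → ‖jumpWave r n z‖ ≤ 1 := by
    intro n z hz
    unfold jumpWave
    rw [norm_pow]
    refine pow_le_one₀ (norm_nonneg _) ?_
    split_ifs
    · exact hz.le
    · exact h.norm_root_le z hz
  refine ⟨2 * B, fun n m z hz => ?_⟩
  have h1 := hB z (by simpa using hz)
  have h2 := hw n z hz
  have h3 := hw m z hz
  have hB0 : 0 ≤ B := (norm_nonneg _).trans h1
  rw [transIntegrand, norm_mul, norm_mul, norm_mul, Complex.norm_ofNat]
  calc 2 * ‖T z‖ * ‖jumpWave r n z‖ * ‖jumpWave r m z‖ ≤ 2 * B * 1 * 1 := by gcongr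
    _ = 2 * B := by ring

theorem jumpWave_of_neg {n : ℤ} (hn : n ≤ -1) {z : ℂ} (hz : ‖z‖ = 1) :
    jumpWave r (n + 1) z - 2 * jumpWave r n z + jumpWave r (n - 1) z =
      (z - 2 + z⁻¹) * jumpWave r n z := by
  obtain ⟨k, rfl⟩ : ∃ k : ℕ, n = -(k + 1 : ℤ) := ⟨(-n - 1).toNat, by omega⟩
  have hz0 : z ≠ 0 := by rintro rfl; simp at hz
  -- For `k = 0` this neighbour is the origin and falls in the `r` branch, but with exponent `0`, so
  -- both branches agree.
  have e1 : jumpWave r (-(k + 1 : ℤ) + 1) z = z ^ k := by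
    rcases k with _ | k
    · simp [jumpWave]
    · rw [jumpWave, if_pos (by push_cast; omega)]
      congr 1
  have e2 : jumpWave r (-(k + 1 : ℤ)) z = z ^ (k + 1) := by
    rw [jumpWave, if_pos (by omega)]
    congr 1
  have e3 : jumpWave r (-(k + 1 : ℤ) - 1) z = z ^ (k + 2) := by
    rw [jumpWave, if_pos (by omega)]
    congr 1
  rw [e1, e2, e3]
  field_simp
  ring

theorem jumpWave_of_pos (h : IsScatteringData b₁ b₂ r T) {n : ℤ} (hn : 1 ≤ n) {z : ℂ}
    (hz : ‖z‖ = 1) :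
    ((b₂ ^ 2)⁻¹ : ℝ) * (jumpWave r (n + 1) z - 2 * jumpWave r n z + jumpWave r (n - 1) z) =
      ((b₁ ^ 2)⁻¹ : ℝ) * (z - 2 + z⁻¹) * jumpWave r n z := by
  obtain ⟨k, rfl⟩ : ∃ k : ℕ, n = (k + 1 : ℤ) := ⟨(n - 1).toNat, by omega⟩
  have e1 : jumpWave r ((k + 1 : ℤ) + 1) z = r z ^ (k + 2) := by
    rw [jumpWave, if_neg (by omega)]
    congr 1
  have e2 : jumpWave r (k + 1 : ℤ) z = r z ^ (k + 1) := by
    rw [jumpWave, if_neg (by omega)]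
    congr 1
  have e3 : jumpWave r ((k + 1 : ℤ) - 1) z = r z ^ k := by
    rw [jumpWave, if_neg (by omega)]
    congr 1
    omega
  rw [e1, e2, e3]
  linear_combination r z ^ k * h.dispersion z hz

/-- Away from the origin the transmitted part of the kernel solves the equation. -/
theorem hasDerivAt_oscAverage_transIntegrand (h : IsScatteringData b₁ b₂ r T) (t : ℝ) {n : ℤ}
    (hn : n ≠ 0) (m : ℤ) :
    HasDerivAt (fun t => oscAverage (b₁ ^ 2)⁻¹ t (transIntegrand r T n m))
      (Complex.I * jumpLaplacian b₁ b₂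
        (fun n => oscAverage (b₁ ^ 2)⁻¹ t (transIntegrand r T n m)) n) t := by
  refine (hasDerivAt_oscAverage (b₁ ^ 2)⁻¹ t
    (h.continuousOn_transIntegrand n m)).congr_deriv ?_
  have key : ∀ a : ℂ, (∀ z, ‖z‖ = 1 → a * (jumpWave r (n + 1) z - 2 * jumpWave r n z +
      jumpWave r (n - 1) z) = ((b₁ ^ 2)⁻¹ : ℝ) * (z - 2 + z⁻¹) * jumpWave r n z) →
      oscAverage (b₁ ^ 2)⁻¹ t (fun z => Complex.I * (((b₁ ^ 2)⁻¹ : ℝ) * (z - 2 + z⁻¹)) *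
        transIntegrand r T n m z) =
      Complex.I * (a * (oscAverage (b₁ ^ 2)⁻¹ t (transIntegrand r T (n + 1) m) -
        2 * oscAverage (b₁ ^ 2)⁻¹ t (transIntegrand r T n m) +
        oscAverage (b₁ ^ 2)⁻¹ t (transIntegrand r T (n - 1) m))) := by
    intro a ha
    have hl := oscAverage_linear_comb (b₁ ^ 2)⁻¹ t (Complex.I * a) (-2 * Complex.I * a)
      (Complex.I * a) (h.continuousOn_transIntegrand (n + 1) m) (h.continuousOn_transIntegrand n m)
      (h.continuousOn_transIntegrand (n - 1) m)
    refine (oscAverage_congr _ t fun z hz => ?_).trans (hl.trans ?_)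
    · simp only [transIntegrand]
      linear_combination (-(Complex.I * 2 * T z * jumpWave r m z)) * ha z hz
    · ring
  rcases lt_or_gt_of_ne hn with hn | hn
  · rw [jumpLaplacian_of_neg b₁ b₂ _ (by omega)]
    refine (key (((b₁ ^ 2)⁻¹ : ℝ) : ℂ) fun z hz => ?_).trans ?_
    · rw [jumpWave_of_neg (by omega) hz]
      ring
    · push_cast
      rfl
  · rw [jumpLaplacian_of_pos b₁ b₂ _ (by omega)]
    refine (key (((b₂ ^ 2)⁻¹ : ℝ) : ℂ) fun z hz => h.jumpWave_of_pos (by omega) hz).trans ?_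
    push_cast
    rfl

/-- The kernel with source at the origin. -/
theorem jumpKernel_origin (h : IsScatteringData b₁ b₂ r T) (t : ℝ) (n : ℤ) :
    jumpKernel b₁ b₂ t n 0 = oscAverage (b₁ ^ 2)⁻¹ t (transIntegrand r T n 0) := by
  refine (isBoundedJumpSolution_jumpKernel b₁ b₂ 0).eq
    (w := fun t n => oscAverage (b₁ ^ 2)⁻¹ t (transIntegrand r T n 0))
    ⟨fun t n => ?_, fun R => ?_, fun n => ?_⟩ t n
  · by_cases hn : n = 0
    · subst hn
      refine (hasDerivAt_oscAverage (b₁ ^ 2)⁻¹ t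
        (h.continuousOn_transIntegrand 0 0)).congr_deriv ?_
      rw [jumpLaplacian_zero]
      have hl := oscAverage_linear_comb (b₁ ^ 2)⁻¹ t ((b₁ ^ 2)⁻¹ : ℝ)
        (-((((b₁ ^ 2)⁻¹ : ℝ) : ℂ) + ((b₂ ^ 2)⁻¹ : ℝ))) ((b₂ ^ 2)⁻¹ : ℝ)
        (h.continuousOn_transIntegrand (-1) 0) (h.continuousOn_transIntegrand 0 0)
        (h.continuousOn_transIntegrand 1 0)
      have hw : ContinuousOn (fun z : ℂ => Complex.I * (((b₁ ^ 2)⁻¹ : ℝ) * (z - 2 + z⁻¹)) *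
          transIntegrand r T 0 0 z) (Metric.sphere 0 1) := by
        have e := continuousOn_zpow_sphere (-1)
        simp only [zpow_neg_one] at e
        have e2 := h.continuousOn_transIntegrand 0 0
        fun_prop
      have hl2 := oscAverage_linear_comb (b₁ ^ 2)⁻¹ t (-Complex.I) ((b₁ ^ 2)⁻¹ : ℝ)
        (-(((b₁ ^ 2)⁻¹ : ℝ) : ℂ)) hw (continuousOn_zpow_sphere 1) (continuousOn_zpow_sphere (-1))
      -- The junction condition leaves the defect `b₁⁻² (z - z⁻¹)`. Its oscillatory average is zero
      -- because the phase is invariant under `z ↦ z⁻¹`.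
      have hf := freeKernel_neg (b₁ ^ 2)⁻¹ t 1
      simp only [freeKernel] at hf
      rw [hf] at hl2
      have hcong := oscAverage_congr (b₁ ^ 2)⁻¹ t
        (g := fun z => ((b₁ ^ 2)⁻¹ : ℝ) * transIntegrand r T (-1) 0 z +
          (-((((b₁ ^ 2)⁻¹ : ℝ) : ℂ) + ((b₂ ^ 2)⁻¹ : ℝ))) * transIntegrand r T 0 0 z +
          ((b₂ ^ 2)⁻¹ : ℝ) * transIntegrand r T 1 0 z)
        (h := fun z => -Complex.I * (Complex.I * (((b₁ ^ 2)⁻¹ : ℝ) * (z - 2 + z⁻¹)) *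
          transIntegrand r T 0 0 z) + ((b₁ ^ 2)⁻¹ : ℝ) * z ^ (1 : ℤ) +
          (-(((b₁ ^ 2)⁻¹ : ℝ) : ℂ)) * z ^ (-1 : ℤ)) (fun z hz => by
            have hj := h.junction z hz
            have e0 : jumpWave r 0 z = 1 := by simp [jumpWave]
            have e1 : jumpWave r 1 z = r z := by simp [jumpWave]
            have e2 : jumpWave r (-1) z = z := by simp [jumpWave]
            simp only [transIntegrand, e0, e1, e2, zpow_one, zpow_neg_one]
            linear_combination hj + 2 * T z * ((b₁ ^ 2)⁻¹ : ℝ) * (z - 2 + z⁻¹) * Complex.I_sq)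
      rw [hl, hl2] at hcong
      push_cast at hcong ⊢
      linear_combination (-Complex.I) * hcong + (oscAverage (b₁ ^ 2)⁻¹ t fun z => Complex.I *
        (((b₁ : ℂ) ^ 2)⁻¹ * (z - 2 + z⁻¹)) * transIntegrand r T 0 0 z) * Complex.I_sq
    · exact h.hasDerivAt_oscAverage_transIntegrand t hn 0
  · obtain ⟨B, hB⟩ := h.exists_norm_transIntegrand_le
    exact ⟨B, fun t _ n => norm_oscAverage_le _ t (hB n 0)⟩
  · rw [h.oscAverage_transIntegrand_time_zero, Pi.single_apply]
    simp

end IsScatteringData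

/-! ### Method of images and sources away from the origin -/

/-- The Dirichlet kernel of a half line with constant coefficient. -/
noncomputable def dirichletKernel (c t : ℝ) (n m : ℤ) : ℂ :=
  freeKernel c t (n - m) - freeKernel c t (n + m)

theorem dirichletKernel_zero_left (c t : ℝ) (m : ℤ) : dirichletKernel c t 0 m = 0 := by
  rw [dirichletKernel, zero_sub, zero_add, freeKernel_neg, sub_self]

theorem hasDerivAt_dirichletKernel (c t : ℝ) (n m : ℤ) :
    HasDerivAt (fun t => dirichletKernel c t n m)
      (Complex.I * (c * (dirichletKernel c t (n + 1) m - 2 * dirichletKernel c t n m +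
        dirichletKernel c t (n - 1) m))) t := by
  refine ((hasDerivAt_freeKernel c t (n - m)).sub (hasDerivAt_freeKernel c t (n + m))).congr_deriv ?_
  have e1 : n - m + 1 = n + 1 - m := by ring
  have e2 : n - m - 1 = n - 1 - m := by ring
  have e3 : n + m + 1 = n + 1 + m := by ring
  have e4 : n + m - 1 = n - 1 + m := by ring
  simp only [dirichletKernel, e1, e2, e3, e4]
  ring

/-- The Dirichlet part of the kernel: it lives on the half line of the source. -/
noncomputable def sidedDirichletKernel (b₁ b₂ t : ℝ) (n m : ℤ) : ℂ :=
  if 0 < m then (if 0 ≤ n then dirichletKernel (b₂ ^ 2)⁻¹ t n m else 0)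
  else (if n ≤ 0 then dirichletKernel (b₁ ^ 2)⁻¹ t n m else 0)

theorem hasDerivAt_sidedDirichletKernel (b₁ b₂ t : ℝ) {n : ℤ} (hn : n ≠ 0) (m : ℤ) :
    HasDerivAt (fun t => sidedDirichletKernel b₁ b₂ t n m)
      (Complex.I * jumpLaplacian b₁ b₂ (fun n => sidedDirichletKernel b₁ b₂ t n m) n) t := by
  by_cases hm : 0 < m
  · simp only [sidedDirichletKernel, if_pos hm]
    rcases lt_or_gt_of_ne hn with hn | hn
    · rw [jumpLaplacian_of_neg b₁ b₂ _ (by omega)]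
      simp only [if_neg (show ¬ 0 ≤ n by omega), if_neg (show ¬ 0 ≤ n - 1 by omega)]
      -- Truncation is harmless even for `n = -1`: the neighbour is then the origin, where the
      -- Dirichlet kernel vanishes.
      have : (if 0 ≤ n + 1 then dirichletKernel (b₂ ^ 2)⁻¹ t (n + 1) m else 0) = 0 := by
        split_ifs with h
        · have : n + 1 = 0 := by omega
          rw [this, dirichletKernel_zero_left]
        · rfl
      rw [this]
      simpa using hasDerivAt_const t (0 : ℂ)
    · rw [jumpLaplacian_of_pos b₁ b₂ _ (by omega)]
      simp only [if_pos (show 0 ≤ n by omega), if_pos (show 0 ≤ n - 1 by omega),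
        if_pos (show 0 ≤ n + 1 by omega)]
      refine (hasDerivAt_dirichletKernel (b₂ ^ 2)⁻¹ t n m).congr_deriv ?_
      push_cast
      rfl
  · simp only [sidedDirichletKernel, if_neg hm]
    rcases lt_or_gt_of_ne hn with hn | hn
    · rw [jumpLaplacian_of_neg b₁ b₂ _ (by omega)]
      simp only [if_pos (show n ≤ 0 by omega), if_pos (show n - 1 ≤ 0 by omega),
        if_pos (show n + 1 ≤ 0 by omega)]
      refine (hasDerivAt_dirichletKernel (b₁ ^ 2)⁻¹ t n m).congr_deriv ?_
      push_cast
      rfl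
    · rw [jumpLaplacian_of_pos b₁ b₂ _ (by omega)]
      simp only [if_neg (show ¬ n ≤ 0 by omega), if_neg (show ¬ n + 1 ≤ 0 by omega)]
      have : (if n - 1 ≤ 0 then dirichletKernel (b₁ ^ 2)⁻¹ t (n - 1) m else 0) = 0 := by
        split_ifs with h
        · have : n - 1 = 0 := by omega
          rw [this, dirichletKernel_zero_left]
        · rfl
      rw [this]
      simpa using hasDerivAt_const t (0 : ℂ)

theorem sidedDirichletKernel_zero_left (b₁ b₂ t : ℝ) (m : ℤ) :
    sidedDirichletKernel b₁ b₂ t 0 m = 0 := by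
  simp [sidedDirichletKernel, dirichletKernel_zero_left]

theorem sidedDirichletKernel_time_zero (b₁ b₂ : ℝ) (n : ℤ) {m : ℤ} (hm : m ≠ 0) :
    sidedDirichletKernel b₁ b₂ 0 n m = if n = m then 1 else 0 := by
  simp only [sidedDirichletKernel, dirichletKernel, freeKernel_time_zero]
  split_ifs <;> first | omega | simp

theorem norm_sidedDirichletKernel_le {b₁ b₂ t M : ℝ} (h₁ : ∀ p, ‖freeKernel (b₁ ^ 2)⁻¹ t p‖ ≤ M)
    (h₂ : ∀ p, ‖freeKernel (b₂ ^ 2)⁻¹ t p‖ ≤ M) (n m : ℤ) :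
    ‖sidedDirichletKernel b₁ b₂ t n m‖ ≤ 2 * M := by
  have hM : 0 ≤ M := (norm_nonneg _).trans (h₁ 0)
  unfold sidedDirichletKernel dirichletKernel
  split_ifs
  · refine (norm_sub_le _ _).trans ?_; linarith [h₂ (n - m), h₂ (n + m)]
  · simpa using hM
  · refine (norm_sub_le _ _).trans ?_; linarith [h₁ (n - m), h₁ (n + m)]
  · simpa using hM

/-- The kernel with source away from the origin. -/
theorem IsScatteringData.jumpKernel_eq {b₁ b₂ : ℝ} {r T : ℂ → ℂ} (h : IsScatteringData b₁ b₂ r T)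
    (t : ℝ) (n : ℤ) {m : ℤ} (hm : m ≠ 0) :
    jumpKernel b₁ b₂ t n m =
      sidedDirichletKernel b₁ b₂ t n m + oscAverage (b₁ ^ 2)⁻¹ t (transIntegrand r T n m) := by
  refine (isBoundedJumpSolution_jumpKernel b₁ b₂ m).eq_of_eq_zero
    (w := fun t n => sidedDirichletKernel b₁ b₂ t n m +
      oscAverage (b₁ ^ 2)⁻¹ t (transIntegrand r T n m)) (fun t => ?_) (fun t n hn => ?_)
    (fun R => ?_) (fun n => ?_) t n
  -- Symmetry turns the value at the origin into the kernel with source at the origin. The equation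
  -- at the origin need not be checked for this source.
  · rw [jumpKernel_symm, h.jumpKernel_origin, sidedDirichletKernel_zero_left, zero_add]
    congr 1
    funext z
    simp only [transIntegrand]
    ring
  · refine ((hasDerivAt_sidedDirichletKernel b₁ b₂ t hn m).add
      (h.hasDerivAt_oscAverage_transIntegrand t hn m)).congr_deriv ?_
    rw [← mul_add, ← jumpLaplacian_add]
    rfl
  · obtain ⟨B, hB⟩ := h.exists_norm_transIntegrand_le
    refine ⟨2 * 1 + B, fun t _ n => (norm_add_le _ _).trans (add_le_add ?_ ?_)⟩
    · exact norm_sidedDirichletKernel_le (norm_freeKernel_le_one _ t)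
        (norm_freeKernel_le_one _ t) n m
    · exact norm_oscAverage_le _ t (hB n m)
  · have hnm : ¬(n = 0 ∧ m = 0) := fun h => hm h.2
    rw [sidedDirichletKernel_time_zero b₁ b₂ n hm, h.oscAverage_transIntegrand_time_zero,
      if_neg hnm, add_zero, Pi.single_apply]

/-! ### Decay of the kernel and conclusion -/

open ComplexConjugate Real in
/-- Averages over the circle of conjugation invariant functions reduce to the upper half circle. -/
theorem norm_oscAverage_le_of_upper {c M : ℝ} {g : ℂ → ℂ}
    (hg : ContinuousOn g (Metric.sphere 0 1)) (hconj : ∀ z, ‖z‖ = 1 → g (conj z) = conj (g z))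
    {t : ℝ}
    (hM : ∀ s, |s| = |t| → ‖∫ θ in 0..π, circlePhase c s (Complex.exp (θ * Complex.I)) *
      g (Complex.exp (θ * Complex.I))‖ ≤ M) :
    ‖oscAverage c t g‖ ≤ M := by
  have hpi := pi_pos
  have hM0 : 0 ≤ M := (norm_nonneg _).trans (hM t rfl)
  have hexp : ∀ θ : ℝ, circleMap 0 1 θ = Complex.exp (θ * Complex.I) := by
    intro θ; simp [circleMap]
  set G : ℝ → ℝ → ℂ := fun s θ => circlePhase c s (Complex.exp (θ * Complex.I)) *
      g (Complex.exp (θ * Complex.I)) with hG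
  have hexpc : Continuous fun θ : ℝ => Complex.exp (θ * Complex.I) := by fun_prop
  have hGc : ∀ s, Continuous (G s) := fun s =>
    ((continuous_circlePhase c s).comp hexpc).mul
      (hg.comp_continuous hexpc fun θ => by simp [Complex.norm_exp_ofReal_mul_I])
  -- Conjugation carries the lower half circle to the upper one but reverses time, which is why both
  -- signs of `s` occur in the hypothesis.
  have hsym : ∀ θ : ℝ, G t (2 * π - θ) = conj (G (-t) θ) := by
    intro θ
    have h1 : Complex.exp ((2 * π - θ : ℝ) * Complex.I) = conj (Complex.exp (θ * Complex.I)) := by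
      rw [← Complex.exp_conj]
      have : ((2 * π - θ : ℝ) : ℂ) * Complex.I = conj ((θ : ℂ) * Complex.I) + 2 * π * Complex.I := by
        simp only [map_mul, Complex.conj_ofReal, Complex.conj_I]
        push_cast
        ring
      rw [this, Complex.exp_add, Complex.exp_two_pi_mul_I, mul_one]
    simp only [hG]
    rw [h1, hconj _ (Complex.norm_exp_ofReal_mul_I θ), map_mul]
    congr 1
    simp only [circlePhase, Complex.conj_re]
    rw [← Complex.exp_conj]
    congr 1
    simp only [map_mul, Complex.conj_ofReal, Complex.conj_I]
    push_cast
    ring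
  have hlow : ∫ θ in π..(2 * π), G t θ = conj (∫ θ in 0..π, G (-t) θ) := by
    rw [← intervalIntegral.intervalIntegral_conj]
    have h := intervalIntegral.integral_comp_sub_left (a := 0) (b := π) (G t) (2 * π)
    rw [sub_zero, two_mul, add_sub_cancel_right, ← two_mul] at h
    rw [← h]
    exact intervalIntegral.integral_congr fun θ _ => hsym θ
  have hint : oscAverage c t g = (2 * π)⁻¹ • ∫ θ in 0..(2 * π), G t θ := by
    rw [oscAverage_eq_integral]
    simp only [hexp, hG]
  rw [hint, ← intervalIntegral.integral_add_adjacent_intervals (b := π)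
    ((hGc t).intervalIntegrable _ _) ((hGc t).intervalIntegrable _ _), hlow, norm_smul, norm_inv,
    norm_eq_abs, abs_of_pos (by positivity), inv_mul_le_iff₀ (by positivity)]
  refine (norm_add_le _ _).trans ?_
  rw [RCLike.norm_conj]
  have h1 := hM t rfl
  have h2 := hM (-t) (abs_neg t)
  have h3 : 2 * M ≤ 2 * π * M := by
    have := pi_gt_three
    nlinarith
  linarith

theorem circlePhase_cexp (c t θ : ℝ) : circlePhase c t (Complex.exp (θ * Complex.I)) =
    Complex.exp ((2 * c * t * Real.cos θ + -(2 * c * t) : ℝ) * Complex.I) := by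
  unfold circlePhase
  rw [Complex.exp_ofReal_mul_I_re]
  congr 3
  ring

open ComplexConjugate Real in
/-- Decay of the kernel with constant coefficient. -/
theorem exists_norm_freeKernel_le {c : ℝ} (hc : 0 < c) :
    ∃ C : ℝ, 0 < C ∧ ∀ (t : ℝ) (p : ℤ), 1 ≤ |t| →
      ‖freeKernel c t p‖ ≤ C * |t| ^ (-(1 / 3 : ℝ)) := by
  have hc2 : 0 < 2 * c := by linarith
  obtain ⟨C, hC, hb⟩ := exists_subintervalBound_cos hc2
  refine ⟨C, hC, fun t p ht => ?_⟩
  refine norm_oscAverage_le_of_upper (continuousOn_zpow_sphere p) (fun z _ => by simp) ?_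
  intro s hs
  have h := hb s p (-(2 * c * s)) (by rwa [hs]) 0 π le_rfl pi_pos.le le_rfl
  rw [hs] at h
  refine le_of_eq_of_le (congrArg _ (intervalIntegral.integral_congr fun θ _ => ?_)) h
  rw [circlePhase_cexp, ← Complex.exp_int_mul, ← Complex.exp_add]
  congr 1
  push_cast
  ring

theorem jumpWave_eq_mul (r : ℂ → ℂ) (n : ℤ) (z : ℂ) :
    jumpWave r n z = z ^ (if n < 0 then n.natAbs else 0) * r z ^ (if n < 0 then 0 else n.natAbs) := by
  unfold jumpWave
  split_ifs <;> simp

/-- Each wave is a power of `z` or of `r`, so the product of two has nonnegative total exponents `j`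
and `k`. This sign is what excludes cancellation in the third derivative of the phase. -/
theorem circlePhase_mul_transIntegrand {c κ θ : ℝ} (hκ : 1 < κ) (h0 : 0 ≤ θ) (h1 : θ ≤ Real.pi)
    (t : ℝ) (n m : ℤ) :
    circlePhase c t (Complex.exp (θ * Complex.I)) *
      transIntegrand (rightRoot κ) (transCoeff κ) n m (Complex.exp (θ * Complex.I)) =
      2 / (κ ^ 2 - 1) * bandIntegrand c κ t
        ((if n < 0 then n.natAbs else 0) + (if m < 0 then m.natAbs else 0))
        ((if n < 0 then 0 else n.natAbs) + (if m < 0 then 0 else m.natAbs)) θ := by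
  rw [transIntegrand, jumpWave_eq_mul, jumpWave_eq_mul, rightRoot_cexp hκ h0 h1,
    transCoeff_cexp hκ h0 h1, circlePhase_cexp, bandIntegrand]
  generalize (if n < 0 then n.natAbs else 0) = j₁
  generalize (if m < 0 then m.natAbs else 0) = j₂
  generalize (if n < 0 then 0 else n.natAbs) = k₁
  generalize (if m < 0 then 0 else m.natAbs) = k₂
  have e : Complex.exp ((2 * c * t * Real.cos θ + (j₁ + j₂ : ℕ) * θ + -(2 * c * t) : ℝ) *
      Complex.I) = Complex.exp ((2 * c * t * Real.cos θ + -(2 * c * t) : ℝ) * Complex.I) *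
        Complex.exp (θ * Complex.I) ^ j₁ * Complex.exp (θ * Complex.I) ^ j₂ := by
    rw [← Complex.exp_nat_mul, ← Complex.exp_nat_mul, ← Complex.exp_add, ← Complex.exp_add]
    congr 1
    push_cast
    ring
  rw [e, ← pow_mul, ← pow_mul, mul_add 2 k₁ k₂, pow_add]
  ring

open ComplexConjugate Real in
/-- Decay of the transmitted part of the kernel. -/
theorem exists_norm_oscAverage_transIntegrand_le {b₁ b₂ : ℝ} (h₁ : 0 < b₁) (h : b₁ < b₂) :
    ∃ C : ℝ, 0 < C ∧ ∀ (t : ℝ) (n m : ℤ), 1 ≤ |t| →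
      ‖oscAverage (b₁ ^ 2)⁻¹ t (transIntegrand (rightRoot (b₂ / b₁)) (transCoeff (b₂ / b₁)) n m)‖ ≤
        C * |t| ^ (-(1 / 3 : ℝ)) := by
  have hdata := isScatteringData_rightRoot h₁ h
  have hκ : 1 < b₂ / b₁ := (one_lt_div h₁).2 h
  set κ := b₂ / b₁
  have hc : 0 < (b₁ ^ 2)⁻¹ := by positivity
  have hκ1 : 0 < κ ^ 2 - 1 := by nlinarith
  obtain ⟨C, hC, hb⟩ := exists_norm_integral_bandIntegrand_le hc hκ
  refine ⟨2 / (κ ^ 2 - 1) * C, by positivity, fun t n m ht => ?_⟩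
  refine norm_oscAverage_le_of_upper (hdata.continuousOn_transIntegrand n m) (fun z hz => ?_) ?_
  · simp only [transIntegrand, jumpWave_eq_mul, rightRoot_conj κ hz.le, transCoeff_conj κ hz.le,
      map_mul, map_pow, map_ofNat]
  · intro s hs
    rw [intervalIntegral.integral_congr (fun θ hθ =>
      circlePhase_mul_transIntegrand hκ (Set.uIcc_of_le pi_pos.le ▸ hθ).1
        (Set.uIcc_of_le pi_pos.le ▸ hθ).2 s n m), intervalIntegral.integral_const_mul, norm_mul]
    have e : ‖(2 : ℂ) / ((κ : ℂ) ^ 2 - 1)‖ = 2 / (κ ^ 2 - 1) := by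
      have : (2 : ℂ) / ((κ : ℂ) ^ 2 - 1) = ((2 / (κ ^ 2 - 1) : ℝ) : ℂ) := by push_cast; rfl
      rw [this, Complex.norm_real, norm_eq_abs, abs_of_pos (by positivity)]
    rw [e, mul_assoc, ← hs]
    exact mul_le_mul_of_nonneg_left (hb s _ _ (by rwa [hs])) (by positivity)

/-- Decay of the kernel from the decay of its transmitted part. -/
theorem IsScatteringData.exists_norm_jumpKernel_le {b₁ b₂ : ℝ} (h₁ : 0 < b₁) (h₂ : 0 < b₂)
    {r T : ℂ → ℂ} (h : IsScatteringData b₁ b₂ r T)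
    (hdecay : ∃ C : ℝ, 0 < C ∧ ∀ (t : ℝ) (n m : ℤ), 1 ≤ |t| →
      ‖oscAverage (b₁ ^ 2)⁻¹ t (transIntegrand r T n m)‖ ≤ C * |t| ^ (-(1 / 3 : ℝ))) :
    ∃ C : ℝ, 0 < C ∧ ∀ (t : ℝ) (n m : ℤ), 1 ≤ |t| →
      ‖jumpKernel b₁ b₂ t n m‖ ≤ C * |t| ^ (-(1 / 3 : ℝ)) := by
  obtain ⟨C, hC, hb⟩ := hdecay
  obtain ⟨C₁, hC₁, hb₁⟩ := exists_norm_freeKernel_le (c := (b₁ ^ 2)⁻¹) (by positivity)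
  obtain ⟨C₂, hC₂, hb₂⟩ := exists_norm_freeKernel_le (c := (b₂ ^ 2)⁻¹) (by positivity)
  refine ⟨2 * (C₁ + C₂) + C, by positivity, fun t n m ht => ?_⟩
  have hτ : 0 < |t| ^ (-(1 / 3 : ℝ)) := Real.rpow_pos_of_pos (by linarith) _
  by_cases hm : m = 0
  · subst hm
    rw [h.jumpKernel_origin]
    refine (hb t n 0 ht).trans ?_
    gcongr
    linarith
  · rw [h.jumpKernel_eq t n hm, add_mul, mul_assoc]
    refine (norm_add_le _ _).trans (add_le_add ?_ (hb t n m ht))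
    refine norm_sidedDirichletKernel_le (fun p => (hb₁ t p ht).trans ?_)
      (fun p => (hb₂ t p ht).trans ?_) n m <;> gcongr <;> linarith

/-- Equal coefficients need a separate argument because of the factor `1 / (κ² - 1)`. Without a jump
the transmitted part is the free kernel at distance `|n| + |m|`. -/
theorem exists_norm_jumpKernel_le_of_le {b₁ b₂ : ℝ} (h₁ : 0 < b₁) (h : b₁ ≤ b₂) :
    ∃ C : ℝ, 0 < C ∧ ∀ (t : ℝ) (n m : ℤ), 1 ≤ |t| →
      ‖jumpKernel b₁ b₂ t n m‖ ≤ C * |t| ^ (-(1 / 3 : ℝ)) := by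
  rcases h.eq_or_lt with rfl | h
  · refine isScatteringData_id.exists_norm_jumpKernel_le h₁ h₁ ?_
    obtain ⟨C, hC, hb⟩ := exists_norm_freeKernel_le (c := (b₁ ^ 2)⁻¹) (by positivity)
    refine ⟨C, hC, fun t n m ht => ?_⟩
    have : oscAverage (b₁ ^ 2)⁻¹ t (transIntegrand id (fun _ => 1 / 2) n m) =
        freeKernel (b₁ ^ 2)⁻¹ t (n.natAbs + m.natAbs : ℕ) := by
      refine oscAverage_congr _ t fun z _ => ?_
      simp only [transIntegrand, jumpWave, id, ite_self, zpow_natCast, pow_add]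
      ring
    rw [this]
    exact hb t _ ht
  · exact (isScatteringData_rightRoot h₁ h).exists_norm_jumpKernel_le h₁ (h₁.trans h)
      (exists_norm_oscAverage_transIntegrand_le h₁ h)

theorem jumpKernel_reflect (b₁ b₂ t : ℝ) (n m : ℤ) :
    jumpKernel b₁ b₂ t n m = jumpKernel b₂ b₁ t (-n) (-m) := by
  have h := (isBoundedJumpSolution_jumpKernel b₂ b₁ (-m)).reflect
  refine (isBoundedJumpSolution_jumpKernel b₁ b₂ m).eq ⟨h.hasDerivAt, h.bounded, fun j => ?_⟩ t n
  rw [h.initial, Pi.single_apply, Pi.single_apply]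
  simp only [neg_inj]

/-- The dispersive estimate for the kernel. -/
theorem exists_norm_jumpKernel_le {b₁ b₂ : ℝ} (h₁ : 0 < b₁) (h₂ : 0 < b₂) :
    ∃ C : ℝ, 0 < C ∧ ∀ (t : ℝ) (n m : ℤ),
      ‖jumpKernel b₁ b₂ t n m‖ ≤ C * (|t| + 1) ^ (-(1 / 3 : ℝ)) := by
  have hlarge : ∃ C : ℝ, 0 < C ∧ ∀ (t : ℝ) (n m : ℤ), 1 ≤ |t| →
      ‖jumpKernel b₁ b₂ t n m‖ ≤ C * |t| ^ (-(1 / 3 : ℝ)) := by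
    rcases le_total b₁ b₂ with h | h
    · exact exists_norm_jumpKernel_le_of_le h₁ h
    · obtain ⟨C, hC, hb⟩ := exists_norm_jumpKernel_le_of_le h₂ h
      refine ⟨C, hC, fun t n m ht => ?_⟩
      rw [jumpKernel_reflect]
      exact hb t (-n) (-m) ht
  obtain ⟨C, hC, hb⟩ := hlarge
  obtain ⟨B, hB⟩ := exists_norm_jumpGroup_le b₁ b₂ 1
  have hB0 : 0 ≤ B := (norm_nonneg _).trans (hB 0 (by simp))
  -- Replaces `|t|` by `|t| + 1`: used with `x = |t|` for `|t| ≥ 1`, and with `x = 1` for `|t| ≤ 1`,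
  -- where the operator norm of the group is bounded by compactness.
  have key : ∀ {x y : ℝ}, 0 < x → y ≤ 2 * x → 0 < y →
      x ^ (-(1 / 3 : ℝ)) ≤ 2 * y ^ (-(1 / 3 : ℝ)) := by
    intro x y hx hyx hy
    have h2 : (1 / 2 : ℝ) ≤ 2 ^ (-(1 / 3 : ℝ)) := by
      have := Real.rpow_le_rpow_of_exponent_le (x := 2) one_le_two
        (show (-1 : ℝ) ≤ -(1 / 3) by norm_num)
      rw [Real.rpow_neg_one] at this
      linarith
    have h3 := Real.rpow_le_rpow_of_nonpos hy hyx (show -(1 / 3 : ℝ) ≤ 0 by norm_num)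
    rw [Real.mul_rpow zero_le_two hx.le] at h3
    have h4 : 0 < x ^ (-(1 / 3 : ℝ)) := Real.rpow_pos_of_pos hx _
    nlinarith
  refine ⟨2 * C + 2 * B, by positivity, fun t n m => ?_⟩
  have hτ : 0 < (|t| + 1) ^ (-(1 / 3 : ℝ)) := Real.rpow_pos_of_pos (by positivity) _
  rcases le_total 1 |t| with ht | ht
  · have h3 := key (x := |t|) (y := |t| + 1) (by linarith) (by linarith) (by linarith)
    calc _ ≤ C * |t| ^ (-(1 / 3 : ℝ)) := hb t n m ht
      _ ≤ C * (2 * (|t| + 1) ^ (-(1 / 3 : ℝ))) := by gcongr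
      _ = 2 * C * (|t| + 1) ^ (-(1 / 3 : ℝ)) := by ring
      _ ≤ _ := by gcongr; linarith
  · have h3 := key (x := 1) (y := |t| + 1) one_pos (by linarith) (by positivity)
    rw [Real.one_rpow] at h3
    have h4 := norm_jumpGroup_apply_apply_le b₁ b₂ t (lp.single 2 m (1 : ℂ)) n
    rw [lp.norm_single (by norm_num), norm_one, mul_one] at h4
    calc _ ≤ ‖jumpGroup b₁ b₂ t‖ := h4
      _ ≤ B * 1 := by rw [mul_one]; exact hB t ht
      _ ≤ B * (2 * (|t| + 1) ^ (-(1 / 3 : ℝ))) := by gcongr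
      _ = 2 * B * (|t| + 1) ^ (-(1 / 3 : ℝ)) := by ring
      _ ≤ _ := by gcongr; linarith

theorem theorem2p2 (b₁ b₂ : ℝ) (hb₁ : 0 < b₁) (hb₂ : 0 < b₂) :
    (∀ φ : lp (fun _ : ℤ => ℂ) 2,
      ∃! u : ℝ → lp (fun _ : ℤ => ℂ) 2, IsJumpSolution b₁ b₂ φ u) ∧
    (∃ C : ℝ, 0 < C ∧
      ∀ (φ : lp (fun _ : ℤ => ℂ) 1) (u : ℝ → lp (fun _ : ℤ => ℂ) 2),
        IsJumpSolution b₁ b₂ φ u →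
          ∀ t : ℝ, ‖lp.linearMapOfLE ℂ (fun _ : ℤ => ℂ) (le_top : (2 : ℝ≥0∞) ≤ ∞) (u t)‖
            ≤ C * (|t| + 1) ^ (-(1 / 3 : ℝ)) * ‖φ‖) := by
  refine ⟨existsUnique_isJumpSolution b₁ b₂, ?_⟩
  obtain ⟨C, hC, hb⟩ := exists_norm_jumpKernel_le hb₁ hb₂
  exact ⟨C, hC, fun φ u hu t => norm_solution_le_of_norm_jumpKernel_le (hb t) φ hu⟩
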